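/- A \emph{Tangle} is a smooth (i.e. with continuous unit tangent) simple closed curve in the plane that is the union of finitely many links, each link being a quarter of a circle; all circles have the same radius, say $1$, and, after a rotation, all end points of links lie in intercardinal directions (NE, NW, SW, SE) from the centres of their circles. The \emph{length} of a Tangle is its number of links; a Tangle of length $4c$ has \emph{class} $c$. The circles of the links belong to a square packing of the plane by unit circles, coloured black and white like a chessboard so that the circles of those links whose circle lies inside the Tangle are black. The \emph{dual graph} of the Tangle has as vertices the centres of all black circles inside the Tangle, two of them being joined by an edge if the segment between them does not meet the Tangle and meets no other circle of the packing. The \emph{size} of a Tangle is the number of edges of its dual graph. Two Tangles are equivalent as \emph{fixed} Tangles if they differ by a translation, as \emph{one-sided} Tangles if they differ by translations and rotations, and as \emph{free} Tangles if they differ by translations, rotations and reflections. Let $a_0(m),a_1(m),a_2(m)$ be the numbers of fixed, one-sided and free Tangles of size $m$, and let $\ell_0(c),\ell_1(c),\ell_2(c)$ be the numbers of fixed, one-sided and free Tangles of class $c$. A \emph{hole-free polyomino} is a nonempty finite set of cells of the square grid such that both the set and its complement are connected through edges. Let $a_p(m)$ be the number of hole-free polyominoes with $m$ cells, and $\ell_p(c)$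 the number of hole-free polyominoes with perimeter $2c$, both counted up to translation. \textbf{Theorem.} The limits $$\kappa_p=\lim_{m\to\infty}a_p(m)^{1/m},\qquad \mu_p=\lim_{c\to\infty}\ell_p(c)^{1/c},\qquad \kappa=\lim_{m\to\infty}a_0(m)^{1/m},\qquad \mu=\lim_{c\to\infty}\ell_0(c)^{1/c}$$ exist (as real numbers). Moreover $\lim_{m\to\infty}a_i(m)^{1/m}=\kappa$ and $\lim_{c\to\infty}\ell_i(c)^{1/c}=\mu$ for $i=0,1,2$, and $$\kappa_p\le\kappa\le\kappa_p^2,\qquad \mu_p\le\mu\le\mu_p^2 .$$ -/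

import Mathlib

namespace TangleGrowth

/-! ### Counting equivalence classes -/

/-- The number of classes of the equivalence relation `r` that meet `S`. -/
noncomputable def classCount {α : Type*} (r : Setoid α) (S : Set α) : ℕ :=
  ((fun x : α => Quotient.mk r x) '' S).ncard

/-! ### Tangles

The plane is `ℂ`.  Tangles are normalised: their circles have radius `1`, and their joints lie at
intercardinal points (directions `π/4 + j π/2`) of these circles. -/

/-- The point at arc length `s` on the link (quarter circle, `0 ≤ s ≤ π/2`) of the unit circle with
centre `c` that starts at the intercardinal direction `π/4 + j π/2` and runs counterclockwise
(`ε = 1`) or clockwise (`ε = -1`). -/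
noncomputable def linkPoint (c : ℂ) (j : ℤ) (ε : ℤˣ) (s : ℝ) : ℂ :=
  c + Complex.exp (((Real.pi / 4 + j * (Real.pi / 2) + ((ε : ℤ) : ℝ) * s : ℝ) : ℂ) * Complex.I)

/-- The unit tangent vector of a link at arc length `s`. -/
noncomputable def linkTangent (j : ℤ) (ε : ℤˣ) (s : ℝ) : ℂ :=
  ((ε : ℤ) : ℂ) * Complex.I *
    Complex.exp (((Real.pi / 4 + j * (Real.pi / 2) + ((ε : ℤ) : ℝ) * s : ℝ) : ℂ) * Complex.I)

/-- `linkTangent` is the velocity of `linkPoint`. -/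
theorem hasDerivAt_linkPoint (c : ℂ) (j : ℤ) (ε : ℤˣ) (s : ℝ) :
    HasDerivAt (linkPoint c j ε) (linkTangent j ε s) s := by
  have h1 : HasDerivAt (fun s : ℝ => Real.pi / 4 + j * (Real.pi / 2) + ((ε : ℤ) : ℝ) * s)
      ((ε : ℤ) : ℝ) s := by
    simpa using ((hasDerivAt_id s).const_mul (((ε : ℤ) : ℝ))).const_add
      (Real.pi / 4 + j * (Real.pi / 2))
  have h2 := ((h1.ofReal_comp.mul_const Complex.I).cexp).const_add c
  have h3 : linkTangent j ε s =
      Complex.exp (((Real.pi / 4 + j * (Real.pi / 2) + ((ε : ℤ) : ℝ) * s : ℝ) : ℂ) * Complex.I) *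
        ((((ε : ℤ) : ℝ) : ℂ) * Complex.I) := by
    unfold linkTangent
    push_cast
    ring
  rw [h3]
  exact h2

/-- `Γ` is a (planar, normalised) Tangle of length `n`: a simple closed curve composed of `n` links,
cyclically indexed by `ZMod n`, with a continuous unit tangent. -/
def IsTangleOfLength (n : ℕ) (Γ : Set ℂ) : Prop :=
  0 < n ∧ ∃ (c : ZMod n → ℂ) (j : ZMod n → ℤ) (ε : ZMod n → ℤˣ),
    -- each link ends where the next one starts
    (∀ k, linkPoint (c k) (j k) (ε k) (Real.pi / 2)
      = linkPoint (c (k + 1)) (j (k + 1)) (ε (k + 1)) 0) ∧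
    -- the curve is smooth: the tangents agree at the joints
    (∀ k, linkTangent (j k) (ε k) (Real.pi / 2) = linkTangent (j (k + 1)) (ε (k + 1)) 0) ∧
    -- the curve is simple: no point is visited twice in one period
    (∀ k k' : ZMod n, ∀ s ∈ Set.Ico 0 (Real.pi / 2), ∀ s' ∈ Set.Ico 0 (Real.pi / 2),
      linkPoint (c k) (j k) (ε k) s = linkPoint (c k') (j k') (ε k') s' → k = k' ∧ s = s') ∧
    -- `Γ` is the union of the links
    Γ = ⋃ k, linkPoint (c k) (j k) (ε k) '' Set.Icc 0 (Real.pi / 2)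

/-- A Tangle of any length. -/
def IsTangle (Γ : Set ℂ) : Prop := ∃ n, IsTangleOfLength n Γ

/-- The points inside a closed curve: those whose component in the complement is bounded. -/
def inside (Γ : Set ℂ) : Set ℂ :=
  {z | z ∉ Γ ∧ Bornology.IsBounded (connectedComponentIn Γᶜ z)}

/-- `c` is the centre of the unit circle of some link of `Γ`. -/
def IsLinkCenter (Γ : Set ℂ) (c : ℂ) : Prop :=
  ∃ j : ℤ, ∀ s ∈ Set.Icc 0 (Real.pi / 2), linkPoint c j 1 s ∈ Γ

/-- Centres of all circles of the square packing by unit circles that contains the circles of the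
links of `Γ` lying inside `Γ`.  Kissing circles have centres that differ by `√2 (±1 ± i)`. -/
def packingCenters (Γ : Set ℂ) : Set ℂ :=
  {z | ∃ c, IsLinkCenter Γ c ∧ c ∈ inside Γ ∧ ∃ a b : ℤ, Even (a + b) ∧
    z = c + (Real.sqrt 2 : ℂ) * ((a : ℂ) + (b : ℂ) * Complex.I)}

/-- Centres of the black circles of the packing: in the chessboard colouring, the colour of the
circles of the links of `Γ` lying inside `Γ`. -/
def blackCenters (Γ : Set ℂ) : Set ℂ :=
  {z | ∃ c, IsLinkCenter Γ c ∧ c ∈ inside Γ ∧ ∃ a b : ℤ, Even a ∧ Even b ∧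
    z = c + (Real.sqrt 2 : ℂ) * ((a : ℂ) + (b : ℂ) * Complex.I)}

/-- The vertices of the dual graph: centres of the black circles inside `Γ`. -/
def dualVertices (Γ : Set ℂ) : Set ℂ := blackCenters Γ ∩ inside Γ

/-- The edges of the dual graph: two vertices are joined if the segment between them does not meet
`Γ` and meets no circle (disc) of the packing other than the two at its ends. -/
def dualGraph (Γ : Set ℂ) : SimpleGraph ℂ where
  Adj z w := z ≠ w ∧ z ∈ dualVertices Γ ∧ w ∈ dualVertices Γ ∧
    Disjoint (segment ℝ z w) Γ ∧
    ∀ c ∈ packingCenters Γ, c ≠ z → c ≠ w →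
      Disjoint (segment ℝ z w) (Metric.closedBall c 1)
  symm := ⟨by
    rintro z w ⟨h1, h2, h3, h4, h5⟩
    refine ⟨h1.symm, h3, h2, ?_, fun c hc hw hz => ?_⟩
    · rwa [segment_symm]
    · rw [segment_symm]
      exact h5 c hc hz hw⟩
  loopless := ⟨fun _ h => h.1 rfl⟩

/-- The size of a Tangle: the number of edges of its dual graph. -/
noncomputable def size (Γ : Set ℂ) : ℕ := (dualGraph Γ).edgeSet.ncard

/-- Fixed equivalence: translations. -/
def fixedSetoid : Setoid (Set ℂ) where
  r Γ Γ' := ∃ b : ℂ, Γ' = (fun z => z + b) '' Γ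
  iseqv := by
    refine ⟨fun Γ => ⟨0, by simp⟩, ?_, ?_⟩
    · rintro Γ _ ⟨b, rfl⟩
      refine ⟨-b, ?_⟩
      simp only [Set.image_image, add_neg_cancel_right, Set.image_id']
    · rintro Γ _ _ ⟨b, rfl⟩ ⟨b', rfl⟩
      exact ⟨b + b', by simp only [Set.image_image, add_assoc]⟩

/-- One-sided equivalence: translations and rotations. -/
def oneSidedSetoid : Setoid (Set ℂ) where
  r Γ Γ' := ∃ (u : Circle) (b : ℂ), Γ' = (fun z => (u : ℂ) * z + b) '' Γ
  iseqv := by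
    refine ⟨fun Γ => ⟨1, 0, by simp⟩, ?_, ?_⟩
    · rintro Γ _ ⟨u, b, rfl⟩
      refine ⟨u⁻¹, -((u⁻¹ : Circle) : ℂ) * b, ?_⟩
      have h : ∀ z : ℂ, ((u⁻¹ : Circle) : ℂ) * ((u : ℂ) * z + b) + -((u⁻¹ : Circle) : ℂ) * b = z := by
        intro z
        have hu : ((u⁻¹ : Circle) : ℂ) * (u : ℂ) = 1 := by
          rw [← Circle.coe_mul, inv_mul_cancel, Circle.coe_one]
        linear_combination z * hu
      simp only [Set.image_image, h, Set.image_id']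
    · rintro Γ _ _ ⟨u, b, rfl⟩ ⟨u', b', rfl⟩
      refine ⟨u' * u, (u' : ℂ) * b + b', ?_⟩
      rw [Set.image_image]
      refine Set.image_congr fun z _ => ?_
      push_cast
      ring

/-- Free equivalence: translations, rotations and reflections. -/
def freeSetoid : Setoid (Set ℂ) where
  r Γ Γ' := ∃ (u : Circle) (b : ℂ), Γ' = (fun z => (u : ℂ) * z + b) '' Γ ∨
    Γ' = (fun z => (u : ℂ) * (starRingEnd ℂ) z + b) '' Γ
  iseqv := by
    have hinv : ∀ u : Circle, ((u⁻¹ : Circle) : ℂ) * (u : ℂ) = 1 := fun u => by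
      rw [← Circle.coe_mul, inv_mul_cancel, Circle.coe_one]
    have hconj : ∀ u : Circle, (u : ℂ) * (starRingEnd ℂ) (u : ℂ) = 1 := fun u => by
      rw [Complex.mul_conj, Circle.normSq_coe, Complex.ofReal_one]
    refine ⟨fun Γ => ⟨1, 0, Or.inl (by simp)⟩, ?_, ?_⟩
    · rintro Γ _ ⟨u, b, rfl | rfl⟩
      · refine ⟨u⁻¹, -((u⁻¹ : Circle) : ℂ) * b, Or.inl ?_⟩
        have h : ∀ z : ℂ,
            ((u⁻¹ : Circle) : ℂ) * ((u : ℂ) * z + b) + -((u⁻¹ : Circle) : ℂ) * b = z := by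
          intro z
          linear_combination z * hinv u
        simp only [Set.image_image, h, Set.image_id']
      · refine ⟨u, -(u : ℂ) * (starRingEnd ℂ) b, Or.inr ?_⟩
        have h : ∀ z : ℂ, (u : ℂ) * (starRingEnd ℂ) ((u : ℂ) * (starRingEnd ℂ) z + b)
            + -(u : ℂ) * (starRingEnd ℂ) b = z := by
          intro z
          simp only [map_add, map_mul, Complex.conj_conj]
          linear_combination z * hconj u
        simp only [Set.image_image, h, Set.image_id']
    · rintro Γ _ _ ⟨u, b, rfl | rfl⟩ ⟨u', b', rfl | rfl⟩
      · refine ⟨u' * u, (u' : ℂ) * b + b', Or.inl ?_⟩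
        rw [Set.image_image]
        refine Set.image_congr fun z _ => ?_
        push_cast
        ring
      · refine ⟨u' * u⁻¹, (u' : ℂ) * (starRingEnd ℂ) b + b', Or.inr ?_⟩
        rw [Set.image_image]
        refine Set.image_congr fun z _ => ?_
        simp only [map_add, map_mul, Circle.coe_mul, Circle.coe_inv_eq_conj]
        ring
      · refine ⟨u' * u, (u' : ℂ) * b + b', Or.inr ?_⟩
        rw [Set.image_image]
        refine Set.image_congr fun z _ => ?_
        push_cast
        ring
      · refine ⟨u' * u⁻¹, (u' : ℂ) * (starRingEnd ℂ) b + b', Or.inl ?_⟩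
        rw [Set.image_image]
        refine Set.image_congr fun z _ => ?_
        simp only [map_add, map_mul, Complex.conj_conj, Circle.coe_mul, Circle.coe_inv_eq_conj]
        ring

/-- The number of Tangles of size `m`, up to the equivalence `r`. -/
noncomputable def tanglesOfSize (r : Setoid (Set ℂ)) (m : ℕ) : ℕ :=
  classCount r {Γ | IsTangle Γ ∧ size Γ = m}

/-- The number of Tangles of class `c`, i.e. of length `4 c`, up to the equivalence `r`. -/
noncomputable def tanglesOfClass (r : Setoid (Set ℂ)) (c : ℕ) : ℕ :=
  classCount r {Γ | IsTangleOfLength (4 * c) Γ}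

/-! ### Polyominoes

A cell is identified with the position of its lower left corner in `ℤ × ℤ`. -/

/-- The four cells sharing an edge with `x`. -/
def cellNeighbors (x : ℤ × ℤ) : Finset (ℤ × ℤ) :=
  {(x.1 + 1, x.2), (x.1 - 1, x.2), (x.1, x.2 + 1), (x.1, x.2 - 1)}

/-- Two cells are adjacent if they share an edge. -/
def cellGraph : SimpleGraph (ℤ × ℤ) where
  Adj x y := y ∈ cellNeighbors x
  symm := ⟨by
    rintro ⟨a, b⟩ ⟨c, d⟩ h
    simp only [cellNeighbors, Finset.mem_insert, Finset.mem_singleton, Prod.mk.injEq] at h ⊢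
    omega⟩
  loopless := ⟨by
    rintro ⟨a, b⟩ h
    simp only [cellNeighbors, Finset.mem_insert, Finset.mem_singleton, Prod.mk.injEq] at h
    omega⟩

/-- A hole-free polyomino: a nonempty finite edge-connected set of cells whose complement is
edge-connected as well (so that its boundary is a single self-avoiding polygon). -/
def IsHoleFreePolyomino (P : Finset (ℤ × ℤ)) : Prop :=
  (cellGraph.induce (P : Set (ℤ × ℤ))).Connected ∧
    (cellGraph.induce ((P : Set (ℤ × ℤ))ᶜ)).Connected

/-- The perimeter: the number of unit edges between a cell of `P` and a cell outside `P`. -/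
def perimeter (P : Finset (ℤ × ℤ)) : ℕ := ∑ x ∈ P, (cellNeighbors x \ P).card

/-- Fixed equivalence of polyominoes: translations. -/
def polyominoSetoid : Setoid (Finset (ℤ × ℤ)) where
  r P Q := ∃ v : ℤ × ℤ, Q = P.image (fun x => x + v)
  iseqv := by
    refine ⟨fun P => ⟨0, by simp⟩, ?_, ?_⟩
    · rintro P _ ⟨v, rfl⟩
      refine ⟨-v, ?_⟩
      rw [Finset.image_image]
      simp [Function.comp_def]
    · rintro P _ _ ⟨v, rfl⟩ ⟨w, rfl⟩
      refine ⟨v + w, ?_⟩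
      rw [Finset.image_image]
      simp only [Function.comp_def, add_assoc]

/-- The number of fixed hole-free polyominoes with `m` cells. -/
noncomputable def polyominoesOfArea (m : ℕ) : ℕ :=
  classCount polyominoSetoid {P | IsHoleFreePolyomino P ∧ P.card = m}

/-- The number of fixed hole-free polyominoes with perimeter `2 c`. -/
noncomputable def polyominoesOfHalfPerimeter (c : ℕ) : ℕ :=
  classCount polyominoSetoid {P | IsHoleFreePolyomino P ∧ perimeter P = 2 * c}

/-- `γ` is the growth constant of the counting sequence `a`: the limit of `a n ^ (1 / n)`. -/
def IsGrowthConstant (a : ℕ → ℕ) (γ : ℝ) : Prop :=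
  Filter.Tendsto (fun n : ℕ => (a n : ℝ) ^ (1 / (n : ℝ))) Filter.atTop (nhds γ)

end TangleGrowth

namespace TangleGrowth

/-! ### Cells, sides and connectivity -/

/-! The discs and gaps of a square packing are indexed by the cells of `ℤ × ℤ`: a cell with even
coordinate sum is a disc, black if both coordinates are even and white if both are odd, and every
other cell is a gap. A link is then a side between a disc and a gap, and a closed curve of links is
a polygon in the grid of cells. Under this dictionary Tangles are the boundaries of hole-free
polyominoes `Q` with property `Sub`. Such a `Q` is a subcomplex of the square complex whose
vertices, edges and squares are the black cells, the gaps and the white cells.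

The passage from a Tangle to `Q` is a discrete Jordan curve theorem, `exists_polyomino_of_loop`.
Modulo two the polygon is a closed cochain, so by the Poincaré lemma it is the jump set of a
function; following the polygon along both sides shows that its complement has at most two pieces,
hence these are the two level sets. In the other direction, `exists_loop_of_polyomino` traces the
boundary of `Q` and shows with the same potential that it is one loop. That the faces of `Q` are
also the faces inside in the topological sense is `pt_mem_inside_iff`. All this is collected in
`isTangleOfLength_curve` and `exists_curve_of_isTangleOfLength`.

The length of the Tangle is the perimeter of `Q`. The edges of its dual graph are the gaps in `Q`,
and Euler's formula turns this into `Q.card = 2 * size + 1`. Since `Q` is itself a hole-free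
polyomino, Tangles of size `m` number at most the polyominoes of area `2m + 1`, and Tangles of class
`c` at most those of perimeter `4c`; this gives the squares in the upper bounds. For the lower
bounds, a polyomino of area `m + 1` is thinned to a spanning tree of black cells and gaps
(`exists_tree`), a Tangle of size `m`; and a polyomino of perimeter `2(c + 1)` is doubled
(`refinement`), a Tangle of class `c`.

The limits exist by Fekete's lemma. Two polyominoes are concatenated by gluing the lexicographically
last cell of the first to the first cell of the second; for subcomplexes a gap goes in between. The
factors can be recovered once the area or the perimeter of the first is known, so the counts are
supermultiplicative up to index shifts. A Tangle is determined up to translation by its first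
direction and its sequence of left and right turns, which gives exponential upper bounds. Finally, a
free class splits into at most eight fixed classes, because a rotation between Tangles in which two
kissing circles take part is by a multiple of a right angle, and any other Tangle is a single
circle. -/

/-- The outward normals of the four sides of a cell: up, left, down, right. -/
def dir (s : ZMod 4) : ℤ × ℤ := (![(0, 1), (-1, 0), (0, -1), (1, 0)] : Fin 4 → ℤ × ℤ) s

theorem dir_add_two (s : ZMod 4) : dir (s + 2) = -dir s := by
  revert s; decide

theorem dir_zero : dir 0 = (0, 1) := rfl
theorem dir_one : dir 1 = (-1, 0) := rfl
theorem dir_two : dir 2 = (0, -1) := rfl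
theorem dir_three : dir 3 = (1, 0) := rfl

theorem forall_side {p : ZMod 4 → Prop} : (∀ s, p s) ↔ p 0 ∧ p 1 ∧ p 2 ∧ p 3 :=
  ⟨fun h => ⟨h 0, h 1, h 2, h 3⟩, fun ⟨h0, h1, h2, h3⟩ s => by
    fin_cases s
    exacts [h0, h1, h2, h3]⟩

theorem exists_side {p : ZMod 4 → Prop} : (∃ s, p s) ↔ p 0 ∨ p 1 ∨ p 2 ∨ p 3 := by
  constructor
  · rintro ⟨s, hs⟩
    fin_cases s
    exacts [Or.inl hs, Or.inr (Or.inl hs), Or.inr (Or.inr (Or.inl hs)),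
      Or.inr (Or.inr (Or.inr hs))]
  · rintro (h | h | h | h)
    exacts [⟨_, h⟩, ⟨_, h⟩, ⟨_, h⟩, ⟨_, h⟩]

theorem sum_side {M : Type*} [AddCommMonoid M] (f : ZMod 4 → M) :
    ∑ s, f s = f 0 + f 1 + f 2 + f 3 :=
  Fin.sum_univ_four f

theorem dir_ne_zero (s : ZMod 4) : dir s ≠ 0 := by
  revert s; decide

theorem dir_injective : Function.Injective dir := by
  intro s t
  revert s t; decide

theorem add_dir_add_dir_two (x : ℤ × ℤ) (s : ZMod 4) : x + dir s + dir (s + 2) = x := by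
  rw [dir_add_two]; abel

theorem cellNeighbors_eq (x : ℤ × ℤ) : cellNeighbors x = Finset.univ.image (fun s => x + dir s) := by
  ext ⟨a, b⟩
  simp only [cellNeighbors, Finset.mem_insert, Finset.mem_singleton, Finset.mem_image,
    Finset.mem_univ, true_and, exists_side, dir_zero, dir_one, dir_two, dir_three, Prod.ext_iff,
    Prod.fst_add, Prod.snd_add]
  omega

theorem mem_cellNeighbors {x y : ℤ × ℤ} : y ∈ cellNeighbors x ↔ ∃ s, y = x + dir s := by
  simp [cellNeighbors_eq, eq_comm]

/-- `b` is a neighbour of `a`, both in `S`. -/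
def Nbr (S : Set (ℤ × ℤ)) (a b : ℤ × ℤ) : Prop := a ∈ S ∧ b ∈ S ∧ ∃ s, b = a + dir s

theorem Nbr.symm {S : Set (ℤ × ℤ)} {a b : ℤ × ℤ} (h : Nbr S a b) : Nbr S b a := by
  obtain ⟨ha, hb, s, rfl⟩ := h
  exact ⟨hb, ha, s + 2, (add_dir_add_dir_two a s).symm⟩

/-- `a` and `b` are joined by a path of neighbouring cells in `S`. -/
def Conn (S : Set (ℤ × ℤ)) : ℤ × ℤ → ℤ × ℤ → Prop := Relation.ReflTransGen (Nbr S)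

theorem Conn.refl {S : Set (ℤ × ℤ)} (a : ℤ × ℤ) : Conn S a a := Relation.ReflTransGen.refl

theorem Conn.trans {S : Set (ℤ × ℤ)} {a b c : ℤ × ℤ} (h : Conn S a b) (h' : Conn S b c) :
    Conn S a c := Relation.ReflTransGen.trans h h'

theorem Conn.symm {S : Set (ℤ × ℤ)} {a b : ℤ × ℤ} (h : Conn S a b) : Conn S b a :=
  Relation.ReflTransGen.head_induction_on h (Conn.refl _)
    fun h _ ih => Relation.ReflTransGen.tail ih h.symm

theorem Conn.mono {S T : Set (ℤ × ℤ)} (hST : S ⊆ T) {a b : ℤ × ℤ} (h : Conn S a b) : Conn T a b :=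
  Relation.ReflTransGen.lift id (fun _ _ h => ⟨hST h.1, hST h.2.1, h.2.2⟩) _ _ h

theorem Conn.step {S : Set (ℤ × ℤ)} {a : ℤ × ℤ} (s : ZMod 4) (ha : a ∈ S) (hb : a + dir s ∈ S) :
    Conn S a (a + dir s) := Relation.ReflTransGen.single ⟨ha, hb, s, rfl⟩

theorem Conn.of_eq {S : Set (ℤ × ℤ)} {a b : ℤ × ℤ} (h : a = b) : Conn S a b := h ▸ Conn.refl a

theorem Conn.step' {S : Set (ℤ × ℤ)} {a b : ℤ × ℤ} (s : ZMod 4) (ha : a ∈ S) (hb : b ∈ S)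
    (h : b = a + dir s) : Conn S a b := Relation.ReflTransGen.single ⟨ha, hb, s, h⟩

theorem induce_connected_iff (S : Set (ℤ × ℤ)) :
    (cellGraph.induce S).Connected ↔ S.Nonempty ∧ ∀ a ∈ S, ∀ b ∈ S, Conn S a b := by
  rw [SimpleGraph.connected_iff]
  constructor
  · rintro ⟨h, ⟨x⟩⟩
    refine ⟨⟨x, x.2⟩, fun a ha b hb => ?_⟩
    have h1 := (SimpleGraph.reachable_iff_reflTransGen _ _).1 (h ⟨a, ha⟩ ⟨b, hb⟩)
    exact Relation.ReflTransGen.lift (fun x : S => (x : ℤ × ℤ))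
      (fun x y hxy => ⟨x.2, y.2, mem_cellNeighbors.1 hxy⟩) _ _ h1
  · rintro ⟨⟨x, hx⟩, h⟩
    refine ⟨?_, ⟨x, hx⟩⟩
    rintro ⟨a, ha⟩ ⟨b, hb⟩
    have h1 := h a ha b hb
    clear h
    induction h1 with
    | refl => exact SimpleGraph.Reachable.refl _
    | tail _ h2 ih =>
      refine (ih h2.1).trans (SimpleGraph.Adj.reachable ?_)
      exact mem_cellNeighbors.2 h2.2.2

/-- Cells outside the square `[-N, N]²`. -/
def outBox (N : ℤ) : Set (ℤ × ℤ) := {x | N < |x.1| ∨ N < |x.2|}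

theorem exists_outBox_disjoint (P : Finset (ℤ × ℤ)) : ∃ N : ℤ, 0 ≤ N ∧ ∀ x ∈ outBox N, x ∉ P := by
  refine ⟨∑ x ∈ P, (|x.1| + |x.2|), Finset.sum_nonneg fun x _ => by positivity, fun x hx hxP => ?_⟩
  have h := Finset.single_le_sum (f := fun x : ℤ × ℤ => |x.1| + |x.2|)
    (fun x _ => by positivity) hxP
  have h1 := abs_nonneg x.1
  have h2 := abs_nonneg x.2
  rcases hx with hx | hx <;> omega

theorem conn_horizontal {S : Set (ℤ × ℤ)} {b i j : ℤ}
    (h : ∀ t, min i j ≤ t → t ≤ max i j → (t, b) ∈ S) : Conn S (i, b) (j, b) := by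
  wlog hij : i ≤ j generalizing i j
  · exact (this (fun t h1 h2 => h t (by rwa [min_comm]) (by rwa [max_comm])) (by omega)).symm
  rw [min_eq_left hij, max_eq_right hij] at h
  induction j, hij using Int.leInduction with
  | base => exact Conn.refl _
  | succ k hk ih =>
    refine (ih fun t h1 h2 => h t h1 (by omega)).trans ?_
    exact Conn.step' 3 (h k hk (by omega)) (h _ (by omega) le_rfl) (by simp [dir_three])

theorem conn_vertical {S : Set (ℤ × ℤ)} {a i j : ℤ}
    (h : ∀ t, min i j ≤ t → t ≤ max i j → (a, t) ∈ S) : Conn S (a, i) (a, j) := by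
  wlog hij : i ≤ j generalizing i j
  · exact (this (fun t h1 h2 => h t (by rwa [min_comm]) (by rwa [max_comm])) (by omega)).symm
  rw [min_eq_left hij, max_eq_right hij] at h
  induction j, hij using Int.leInduction with
  | base => exact Conn.refl _
  | succ k hk ih =>
    refine (ih fun t h1 h2 => h t h1 (by omega)).trans ?_
    exact Conn.step' 0 (h k hk (by omega)) (h _ (by omega) le_rfl) (by simp [dir_zero])

/-- A cell beyond the box in one coordinate may change the other one freely, so every such cell
slides to the corner `(N + 1, N + 1)`. -/
theorem conn_outBox {N : ℤ} (hN : 0 ≤ N) {a b : ℤ × ℤ} (ha : a ∈ outBox N) (hb : b ∈ outBox N) :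
    Conn (outBox N) a b := by
  suffices h : ∀ a ∈ outBox N, Conn (outBox N) a (N + 1, N + 1) from (h a ha).trans (h b hb).symm
  have hab : N < |N + 1| := by rw [abs_of_nonneg] <;> omega
  rintro ⟨i, j⟩ (h | h)
  · refine (conn_vertical (j := N + 1) fun t _ _ => Or.inl h).trans ?_
    exact conn_horizontal fun t _ _ => Or.inr hab
  · refine (conn_horizontal (j := N + 1) fun t _ _ => Or.inr h).trans ?_
    exact conn_vertical fun t _ _ => Or.inl hab

/-- Nonemptiness of the complement is automatic, `P` being finite; only that of `P` has to be kept.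
-/
theorem isHoleFree_iff (P : Finset (ℤ × ℤ)) : IsHoleFreePolyomino P ↔
    P.Nonempty ∧ (∀ a ∈ P, ∀ b ∈ P, Conn P a b) ∧
      (∀ a ∉ P, ∀ b ∉ P, Conn ((P : Set (ℤ × ℤ))ᶜ) a b) := by
  rw [IsHoleFreePolyomino, induce_connected_iff, induce_connected_iff]
  constructor
  · rintro ⟨⟨h1, h2⟩, -, h3⟩
    exact ⟨by simpa using h1, by simpa using h2, by simpa using h3⟩
  · rintro ⟨h1, h2, h3⟩
    refine ⟨⟨by simpa using h1, by simpa using h2⟩, ?_, by simpa using h3⟩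
    obtain ⟨N, hN, h⟩ := exists_outBox_disjoint P
    have h4 := h (N + 1, 0) (Or.inl (by rw [abs_of_nonneg] <;> omega))
    exact ⟨(N + 1, 0), by simpa using h4⟩

/-- Removing `R` from a connected set keeps it connected if the cells next to `R` that remain are
connected to each other. -/
theorem conn_remove {S S' R K : Set (ℤ × ℤ)} (hS : ∀ x ∈ S, x ∈ S' ∨ x ∈ R)
    (hd : ∀ x ∈ S', x ∉ R)
    (h : ∀ a ∈ S', ∀ s, a + dir s ∈ R → a ∈ K)
    (hKc : ∀ a ∈ K, ∀ b ∈ K, Conn S' a b) {a b : ℤ × ℤ} (ha : a ∈ S') (hb : b ∈ S')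
    (hab : Conn S a b) : Conn S' a b := by
  -- While the path in `S` runs through `R`, the invariant keeps a cell of `K` already connected to
  -- `a`; on leaving `R` the path is again in `K`.
  suffices H : (b ∈ S' → Conn S' a b) ∧ (b ∈ R → ∃ k ∈ K, Conn S' a k) from H.1 hb
  clear hb
  induction hab with
  | refl => exact ⟨fun _ => Conn.refl _, fun hR => (hd a ha hR).elim⟩
  | @tail c d _ hcd ih =>
    obtain ⟨hc, -, s, rfl⟩ := hcd
    have hback : c + dir s + dir (s + 2) = c := add_dir_add_dir_two c s
    rcases hS c hc with hc' | hc'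
    · exact ⟨fun hd' => (ih.1 hc').trans (Conn.step s hc' hd'),
        fun hd' => ⟨c, h c hc' s hd', ih.1 hc'⟩⟩
    · obtain ⟨k, hk, hak⟩ := ih.2 hc'
      exact ⟨fun hd' => hak.trans (hKc k hk _ (h _ hd' (s + 2) (by rwa [hback]))),
        fun _ => ⟨k, hk, hak⟩⟩

/-! ### The Poincaré lemma modulo two -/

theorem zmod_two_add_self (a : ZMod 2) : a + a = 0 := CharTwo.add_self_eq_zero a

theorem exists_primitive (g : ℤ → ZMod 2) : ∃ G : ℤ → ZMod 2, ∀ n, G n + G (n + 1) = g n := by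
  -- One of the two intervals is always empty, and signs play no role modulo two, so a single
  -- formula serves on both sides of `0`.
  refine ⟨fun n => ∑ i ∈ Finset.Ico 0 n, g i + ∑ i ∈ Finset.Ico n 0, g i, fun n => ?_⟩
  beta_reduce
  rcases lt_or_ge n 0 with hn | hn
  · rw [Finset.Ico_eq_empty (a := 0) (b := n) (by omega),
      Finset.Ico_eq_empty (a := 0) (b := n + 1) (by omega)]
    have : Finset.Ico n 0 = insert n (Finset.Ico (n + 1) 0) := by
      ext; simp only [Finset.mem_Ico, Finset.mem_insert]; omega
    rw [this, Finset.sum_insert (by simp)]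
    linear_combination zmod_two_add_self (∑ i ∈ Finset.Ico (n + 1) 0, g i)
  · rw [Finset.Ico_eq_empty (a := n) (by omega), Finset.Ico_eq_empty (a := n + 1) (by omega)]
    have : Finset.Ico 0 (n + 1) = insert n (Finset.Ico 0 n) := by
      ext; simp only [Finset.mem_Ico, Finset.mem_insert]; omega
    rw [this, Finset.sum_insert (by simp)]
    linear_combination zmod_two_add_self (∑ i ∈ Finset.Ico 0 n, g i)

/-- A closed `1`-cochain modulo two on the square grid is a gradient. -/
theorem exists_potential (h v : ℤ → ℤ → ZMod 2)
    (hc : ∀ a b, h a b + h (a + 1) b + v a b + v a (b + 1) = 0) :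
    ∃ f : ℤ → ℤ → ZMod 2, ∀ a b, f a b + f a (b + 1) = h a b ∧ f a b + f (a + 1) b = v a b := by
  -- Integration first along the column `a = 0` and then along the row `b`. Closedness enters
  -- through `key`: the defect in a column does not depend on the column.
  obtain ⟨H, hH⟩ := exists_primitive (h 0)
  choose V hV using fun b => exists_primitive fun a => v a b
  refine ⟨fun a b => V b a + V b 0 + H b, fun a b => ⟨?_, ?_⟩⟩
  · have key : ∀ a, V b a + V (b + 1) a + h a b = V b (a + 1) + V (b + 1) (a + 1) + h (a + 1) b := by
      intro a
      have h1 := hV b a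
      have h2 := hV (b + 1) a
      have h3 := hc a b
      rw [← h1, ← h2] at h3
      linear_combination h3 - zmod_two_add_self (V b (a + 1)) - zmod_two_add_self (V (b + 1) (a + 1))
        - zmod_two_add_self (h (a + 1) b)
    have key2 : V b a + V (b + 1) a + h a b = V b 0 + V (b + 1) 0 + h 0 b := by
      induction a using Int.induction_on with
      | zero => rfl
      | succ i ih => rw [← key, ih]
      | pred i ih => rw [← ih, key]; simp
    have h4 := hH b
    linear_combination key2 + h4 - zmod_two_add_self (h a b) + zmod_two_add_self (V b 0) +
      zmod_two_add_self (V (b + 1) 0) + zmod_two_add_self (h 0 b)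
  · have h1 := hV b a
    simp only at h1 ⊢
    linear_combination h1 + zmod_two_add_self (V b 0) + zmod_two_add_self (H b)

/-- The Poincaré lemma for functions on the sides of cells. -/
theorem exists_potential_sides (z : ℤ × ℤ → ZMod 4 → ZMod 2)
    (hs : ∀ x s, z (x + dir s) (s + 2) = z x s)
    (hc : ∀ x, z x 0 + z x 3 + z (x + (1, 1)) 1 + z (x + (1, 1)) 2 = 0) :
    ∃ f : ℤ × ℤ → ZMod 2, ∀ x s, f x + f (x + dir s) = z x s := by
  have e1 : (1 : ZMod 4) + 2 = 3 := by decide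
  have e2 : (2 : ZMod 4) + 2 = 0 := by decide
  obtain ⟨f, hf⟩ := exists_potential (fun a b => z (a, b) 0) (fun a b => z (a, b) 3) (by
    intro a b
    have h1 := hs (a + 1, b + 1) 1
    have h2 := hs (a + 1, b + 1) 2
    have h3 := hc (a, b)
    simp only [dir_one, dir_two, Prod.mk_add_mk, add_zero, e1, e2, add_neg_cancel_right] at h1 h2 h3
    rw [← h1, ← h2] at h3
    linear_combination h3)
  refine ⟨fun x => f x.1 x.2, fun x => forall_side.2 ?_⟩
  obtain ⟨a, b⟩ := x
  have h1 := hs (a, b) 1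
  have h2 := hs (a, b) 2
  simp only [dir_zero, dir_one, dir_two, dir_three, e1, e2, Prod.mk_add_mk, add_zero] at h1 h2 ⊢
  refine ⟨(hf a b).1, ?_, ?_, (hf a b).2⟩
  · rw [← h1, ← (hf _ _).2, add_comm]; simp
  · rw [← h2, ← (hf _ _).1, add_comm]; simp


/-! ### The Euler characteristic of a hole-free polyomino -/

/-- Cells of `P` whose right neighbour is in `P`. -/
def horPairs (P : Finset (ℤ × ℤ)) : Finset (ℤ × ℤ) := P.filter fun x => x + (1, 0) ∈ P

/-- Cells of `P` whose upper neighbour is in `P`. -/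
def verPairs (P : Finset (ℤ × ℤ)) : Finset (ℤ × ℤ) := P.filter fun x => x + (0, 1) ∈ P

/-- Lower left cells of the `2 × 2` blocks in `P`. -/
def blocks (P : Finset (ℤ × ℤ)) : Finset (ℤ × ℤ) :=
  P.filter fun x => x + (1, 0) ∈ P ∧ x + (0, 1) ∈ P ∧ x + (1, 1) ∈ P

theorem mem_horPairs {P : Finset (ℤ × ℤ)} {x : ℤ × ℤ} :
    x ∈ horPairs P ↔ x ∈ P ∧ x + (1, 0) ∈ P := Finset.mem_filter

theorem mem_verPairs {P : Finset (ℤ × ℤ)} {x : ℤ × ℤ} :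
    x ∈ verPairs P ↔ x ∈ P ∧ x + (0, 1) ∈ P := Finset.mem_filter

theorem mem_blocks {P : Finset (ℤ × ℤ)} {x : ℤ × ℤ} :
    x ∈ blocks P ↔ x ∈ P ∧ x + (1, 0) ∈ P ∧ x + (0, 1) ∈ P ∧ x + (1, 1) ∈ P := Finset.mem_filter

theorem shift_ur (x : ℤ × ℤ) : x + (1, 0) + (0, 1) = x + (1, 1) := by
  rw [add_assoc]; rfl

theorem shift_ru (x : ℤ × ℤ) : x + (0, 1) + (1, 0) = x + (1, 1) := by
  rw [add_assoc]; rfl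

/-- The boundary, at the upper right corners of cells, of a chain of grid edges modulo two: the
pair `(h, v)` consists of the coefficients of the upper and the right edges of cells. -/
def edgeBoundary :
    ((ℤ × ℤ → ZMod 2) × (ℤ × ℤ → ZMod 2)) →ₗ[ZMod 2] (ℤ × ℤ → ZMod 2) where
  toFun c y := c.1 y + c.1 (y + (1, 0)) + c.2 y + c.2 (y + (0, 1))
  map_add' c c' := by
    ext y
    simp only [Prod.fst_add, Prod.snd_add, Pi.add_apply]
    ring
  map_smul' a c := by
    ext y
    simp only [Prod.smul_fst, Prod.smul_snd, Pi.smul_apply, smul_eq_mul, RingHom.id_apply]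
    ring

theorem edgeBoundary_apply (c : (ℤ × ℤ → ZMod 2) × (ℤ × ℤ → ZMod 2)) (y : ℤ × ℤ) :
    edgeBoundary c y = c.1 y + c.1 (y + (1, 0)) + c.2 y + c.2 (y + (0, 1)) := rfl

/-- Chains that do not contain an edge between two cells of `P`. -/
def outerChains (P : Finset (ℤ × ℤ)) : Submodule (ZMod 2) ((ℤ × ℤ → ZMod 2) × (ℤ × ℤ → ZMod 2)) where
  carrier := {c | (∀ x ∈ verPairs P, c.1 x = 0) ∧ ∀ x ∈ horPairs P, c.2 x = 0}
  zero_mem' := ⟨fun _ _ => rfl, fun _ _ => rfl⟩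
  add_mem' {a b} ha hb := ⟨fun x hx => by simp [ha.1 x hx, hb.1 x hx],
    fun x hx => by simp [ha.2 x hx, hb.2 x hx]⟩
  smul_mem' r a ha := ⟨fun x hx => by simp [ha.1 x hx], fun x hx => by simp [ha.2 x hx]⟩

/-- The vertex `y` is the boundary of a possibly infinite chain outside `P`. -/
def Escapes (P : Finset (ℤ × ℤ)) (y : ℤ × ℤ) : Prop :=
  ∃ c ∈ outerChains P, edgeBoundary c = Pi.single y 1

theorem Escapes.of_boundary {P : Finset (ℤ × ℤ)} {y y' : ℤ × ℤ} (h : Escapes P y)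
    {c : (ℤ × ℤ → ZMod 2) × (ℤ × ℤ → ZMod 2)} (hc : c ∈ outerChains P)
    (hb : edgeBoundary c = Pi.single y 1 + Pi.single y' 1) : Escapes P y' := by
  obtain ⟨c', hc', h'⟩ := h
  refine ⟨c + c', add_mem hc hc', ?_⟩
  rw [map_add, hb, h', add_right_comm, CharTwo.add_self_eq_zero, zero_add]

/-- The ends of the upper edge of the cell `x` are the vertices `x` and `x - (1, 0)`. If the edge is
not between two cells of `P`, it can be added to an escaping chain. -/
theorem escapes_up_iff {P : Finset (ℤ × ℤ)} {x : ℤ × ℤ} (h : x ∉ verPairs P) :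
    Escapes P x ↔ Escapes P (x - (1, 0)) := by
  have hc : ((Pi.single x 1, 0) : (ℤ × ℤ → ZMod 2) × (ℤ × ℤ → ZMod 2)) ∈ outerChains P :=
    ⟨fun y hy => Pi.single_eq_of_ne (by rintro rfl; exact h hy) _, fun _ _ => rfl⟩
  have hb : edgeBoundary ((Pi.single x 1, 0) : (ℤ × ℤ → ZMod 2) × (ℤ × ℤ → ZMod 2)) =
      Pi.single x 1 + Pi.single (x - (1, 0)) 1 := by
    ext y
    simp only [edgeBoundary_apply, Pi.single_apply, Pi.zero_apply, Pi.add_apply, add_zero,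
      eq_sub_iff_add_eq]
  exact ⟨fun h => h.of_boundary hc hb, fun h => h.of_boundary hc (by rw [hb, add_comm])⟩

theorem escapes_right_iff {P : Finset (ℤ × ℤ)} {x : ℤ × ℤ} (h : x ∉ horPairs P) :
    Escapes P x ↔ Escapes P (x - (0, 1)) := by
  have hc : ((0, Pi.single x 1) : (ℤ × ℤ → ZMod 2) × (ℤ × ℤ → ZMod 2)) ∈ outerChains P :=
    ⟨fun _ _ => rfl, fun y hy => Pi.single_eq_of_ne (by rintro rfl; exact h hy) _⟩
  have hb : edgeBoundary ((0, Pi.single x 1) : (ℤ × ℤ → ZMod 2) × (ℤ × ℤ → ZMod 2)) =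
      Pi.single x 1 + Pi.single (x - (0, 1)) 1 := by
    ext y
    simp only [edgeBoundary_apply, Pi.single_apply, Pi.zero_apply, Pi.add_apply, add_zero, zero_add,
      eq_sub_iff_add_eq]
  exact ⟨fun h => h.of_boundary hc hb, fun h => h.of_boundary hc (by rw [hb, add_comm])⟩

/-- All four corners of the cell `x` escape. -/
def CellEscapes (P : Finset (ℤ × ℤ)) (x : ℤ × ℤ) : Prop :=
  Escapes P x ∧ Escapes P (x - (1, 0)) ∧ Escapes P (x - (0, 1)) ∧ Escapes P (x - (1, 1))

/-- None of the edges of a cell outside `P` lies between two cells of `P`, and three of them already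
join its four corners. -/
theorem cellEscapes_of {P : Finset (ℤ × ℤ)} {x : ℤ × ℤ} (hx : x ∉ P)
    (h : Escapes P x ∨ Escapes P (x - (1, 0)) ∨ Escapes P (x - (0, 1)) ∨ Escapes P (x - (1, 1))) :
    CellEscapes P x := by
  have e1 := escapes_up_iff (P := P) (x := x) fun h => hx (mem_verPairs.1 h).1
  have e2 := escapes_right_iff (P := P) (x := x) fun h => hx (mem_horPairs.1 h).1
  have e3 := escapes_up_iff (P := P) (x := x - (0, 1)) fun h => hx (by
    simpa using (mem_verPairs.1 h).2)
  rw [sub_sub, show ((0, 1) : ℤ × ℤ) + (1, 0) = (1, 1) from rfl] at e3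
  unfold CellEscapes
  tauto

/-- The chain is the horizontal ray to the right: it is infinite, so its only boundary point is its
origin. This is why chains with infinite support are allowed. -/
theorem escapes_of_far {P : Finset (ℤ × ℤ)} {a b : ℤ} (h : ∀ x ∈ P, x.1 ≤ a) : Escapes P (a, b) := by
  refine ⟨(fun x => if x.2 = b ∧ a < x.1 then 1 else 0, 0), ⟨fun x hx => ?_, fun _ _ => rfl⟩, ?_⟩
  · have := h x (mem_verPairs.1 hx).1
    exact if_neg (by omega)
  · ext ⟨i, j⟩
    simp only [edgeBoundary_apply, Pi.single_apply, Pi.zero_apply, add_zero, Prod.mk_add_mk,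
      Prod.mk.injEq]
    by_cases hj : j = b
    · rcases lt_trichotomy i a with hi | hi | hi
      · rw [if_neg (by omega), if_neg (by omega), if_neg (by omega), add_zero]
      · rw [if_neg (by omega), if_pos (by omega), if_pos (by omega), zero_add]
      · rw [if_pos (by omega), if_pos (by omega), if_neg (by omega), CharTwo.add_self_eq_zero]
    · rw [if_neg (by omega), if_neg (by omega), if_neg (by omega), add_zero]

/-- Escaping propagates from a far cell along a path in the complement, since consecutive cells
share corners. This is where the absence of holes is used. -/
theorem cellEscapes_of_notMem {P : Finset (ℤ × ℤ)}
    (hP : ∀ a ∉ P, ∀ b ∉ P, Conn ((P : Set (ℤ × ℤ))ᶜ) a b) {x : ℤ × ℤ} (hx : x ∉ P) :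
    CellEscapes P x := by
  obtain ⟨N, hN, hbox⟩ := exists_outBox_disjoint P
  have hfar : ∀ y ∈ P, y.1 ≤ N + 1 := fun y hy => by
    by_contra hlt
    exact hbox y (Or.inl (by rw [abs_of_nonneg] <;> omega)) hy
  have hstart : (N + 1, 0) ∉ P := hbox _ (Or.inl (by rw [abs_of_nonneg] <;> omega))
  have hconn := hP _ hstart x hx
  clear hx
  induction hconn with
  | refl => exact cellEscapes_of hstart (Or.inl (escapes_of_far hfar))
  | @tail b c _ hbc ih =>
    obtain ⟨-, hc, s, rfl⟩ := hbc
    have hc' : b + dir s ∉ P := by simpa using hc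
    obtain ⟨h1, h2, h3, h4⟩ := ih
    refine cellEscapes_of hc' ?_
    revert s
    refine forall_side.2 ⟨fun _ _ => ?_, fun _ _ => ?_, fun _ _ => ?_, fun _ _ => ?_⟩
    · right; right; left; convert h1 using 1; rw [dir_zero]; abel
    · left; convert h2 using 1; rw [dir_one, sub_eq_add_neg]; rfl
    · left; convert h3 using 1; rw [dir_two, sub_eq_add_neg]; rfl
    · right; left; convert h1 using 1; rw [dir_three]; abel

/-- A chain of edges inside a polyomino with connected complement which is closed at all interior
vertices is a gradient. -/
theorem exists_potential_of_hole_free {P : Finset (ℤ × ℤ)}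
    (hP : ∀ a ∉ P, ∀ b ∉ P, Conn ((P : Set (ℤ × ℤ))ᶜ) a b)
    (c : (ℤ × ℤ → ZMod 2) × (ℤ × ℤ → ZMod 2)) (h1 : ∀ x ∉ verPairs P, c.1 x = 0)
    (h2 : ∀ x ∉ horPairs P, c.2 x = 0) (hc : ∀ y ∈ blocks P, edgeBoundary c y = 0) :
    ∃ f : ℤ × ℤ → ZMod 2, (∀ x ∈ verPairs P, f x + f (x + (0, 1)) = c.1 x) ∧
      ∀ x ∈ horPairs P, f x + f (x + (1, 0)) = c.2 x := by
  -- A vertex that is not interior is a corner of some cell outside `P`. The value `0` at interior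
  -- vertices is a default that is never used.
  have hesc : ∀ y, ∃ e ∈ outerChains P, y ∉ blocks P → edgeBoundary e = Pi.single y 1 := by
    intro y
    by_cases hy : y ∈ blocks P
    · exact ⟨0, zero_mem _, fun h => (h hy).elim⟩
    · suffices h : Escapes P y by
        obtain ⟨e, he, he'⟩ := h
        exact ⟨e, he, fun _ => he'⟩
      rw [mem_blocks] at hy
      by_cases ha : y ∈ P
      · by_cases hb : y + (1, 0) ∈ P
        · by_cases hd : y + (0, 1) ∈ P
          · have he : y + (1, 1) ∉ P := fun he => hy ⟨ha, hb, hd, he⟩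
            simpa using (cellEscapes_of_notMem hP he).2.2.2
          · simpa using (cellEscapes_of_notMem hP hd).2.2.1
        · simpa using (cellEscapes_of_notMem hP hb).2.1
      · exact (cellEscapes_of_notMem hP ha).1
  choose e he heb using hesc
  let F : Finset (ℤ × ℤ) := (P ∪ P.image (· - (1, 0)) ∪ P.image (· - (0, 1))) \ blocks P
  -- Each boundary point of `c` is sent to infinity along an outer chain. The result is closed
  -- everywhere and agrees with `c` on the edges inside `P`. The finite set `F` holds all
  -- non-interior vertices at which an edge inside `P` can end.
  let c' := c + ∑ y ∈ F, edgeBoundary c y • e y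
  have hc'b : edgeBoundary c' = 0 := by
    ext y
    have : edgeBoundary c' = edgeBoundary c + ∑ y ∈ F, edgeBoundary c y • Pi.single y 1 := by
      simp only [c', map_add, map_sum, map_smul]
      congr 1
      refine Finset.sum_congr rfl fun y hy => ?_
      rw [heb y (Finset.mem_sdiff.1 hy).2]
    rw [this, Pi.add_apply, Finset.sum_apply, Pi.zero_apply]
    simp only [Pi.smul_apply, Pi.single_apply, smul_eq_mul, mul_ite, mul_one, mul_zero,
      Finset.sum_ite_eq]
    split_ifs with hy
    · exact CharTwo.add_self_eq_zero _
    · rw [add_zero]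
      by_cases hyb : y ∈ blocks P
      · exact hc y hyb
      · have hy2 : ∀ w, (w = y ∨ w - (1, 0) = y ∨ w - (0, 1) = y) → w ∉ P := by
          intro w hw hwP
          refine hy (Finset.mem_sdiff.2 ⟨?_, hyb⟩)
          simp only [Finset.mem_union, Finset.mem_image]
          rcases hw with hw | hw | hw
          · exact Or.inl (Or.inl (hw ▸ hwP))
          · exact Or.inl (Or.inr ⟨w, hwP, hw⟩)
          · exact Or.inr ⟨w, hwP, hw⟩
        rw [edgeBoundary_apply, h1, h1, h2, h2]
        · simp
        · exact fun h => hy2 _ (Or.inr (Or.inr (by simp))) (mem_horPairs.1 h).1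
        · exact fun h => hy2 _ (Or.inl rfl) (mem_horPairs.1 h).1
        · exact fun h => hy2 _ (Or.inr (Or.inl (by simp))) (mem_verPairs.1 h).1
        · exact fun h => hy2 _ (Or.inl rfl) (mem_verPairs.1 h).1
  have hout : ∑ y ∈ F, edgeBoundary c y • e y ∈ outerChains P :=
    sum_mem fun y _ => Submodule.smul_mem _ _ (he y)
  obtain ⟨f, hf⟩ := exists_potential (fun a b => c'.1 (a, b)) (fun a b => c'.2 (a, b)) (by
    intro a b
    have := congrFun hc'b (a, b)
    simpa [edgeBoundary_apply] using this)
  refine ⟨fun x => f x.1 x.2, fun x hx => ?_, fun x hx => ?_⟩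
  · have h3 := (hf x.1 x.2).1
    have h4 : c'.1 x = c.1 x := by simp only [c', Prod.fst_add, Pi.add_apply, hout.1 x hx, add_zero]
    rw [← h4, ← h3]
    simp
  · have h3 := (hf x.1 x.2).2
    have h4 : c'.2 x = c.2 x := by simp only [c', Prod.snd_add, Pi.add_apply, hout.2 x hx, add_zero]
    rw [← h4, ← h3]
    simp

/-! ### Cells, inner edges and interior vertices as a cochain complex modulo two -/

section Euler

variable (P : Finset (ℤ × ℤ))

/-- Differences of functions on `P` along the edges between cells of `P`. -/
def coboundaryZero : (P → ZMod 2) →ₗ[ZMod 2] ((verPairs P → ZMod 2) × (horPairs P → ZMod 2)) where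
  toFun f := (fun x => f ⟨x, (mem_verPairs.1 x.2).1⟩ + f ⟨x.1 + (0, 1), (mem_verPairs.1 x.2).2⟩,
    fun x => f ⟨x, (mem_horPairs.1 x.2).1⟩ + f ⟨x.1 + (1, 0), (mem_horPairs.1 x.2).2⟩)
  map_add' f g := by
    ext x <;> simp only [Pi.add_apply, Prod.mk_add_mk] <;> ring
  map_smul' a f := by
    ext x <;> simp only [Pi.smul_apply, Prod.smul_mk, smul_eq_mul, RingHom.id_apply] <;> ring

/-- Sums of edge functions around the interior vertices of `P`. -/
def coboundaryOne : ((verPairs P → ZMod 2) × (horPairs P → ZMod 2)) →ₗ[ZMod 2]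
    (blocks P → ZMod 2) where
  toFun c y :=
    c.1 ⟨y, mem_verPairs.2 ⟨(mem_blocks.1 y.2).1, (mem_blocks.1 y.2).2.2.1⟩⟩ +
    c.1 ⟨y.1 + (1, 0), mem_verPairs.2 ⟨(mem_blocks.1 y.2).2.1, by
      rw [shift_ur]; exact (mem_blocks.1 y.2).2.2.2⟩⟩ +
    c.2 ⟨y, mem_horPairs.2 ⟨(mem_blocks.1 y.2).1, (mem_blocks.1 y.2).2.1⟩⟩ +
    c.2 ⟨y.1 + (0, 1), mem_horPairs.2 ⟨(mem_blocks.1 y.2).2.2.1, by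
      rw [shift_ru]; exact (mem_blocks.1 y.2).2.2.2⟩⟩
  map_add' f g := by
    ext x
    simp only [Pi.add_apply, Prod.fst_add, Prod.snd_add]
    ring
  map_smul' a f := by
    ext x
    simp only [Pi.smul_apply, Prod.smul_fst, Prod.smul_snd, smul_eq_mul, RingHom.id_apply]
    ring

/-- For an interior vertex `y`, take the ray to the right from `y` up to the first vertex that is
not interior. Every other interior vertex on it meets two of its edges, and `y` meets one. -/
theorem coboundaryOne_surjective : Function.Surjective (coboundaryOne P) := by
  rw [← LinearMap.range_eq_top, eq_top_iff]
  rintro g -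
  rw [show g = ∑ y, g y • Pi.single y 1 by
    ext y; simp [Finset.sum_apply, Pi.single_apply]]
  refine sum_mem fun y _ => Submodule.smul_mem _ _ ?_
  classical
  refine ⟨(fun x => if x.1.2 = y.1.2 ∧ y.1.1 < x.1.1 ∧
    ∀ i, y.1.1 ≤ i → i < x.1.1 → (i, y.1.2) ∈ blocks P then 1 else 0, 0), ?_⟩
  ext ⟨⟨i, j⟩, hij⟩
  obtain ⟨⟨a, b⟩, hab⟩ := y
  simp only [coboundaryOne, LinearMap.coe_mk, AddHom.coe_mk, Pi.zero_apply, add_zero,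
    Pi.single_apply, Subtype.mk.injEq, Prod.mk.injEq, Prod.mk_add_mk]
  by_cases hj : j = b
  · subst hj
    rcases lt_trichotomy i a with hi | hi | hi
    · rw [if_neg (by omega), if_neg (by omega), if_neg (by omega), add_zero]
    · subst hi
      rw [if_neg (by omega), if_pos, if_pos (by omega), zero_add]
      refine ⟨rfl, by omega, fun k h1 h2 => ?_⟩
      rwa [show k = i by omega]
    · rw [if_neg (by omega : ¬(i = a ∧ j = j))]
      have : (∀ k, a ≤ k → k < i + 1 → (k, j) ∈ blocks P) ↔
          (∀ k, a ≤ k → k < i → (k, j) ∈ blocks P) := by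
        refine ⟨fun h k h1 h2 => h k h1 (by omega), fun h k h1 h2 => ?_⟩
        rcases eq_or_ne k i with rfl | hk
        · exact hij
        · exact h k h1 (by omega)
      simp only [this, hi, true_and, show a < i + 1 by omega]
      exact zmod_two_add_self _
  · rw [if_neg (by omega), if_neg (by omega), if_neg (by omega), add_zero]

variable {P}

/-- Exactness in the middle, the vanishing of the first cohomology. An edge function is extended by
zero so that `exists_potential_of_hole_free` applies. -/
theorem ker_coboundaryOne (hP : ∀ a ∉ P, ∀ b ∉ P, Conn ((P : Set (ℤ × ℤ))ᶜ) a b) :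
    LinearMap.ker (coboundaryOne P) = LinearMap.range (coboundaryZero P) := by
  classical
  ext c
  rw [LinearMap.mem_ker, LinearMap.mem_range]
  constructor
  · intro hc
    obtain ⟨f, hf1, hf2⟩ := exists_potential_of_hole_free hP
      (fun x => if h : x ∈ verPairs P then c.1 ⟨x, h⟩ else 0,
        fun x => if h : x ∈ horPairs P then c.2 ⟨x, h⟩ else 0)
      (fun x hx => dif_neg hx) (fun x hx => dif_neg hx) (by
        intro y hy
        have h := congrFun hc ⟨y, hy⟩
        simp only [coboundaryOne, LinearMap.coe_mk, AddHom.coe_mk, Pi.zero_apply] at h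
        obtain ⟨h1, h2, h3, h4⟩ := mem_blocks.1 hy
        rw [← shift_ur] at h4
        have h5 := h4
        rw [shift_ur, ← shift_ru] at h5
        simp only [edgeBoundary_apply]
        rw [dif_pos (mem_verPairs.2 ⟨h1, h3⟩), dif_pos (mem_verPairs.2 ⟨h2, h4⟩),
          dif_pos (mem_horPairs.2 ⟨h1, h2⟩), dif_pos (mem_horPairs.2 ⟨h3, h5⟩)]
        exact h)
    refine ⟨fun x => f x, ?_⟩
    ext ⟨x, hx⟩
    · simpa [hx, coboundaryZero] using hf1 x hx
    · simpa [hx, coboundaryZero] using hf2 x hx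
  · rintro ⟨f, rfl⟩
    ext ⟨y, hy⟩
    simp only [coboundaryOne, coboundaryZero, LinearMap.coe_mk, AddHom.coe_mk, Pi.zero_apply,
      shift_ur, shift_ru]
    obtain ⟨h1, h2, h3, h4⟩ := mem_blocks.1 hy
    linear_combination zmod_two_add_self (f ⟨y, h1⟩) + zmod_two_add_self (f ⟨y + (1, 0), h2⟩) +
      zmod_two_add_self (f ⟨y + (0, 1), h3⟩) + zmod_two_add_self (f ⟨y + (1, 1), h4⟩)

/-- By connectedness, the kernel consists of the constants. -/
theorem finrank_ker_coboundaryZero (hne : P.Nonempty) (hP : ∀ a ∈ P, ∀ b ∈ P, Conn P a b) :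
    Module.finrank (ZMod 2) (LinearMap.ker (coboundaryZero P)) = 1 := by
  obtain ⟨a, ha⟩ := hne
  have hker : LinearMap.ker (coboundaryZero P) = Submodule.span (ZMod 2) {fun _ => 1} := by
    ext f
    rw [LinearMap.mem_ker, Submodule.mem_span_singleton]
    constructor
    · intro hf
      refine ⟨f ⟨a, ha⟩, ?_⟩
      ext ⟨b, hb⟩
      simp only [Pi.smul_apply, smul_eq_mul, mul_one]
      have hab := hP a ha b hb
      induction hab with
      | refl => rfl
      | @tail c d _ hcd ih =>
        obtain ⟨hc, hd, s, rfl⟩ := hcd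
        rw [ih hc]
        rw [← CharTwo.add_eq_zero]
        have hv : ∀ x (h : x ∈ P) (h' : x + (0, 1) ∈ P), f ⟨x, h⟩ + f ⟨x + (0, 1), h'⟩ = 0 :=
          fun x h h' => congrFun (congrArg Prod.fst hf) ⟨x, mem_verPairs.2 ⟨h, h'⟩⟩
        have hh : ∀ x (h : x ∈ P) (h' : x + (1, 0) ∈ P), f ⟨x, h⟩ + f ⟨x + (1, 0), h'⟩ = 0 :=
          fun x h h' => congrFun (congrArg Prod.snd hf) ⟨x, mem_horPairs.2 ⟨h, h'⟩⟩
        clear ih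
        revert s
        refine forall_side.2 ⟨fun hd _ => hv c hc hd, fun hd _ => ?_, fun hd _ => ?_,
          fun hd _ => hh c hc hd⟩
        · have e : c + dir 1 + (1, 0) = c := add_dir_add_dir_two c 1
          have := hh (c + dir 1) hd (by rw [e]; exact hc)
          simp only [e] at this
          rwa [add_comm]
        · have e : c + dir 2 + (0, 1) = c := add_dir_add_dir_two c 2
          have := hv (c + dir 2) hd (by rw [e]; exact hc)
          simp only [e] at this
          rwa [add_comm]
    · rintro ⟨r, rfl⟩
      ext x <;> simp [coboundaryZero, CharTwo.add_self_eq_zero]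
  rw [hker]
  exact finrank_span_singleton fun h => one_ne_zero (congrFun h ⟨a, ha⟩)

/-- Euler's formula for hole-free polyominoes. -/
theorem euler_formula (h : IsHoleFreePolyomino P) :
    P.card + (blocks P).card = (horPairs P).card + (verPairs P).card + 1 := by
  obtain ⟨hne, hP, hPc⟩ := (isHoleFree_iff P).1 h
  -- Rank-nullity twice: cells number the rank of `coboundaryZero P` plus one, inner edges the
  -- number of blocks plus that same rank.
  have h0 := LinearMap.finrank_range_add_finrank_ker (coboundaryZero P)
  have h1 := LinearMap.finrank_range_add_finrank_ker (coboundaryOne P)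
  rw [finrank_ker_coboundaryZero hne hP] at h0
  rw [ker_coboundaryOne hPc, LinearMap.range_eq_top.2 (coboundaryOne_surjective P),
    finrank_top] at h1
  simp only [Module.finrank_prod, Module.finrank_fintype_fun_eq_card, Fintype.card_coe] at h0 h1
  omega

end Euler


/-! ### Perimeter -/

/-- The sides of the boundary of `P`, seen from inside. -/
def boundarySides (P : Finset (ℤ × ℤ)) : Finset ((ℤ × ℤ) × ZMod 4) :=
  (P ×ˢ Finset.univ).filter fun e => e.1 + dir e.2 ∉ P

theorem mem_boundarySides {P : Finset (ℤ × ℤ)} {e : (ℤ × ℤ) × ZMod 4} :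
    e ∈ boundarySides P ↔ e.1 ∈ P ∧ e.1 + dir e.2 ∉ P := by
  simp [boundarySides]

theorem card_neighbors_sdiff (P : Finset (ℤ × ℤ)) (x : ℤ × ℤ) :
    (cellNeighbors x \ P).card = ∑ s : ZMod 4, if x + dir s ∉ P then 1 else 0 := by
  rw [cellNeighbors_eq, Finset.sdiff_eq_filter, Finset.filter_image,
    Finset.card_image_of_injective _ fun s t h => dir_injective (add_left_cancel h),
    Finset.card_filter]

theorem perimeter_eq_card (P : Finset (ℤ × ℤ)) : perimeter P = (boundarySides P).card := by
  rw [perimeter, boundarySides, Finset.card_filter, Finset.sum_product]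
  exact Finset.sum_congr rfl fun x _ => card_neighbors_sdiff P x

theorem card_filter_shift (P Q : Finset (ℤ × ℤ)) (v : ℤ × ℤ) :
    (P.filter fun x => x + v ∈ Q).card = (Q.filter fun x => x - v ∈ P).card := by
  refine Finset.card_nbij' (· + v) (· - v) ?_ ?_ ?_ ?_
  · intro x hx
    simpa [and_comm] using hx
  · intro x hx
    simpa [and_comm] using hx
  · intro x _
    simp
  · intro x _
    simp

/-- Of the four sides of each cell, those not on the boundary are shared in pairs. -/
theorem perimeter_add (P : Finset (ℤ × ℤ)) :
    perimeter P + 2 * ((horPairs P).card + (verPairs P).card) = 4 * P.card := by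
  have h1 : ∑ x ∈ P, ∑ s : ZMod 4, (if x + dir s ∈ P then 1 else 0) =
      2 * ((horPairs P).card + (verPairs P).card) := by
    rw [Finset.sum_comm, sum_side]
    simp only [← Finset.card_filter]
    have e0 : (P.filter fun x => x + dir 0 ∈ P).card = (verPairs P).card := rfl
    have e1 : (P.filter fun x => x + dir 1 ∈ P).card = (horPairs P).card := by
      rw [horPairs, card_filter_shift]
      refine congrArg _ (Finset.filter_congr fun x _ => ?_)
      rw [sub_eq_add_neg]; rfl
    have e2 : (P.filter fun x => x + dir 2 ∈ P).card = (verPairs P).card := by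
      rw [verPairs, card_filter_shift]
      refine congrArg _ (Finset.filter_congr fun x _ => ?_)
      rw [sub_eq_add_neg]; rfl
    have e3 : (P.filter fun x => x + dir 3 ∈ P).card = (horPairs P).card := rfl
    rw [e0, e1, e2, e3]
    ring
  rw [← h1, perimeter, ← Finset.sum_add_distrib, mul_comm, ← smul_eq_mul, ← Finset.sum_const]
  refine Finset.sum_congr rfl fun x _ => ?_
  rw [card_neighbors_sdiff, ← Finset.sum_add_distrib]
  have : ∀ s : ZMod 4, ((if x + dir s ∉ P then 1 else 0) + if x + dir s ∈ P then 1 else 0) = 1 := by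
    intro s
    split_ifs <;> simp_all
  rw [Finset.sum_congr rfl fun s _ => this s]
  rfl

/-! ### Subcomplexes of the doubled grid -/

/-- Both coordinates are even. -/
def IsBlack (x : ℤ × ℤ) : Prop := x.1 % 2 = 0 ∧ x.2 % 2 = 0

/-- Both coordinates are odd. -/
def IsWhite (x : ℤ × ℤ) : Prop := x.1 % 2 = 1 ∧ x.2 % 2 = 1

/-- The sum of the coordinates is odd. -/
def IsGap (x : ℤ × ℤ) : Prop := (x.1 + x.2) % 2 = 1

instance : DecidablePred IsBlack := fun _ => inferInstanceAs (Decidable (_ ∧ _))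
instance : DecidablePred IsWhite := fun _ => inferInstanceAs (Decidable (_ ∧ _))
instance : DecidablePred IsGap := fun _ => inferInstanceAs (Decidable (_ = _))

/-- Gaps in `Q` have their black neighbours in `Q`, white cells in `Q` have all their neighbours in
`Q`. -/
def Sub (Q : Finset (ℤ × ℤ)) : Prop :=
  ∀ d s, (IsBlack d → d + dir s ∈ Q → d ∈ Q) ∧ (IsWhite d → d ∈ Q → d + dir s ∈ Q)

/-- Such a cell is white, or a gap whose black neighbours are the left and the right one. -/
theorem Sub.left_right {Q : Finset (ℤ × ℤ)} (h : Sub Q) {x : ℤ × ℤ} (hx : x ∈ Q)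
    (hodd : x.1 % 2 = 1) : x + (1, 0) ∈ Q ∧ x - (1, 0) ∈ Q := by
  rcases Int.emod_two_eq_zero_or_one x.2 with h2 | h2
  · refine ⟨(h _ 1).1 ?_ (by simpa [dir_one, add_assoc, Prod.mk_zero_zero] using hx),
      (h _ 3).1 ?_ (by simpa [dir_three] using hx)⟩ <;>
    simp only [IsBlack, Prod.fst_add, Prod.snd_add, Prod.fst_sub, Prod.snd_sub] <;> omega
  · refine ⟨(h x 3).2 ⟨hodd, h2⟩ hx, ?_⟩
    have := (h x 1).2 ⟨hodd, h2⟩ hx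
    rwa [show dir 1 = -(1, 0) from rfl, ← sub_eq_add_neg] at this

theorem Sub.down_up {Q : Finset (ℤ × ℤ)} (h : Sub Q) {x : ℤ × ℤ} (hx : x ∈ Q)
    (hodd : x.2 % 2 = 1) : x + (0, 1) ∈ Q ∧ x - (0, 1) ∈ Q := by
  rcases Int.emod_two_eq_zero_or_one x.1 with h2 | h2
  · refine ⟨(h _ 2).1 ?_ (by simpa [dir_two, add_assoc, Prod.mk_zero_zero] using hx),
      (h _ 0).1 ?_ (by simpa [dir_zero] using hx)⟩ <;>
    simp only [IsBlack, Prod.fst_add, Prod.snd_add, Prod.fst_sub, Prod.snd_sub] <;> omega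
  · refine ⟨(h x 0).2 ⟨h2, hodd⟩ hx, ?_⟩
    have := (h x 2).2 ⟨h2, hodd⟩ hx
    rwa [show dir 2 = -(0, 1) from rfl, ← sub_eq_add_neg] at this

/-- Exactly one cell of a horizontal pair has odd first coordinate, and each such cell of `Q` has
both its horizontal neighbours in `Q`. -/
theorem Sub.card_horPairs {Q : Finset (ℤ × ℤ)} (h : Sub Q) :
    (horPairs Q).card = 2 * (Q.filter fun x => x.1 % 2 = 1).card := by
  rw [← Finset.card_filter_add_card_filter_not (fun x : ℤ × ℤ => x.1 % 2 = 1), two_mul]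
  congr 1
  · congr 1
    ext x
    simp only [horPairs, Finset.mem_filter]
    exact ⟨fun hx => ⟨hx.1.1, hx.2⟩, fun hx => ⟨⟨hx.1, (h.left_right hx.1 hx.2).1⟩, hx.2⟩⟩
  · refine Finset.card_nbij' (· + (1, 0)) (· - (1, 0)) ?_ ?_ ?_ ?_
    · intro x hx
      simp only [horPairs, Finset.coe_filter, Finset.mem_filter, Set.mem_ofPred_eq,
        Prod.fst_add] at hx ⊢
      exact ⟨hx.1.2, by omega⟩
    · intro x hx
      simp only [horPairs, Finset.coe_filter, Finset.mem_filter, Set.mem_ofPred_eq,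
        Prod.fst_sub, sub_add_cancel] at hx ⊢
      exact ⟨⟨(h.left_right hx.1 hx.2).2, hx.1⟩, by omega⟩
    · intro x _
      simp
    · intro x _
      simp

theorem Sub.card_verPairs {Q : Finset (ℤ × ℤ)} (h : Sub Q) :
    (verPairs Q).card = 2 * (Q.filter fun x => x.2 % 2 = 1).card := by
  rw [← Finset.card_filter_add_card_filter_not (fun x : ℤ × ℤ => x.2 % 2 = 1), two_mul]
  congr 1
  · congr 1
    ext x
    simp only [verPairs, Finset.mem_filter]
    exact ⟨fun hx => ⟨hx.1.1, hx.2⟩, fun hx => ⟨⟨hx.1, (h.down_up hx.1 hx.2).1⟩, hx.2⟩⟩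
  · refine Finset.card_nbij' (· + (0, 1)) (· - (0, 1)) ?_ ?_ ?_ ?_
    · intro x hx
      simp only [verPairs, Finset.coe_filter, Finset.mem_filter, Set.mem_ofPred_eq,
        Prod.snd_add] at hx ⊢
      exact ⟨hx.1.2, by omega⟩
    · intro x hx
      simp only [verPairs, Finset.coe_filter, Finset.mem_filter, Set.mem_ofPred_eq,
        Prod.snd_sub, sub_add_cancel] at hx ⊢
      exact ⟨⟨(h.down_up hx.1 hx.2).2, hx.1⟩, by omega⟩
    · intro x _
      simp
    · intro x _
      simp

/-- A black cell has no odd coordinate, a gap has one, a white cell two. -/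
theorem card_odd_add_card_odd (Q : Finset (ℤ × ℤ)) :
    (Q.filter fun x => x.1 % 2 = 1).card + (Q.filter fun x => x.2 % 2 = 1).card =
      (Q.filter IsGap).card + 2 * (Q.filter IsWhite).card := by
  simp only [Finset.card_filter, Finset.mul_sum, ← Finset.sum_add_distrib]
  refine Finset.sum_congr rfl fun x _ => ?_
  have h3 : (x.1 + x.2) % 2 = (x.1 % 2 + x.2 % 2) % 2 := Int.add_emod _ _ _
  rcases Int.emod_two_eq_zero_or_one x.1 with h1 | h1 <;>
  rcases Int.emod_two_eq_zero_or_one x.2 with h2 | h2 <;>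
  simp [IsGap, IsWhite, h3, h1, h2]

theorem card_filter_add_four {α : Type*} (B : Finset α) (p q : α → Prop) [DecidablePred p]
    [DecidablePred q] : B.card = (B.filter fun x => p x ∧ q x).card +
      (B.filter fun x => p x ∧ ¬q x).card + (B.filter fun x => ¬p x ∧ q x).card +
      (B.filter fun x => ¬p x ∧ ¬q x).card := by
  rw [Finset.card_eq_sum_ones]
  simp only [Finset.card_filter, ← Finset.sum_add_distrib]
  refine Finset.sum_congr rfl fun x _ => ?_
  by_cases hp : p x <;> by_cases hq : q x <;> simp [hp, hq]

/-- Every block contains exactly one white cell, and all eight cells around a white cell of `Q` are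
in `Q`, so it lies in four blocks. The four vectors `v` are its possible positions in a block. -/
theorem Sub.card_blocks {Q : Finset (ℤ × ℤ)} (h : Sub Q) :
    (blocks Q).card = 4 * (Q.filter IsWhite).card := by
  have key : ∀ v ∈ ({(0, 0), (1, 0), (0, 1), (1, 1)} : Finset (ℤ × ℤ)),
      ((blocks Q).filter fun x => IsWhite (x + v)).card = (Q.filter IsWhite).card := by
    intro v hv
    refine Finset.card_nbij' (· + v) (· - v) ?_ ?_ ?_ ?_
    · intro x hx
      simp only [blocks, Finset.coe_filter, Finset.mem_filter, Set.mem_ofPred_eq] at hx ⊢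
      refine ⟨?_, hx.2⟩
      simp only [Finset.mem_insert, Finset.mem_singleton] at hv
      obtain ⟨⟨h1, h2, h3, h4⟩, -⟩ := hx
      rcases hv with rfl | rfl | rfl | rfl
      · simpa [Prod.mk_zero_zero] using h1
      · exact h2
      · exact h3
      · exact h4
    · intro x hx
      simp only [blocks, Finset.coe_filter, Finset.mem_filter, Set.mem_ofPred_eq,
        sub_add_cancel] at hx ⊢
      refine ⟨?_, hx.2⟩
      obtain ⟨hx, hw1, hw2⟩ := hx
      obtain ⟨hu, hd⟩ := h.down_up hx hw2
      obtain ⟨hr, hl⟩ := h.left_right hx hw1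
      obtain ⟨hur, hul⟩ := h.left_right hu (by simpa using hw1)
      obtain ⟨hdr, hdl⟩ := h.left_right hd (by simpa using hw1)
      obtain ⟨a, b⟩ := x
      simp only [Finset.mem_insert, Finset.mem_singleton] at hv
      rcases hv with rfl | rfl | rfl | rfl <;>
      simp only [Prod.mk_add_mk, Prod.mk_sub_mk, add_zero, sub_zero, sub_add_cancel] at * <;>
      refine ⟨?_, ?_, ?_, ?_⟩ <;> assumption
    · intro x _
      simp
    · intro x _
      simp
  rw [card_filter_add_four (blocks Q) (fun x => x.1 % 2 = 1) (fun x => x.2 % 2 = 1)]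
  have k1 := key (0, 0) (by simp)
  have k2 := key (1, 0) (by simp)
  have k3 := key (0, 1) (by simp)
  have k4 := key (1, 1) (by simp)
  have c : ∀ (p q : ℤ × ℤ → Prop) [DecidablePred p] [DecidablePred q], (∀ x, p x ↔ q x) →
      ((blocks Q).filter p).card = ((blocks Q).filter q).card := by
    intro p q _ _ hpq
    congr 1
    exact Finset.filter_congr fun x _ => hpq x
  rw [c _ (fun x : ℤ × ℤ => x.1 % 2 = 1 ∧ x.2 % 2 = 1)] at k1
  rw [c _ (fun x : ℤ × ℤ => ¬x.1 % 2 = 1 ∧ x.2 % 2 = 1)] at k2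
  rw [c _ (fun x : ℤ × ℤ => x.1 % 2 = 1 ∧ ¬x.2 % 2 = 1)] at k3
  rw [c _ (fun x : ℤ × ℤ => ¬x.1 % 2 = 1 ∧ ¬x.2 % 2 = 1)] at k4
  · omega
  all_goals
    intro x
    simp only [IsWhite, Prod.fst_add, Prod.snd_add]
    omega

/-- Cardinality and perimeter of a hole-free subcomplex in terms of its gaps and white cells. -/
theorem Sub.card_eq {Q : Finset (ℤ × ℤ)} (h : Sub Q) (hQ : IsHoleFreePolyomino Q) :
    Q.card = 2 * (Q.filter IsGap).card + 1 ∧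
      perimeter Q + 8 * (Q.filter IsWhite).card = 4 * (Q.filter IsGap).card + 4 := by
  -- With `g` gaps and `w` white cells there are `2(g + 2w)` adjacent pairs and `4w` blocks. In
  -- Euler's formula `w` cancels and leaves `2g + 1` cells.
  have h1 := euler_formula hQ
  have h2 := perimeter_add Q
  have h3 := card_odd_add_card_odd Q
  rw [h.card_horPairs, h.card_verPairs] at h1 h2
  rw [h.card_blocks] at h1
  omega

/-! ### Refinement -/

/-- The doubled polyomino: a cell of the doubled grid belongs to it if all cells of the original
grid that it touches are in `P`. -/
def refinement (P : Finset (ℤ × ℤ)) : Finset (ℤ × ℤ) :=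
  ((P ×ˢ (({0, 1} : Finset ℤ) ×ˢ ({0, 1} : Finset ℤ))).image
    fun x => (2 * x.1.1 + x.2.1, 2 * x.1.2 + x.2.2)).filter fun y =>
      ∀ i ∈ ({0, 1} : Finset ℤ), ∀ j ∈ ({0, 1} : Finset ℤ), ((y.1 + i) / 2, (y.2 + j) / 2) ∈ P

theorem mem_refinement {P : Finset (ℤ × ℤ)} {y : ℤ × ℤ} : y ∈ refinement P ↔
    ∀ i ∈ ({0, 1} : Finset ℤ), ∀ j ∈ ({0, 1} : Finset ℤ), ((y.1 + i) / 2, (y.2 + j) / 2) ∈ P := by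
  rw [refinement, Finset.mem_filter, and_iff_right_iff_imp]
  intro h
  refine Finset.mem_image.2 ⟨((y.1 / 2, y.2 / 2), (y.1 % 2, y.2 % 2)), ?_, ?_⟩
  · have := h 0 (by simp) 0 (by simp)
    simp only [Finset.mem_product, Finset.mem_insert, Finset.mem_singleton]
    exact ⟨by simpa using this, by omega, by omega⟩
  · ext <;> simp only <;> omega

theorem mem_refinement_black {P : Finset (ℤ × ℤ)} {a b : ℤ} :
    (2 * a, 2 * b) ∈ refinement P ↔ (a, b) ∈ P := by
  simp [mem_refinement, show (2 * a + 1) / 2 = a by omega, show (2 * b + 1) / 2 = b by omega]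

theorem mem_refinement_hor {P : Finset (ℤ × ℤ)} {a b : ℤ} :
    (2 * a + 1, 2 * b) ∈ refinement P ↔ (a, b) ∈ P ∧ (a + 1, b) ∈ P := by
  simp [mem_refinement, show (2 * a + 1) / 2 = a by omega, show (2 * b + 1) / 2 = b by omega,
    show (2 * a + 1 + 1) / 2 = a + 1 by omega]

theorem mem_refinement_ver {P : Finset (ℤ × ℤ)} {a b : ℤ} :
    (2 * a, 2 * b + 1) ∈ refinement P ↔ (a, b) ∈ P ∧ (a, b + 1) ∈ P := by
  simp [mem_refinement, show (2 * a + 1) / 2 = a by omega, show (2 * b + 1) / 2 = b by omega,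
    show (2 * b + 1 + 1) / 2 = b + 1 by omega]

theorem mem_refinement_white {P : Finset (ℤ × ℤ)} {a b : ℤ} :
    (2 * a + 1, 2 * b + 1) ∈ refinement P ↔
      ((a, b) ∈ P ∧ (a, b + 1) ∈ P) ∧ (a + 1, b) ∈ P ∧ (a + 1, b + 1) ∈ P := by
  simp [mem_refinement, show (2 * a + 1) / 2 = a by omega, show (2 * b + 1) / 2 = b by omega,
    show (2 * b + 1 + 1) / 2 = b + 1 by omega, show (2 * a + 1 + 1) / 2 = a + 1 by omega]

theorem conn_double {P S : Set (ℤ × ℤ)}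
    (h0 : ∀ a b, (a, b) ∈ P → (2 * a, 2 * b) ∈ S)
    (h1 : ∀ a b, (a, b) ∈ P → (a + 1, b) ∈ P → (2 * a + 1, 2 * b) ∈ S)
    (h2 : ∀ a b, (a, b) ∈ P → (a, b + 1) ∈ P → (2 * a, 2 * b + 1) ∈ S)
    {x y : ℤ × ℤ} (h : Conn P x y) : Conn S (2 * x.1, 2 * x.2) (2 * y.1, 2 * y.2) := by
  induction h with
  | refl => exact Conn.refl _
  | @tail c d _ hcd ih =>
    refine ih.trans ?_
    clear ih
    have hr : ∀ a b, (a, b) ∈ P → (a + 1, b) ∈ P → Conn S (2 * a, 2 * b) (2 * (a + 1), 2 * b) :=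
      fun a b ha hb => (Conn.step' 3 (h0 _ _ ha) (h1 _ _ ha hb) (by simp [dir_three])).trans
        (Conn.step' 3 (h1 _ _ ha hb) (h0 _ _ hb) (by rw [dir_three, Prod.mk_add_mk, add_zero]; congr 1; ring))
    have hu : ∀ a b, (a, b) ∈ P → (a, b + 1) ∈ P → Conn S (2 * a, 2 * b) (2 * a, 2 * (b + 1)) :=
      fun a b ha hb => (Conn.step' 0 (h0 _ _ ha) (h2 _ _ ha hb) (by simp [dir_zero])).trans
        (Conn.step' 0 (h2 _ _ ha hb) (h0 _ _ hb) (by rw [dir_zero, Prod.mk_add_mk, add_zero]; congr 1; ring))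
    obtain ⟨hc, hd, s, rfl⟩ := hcd
    obtain ⟨a, b⟩ := c
    revert s
    refine forall_side.2 ⟨fun hd => ?_, fun hd => ?_, fun hd => ?_, fun hd => ?_⟩ <;>
    simp only [dir_zero, dir_one, dir_two, dir_three, Prod.mk_add_mk, add_zero] at hd ⊢
    · exact hu a b hc hd
    · simpa using (hr (a + -1) b hd (by simpa using hc)).symm
    · simpa using (hu a (b + -1) hd (by simpa using hc)).symm
    · exact hr a b hc hd

/-- A path of at most two steps, first horizontal and then vertical, to a black cell that `y`
touches. -/
theorem conn_of_even {S : Set (ℤ × ℤ)} {y : ℤ × ℤ} {i j : ℤ} (hi : i = 0 ∨ i = 1)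
    (hj : j = 0 ∨ j = 1) (h0 : y ∈ S) (h1 : (2 * ((y.1 + i) / 2), y.2) ∈ S)
    (h2 : (2 * ((y.1 + i) / 2), 2 * ((y.2 + j) / 2)) ∈ S) :
    Conn S y (2 * ((y.1 + i) / 2), 2 * ((y.2 + j) / 2)) := by
  obtain ⟨a, b⟩ := y
  simp only at *
  refine (conn_horizontal (i := a) (j := 2 * ((a + i) / 2)) fun t ht ht' => ?_).trans
    (conn_vertical fun t ht ht' => ?_)
  · rcases (by omega : t = a ∨ t = 2 * ((a + i) / 2)) with rfl | rfl <;> assumption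
  · rcases (by omega : t = b ∨ t = 2 * ((b + j) / 2)) with rfl | rfl <;> assumption

/-- A cell of the refinement touches only doubled cells of `P`, and a cell outside touches a doubled
cell outside `P`. Either way it moves to such a cell on its own side; from there a path between
original cells is doubled. -/
theorem isHoleFree_refinement {P : Finset (ℤ × ℤ)} (h : IsHoleFreePolyomino P) :
    IsHoleFreePolyomino (refinement P) := by
  rw [isHoleFree_iff] at h ⊢
  obtain ⟨⟨x, hx⟩, hP, hPc⟩ := h
  have z01 : (0 : ℤ) ∈ ({0, 1} : Finset ℤ) := by simp
  refine ⟨⟨(2 * x.1, 2 * x.2), mem_refinement_black.2 hx⟩, ?_, ?_⟩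
  · have key : ∀ y ∈ refinement P, ∃ x ∈ P, Conn (refinement P) y (2 * x.1, 2 * x.2) := by
      intro y hy
      have hy' := mem_refinement.1 hy
      refine ⟨_, hy' 0 z01 0 z01, conn_of_even (Or.inl rfl) (Or.inl rfl) hy ?_ ?_⟩
      · rw [Finset.mem_coe, mem_refinement]
        intro i hi j hj
        have e : (2 * ((y.1 + 0) / 2) + i) / 2 = (y.1 + 0) / 2 := by
          simp only [Finset.mem_insert, Finset.mem_singleton] at hi; omega
        simp only [e]
        exact hy' 0 z01 j hj
      · rw [Finset.mem_coe, mem_refinement_black]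
        exact hy' 0 z01 0 z01
    intro a ha b hb
    obtain ⟨x, hx, hax⟩ := key a ha
    obtain ⟨y, hy, hby⟩ := key b hb
    refine hax.trans (Conn.trans ?_ hby.symm)
    refine conn_double ?_ ?_ ?_ (hP x hx y hy)
    · exact fun a b h => mem_refinement_black.2 h
    · exact fun a b h h' => mem_refinement_hor.2 ⟨h, h'⟩
    · exact fun a b h h' => mem_refinement_ver.2 ⟨h, h'⟩
  · have key : ∀ y ∉ refinement P, ∃ x ∉ P,
        Conn ((refinement P : Set (ℤ × ℤ))ᶜ) y (2 * x.1, 2 * x.2) := by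
      intro y hy
      have hy' := mt mem_refinement.2 hy
      push Not at hy'
      obtain ⟨i, hi, j, hj, hij⟩ := hy'
      refine ⟨_, hij, conn_of_even (by simpa using hi) (by simpa using hj) (by simpa using hy) ?_ ?_⟩
      · rw [Set.mem_compl_iff, Finset.mem_coe, mem_refinement]
        intro hall
        have := hall 0 z01 j hj
        have e : (2 * ((y.1 + i) / 2) + 0) / 2 = (y.1 + i) / 2 := by omega
        simp only [e] at this
        exact hij this
      · rw [Set.mem_compl_iff, Finset.mem_coe, mem_refinement_black]
        exact hij
    intro a ha b hb
    obtain ⟨x, hx, hax⟩ := key a ha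
    obtain ⟨y, hy, hby⟩ := key b hb
    refine hax.trans (Conn.trans ?_ hby.symm)
    refine conn_double ?_ ?_ ?_ (hPc x hx y hy)
    · exact fun a b h h' => h (mem_refinement_black.1 h')
    · exact fun a b h _ h' => h (mem_refinement_hor.1 h').1
    · exact fun a b h _ h' => h (mem_refinement_ver.1 h').1

theorem sub_refinement (P : Finset (ℤ × ℤ)) : Sub (refinement P) := by
  rintro ⟨a, b⟩ s
  have hl : ∀ a b : ℤ, (2 * a + -1, b) = (2 * (a - 1) + 1, b) := fun a b => by
    congr 1; ring
  have hd : ∀ a b : ℤ, (b, 2 * a + -1) = (b, 2 * (a - 1) + 1) := fun a b => by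
    congr 1; ring
  have hr : ∀ a b : ℤ, (2 * a + 1 + 1, b) = (2 * (a + 1), b) := fun a b => by
    congr 1; ring
  have hu : ∀ a b : ℤ, (b, 2 * a + 1 + 1) = (b, 2 * (a + 1)) := fun a b => by
    congr 1; ring
  refine ⟨fun hb => ?_, fun hw => ?_⟩
  · obtain ⟨p, rfl⟩ : ∃ p, a = 2 * p := ⟨a / 2, by have := hb.1; simp only at this; omega⟩
    obtain ⟨q, rfl⟩ : ∃ q, b = 2 * q := ⟨b / 2, by have := hb.2; simp only at this; omega⟩
    revert s
    simp only [forall_side, dir_zero, dir_one, dir_two, dir_three, Prod.mk_add_mk, add_zero, hl, hd,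
      mem_refinement_black, mem_refinement_hor, mem_refinement_ver, sub_add_cancel]
    tauto
  · obtain ⟨p, rfl⟩ : ∃ p, a = 2 * p + 1 := ⟨a / 2, by have := hw.1; simp only at this; omega⟩
    obtain ⟨q, rfl⟩ : ∃ q, b = 2 * q + 1 := ⟨b / 2, by have := hw.2; simp only at this; omega⟩
    revert s
    simp only [forall_side, dir_zero, dir_one, dir_two, dir_three, Prod.mk_add_mk, add_zero, hr, hu,
      add_neg_cancel_right, mem_refinement_white, mem_refinement_hor, mem_refinement_ver]
    tauto

theorem card_gaps_refinement (P : Finset (ℤ × ℤ)) :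
    ((refinement P).filter IsGap).card = (horPairs P).card + (verPairs P).card := by
  have e : (refinement P).filter IsGap = (horPairs P).image (fun x => (2 * x.1 + 1, 2 * x.2)) ∪
      (verPairs P).image (fun x => (2 * x.1, 2 * x.2 + 1)) := by
    ext ⟨a, b⟩
    simp only [Finset.mem_filter, Finset.mem_union, Finset.mem_image, Prod.mk.injEq, IsGap,
      Prod.exists, mem_horPairs, mem_verPairs, Prod.mk_add_mk, add_zero]
    constructor
    · rintro ⟨h, hg⟩
      rcases Int.emod_two_eq_zero_or_one a with ha | ha
      · obtain ⟨p, rfl⟩ : ∃ p, a = 2 * p := ⟨a / 2, by omega⟩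
        obtain ⟨q, rfl⟩ : ∃ q, b = 2 * q + 1 := ⟨b / 2, by omega⟩
        exact Or.inr ⟨p, q, mem_refinement_ver.1 h, rfl, rfl⟩
      · obtain ⟨p, rfl⟩ : ∃ p, a = 2 * p + 1 := ⟨a / 2, by omega⟩
        obtain ⟨q, rfl⟩ : ∃ q, b = 2 * q := ⟨b / 2, by omega⟩
        exact Or.inl ⟨p, q, mem_refinement_hor.1 h, rfl, rfl⟩
    · rintro (⟨p, q, h, rfl, rfl⟩ | ⟨p, q, h, rfl, rfl⟩)
      · exact ⟨mem_refinement_hor.2 h, by omega⟩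
      · exact ⟨mem_refinement_ver.2 h, by omega⟩
  rw [e, Finset.card_union_of_disjoint, Finset.card_image_of_injective,
    Finset.card_image_of_injective]
  · intro x y h
    simp only [Prod.mk.injEq] at h
    ext <;> omega
  · intro x y h
    simp only [Prod.mk.injEq] at h
    ext <;> omega
  · rw [Finset.disjoint_left]
    intro x hx hx'
    obtain ⟨y, -, rfl⟩ := Finset.mem_image.1 hx
    obtain ⟨z, -, hz⟩ := Finset.mem_image.1 hx'
    simp only [Prod.mk.injEq] at hz
    omega

theorem card_white_refinement (P : Finset (ℤ × ℤ)) :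
    ((refinement P).filter IsWhite).card = (blocks P).card := by
  have e : (refinement P).filter IsWhite =
      (blocks P).image (fun x => (2 * x.1 + 1, 2 * x.2 + 1)) := by
    ext ⟨a, b⟩
    simp only [Finset.mem_filter, Finset.mem_image, Prod.mk.injEq, IsWhite,
      Prod.exists, mem_blocks, Prod.mk_add_mk, add_zero]
    constructor
    · rintro ⟨h, hg⟩
      obtain ⟨p, rfl⟩ : ∃ p, a = 2 * p + 1 := ⟨a / 2, by omega⟩
      obtain ⟨q, rfl⟩ : ∃ q, b = 2 * q + 1 := ⟨b / 2, by omega⟩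
      have := mem_refinement_white.1 h
      exact ⟨p, q, by tauto, rfl, rfl⟩
    · rintro ⟨p, q, h, rfl, rfl⟩
      exact ⟨mem_refinement_white.2 (by tauto), by omega⟩
  rw [e, Finset.card_image_of_injective]
  intro x y h
  simp only [Prod.mk.injEq] at h
  ext <;> omega

/-- Gaps of the refinement are adjacent pairs in `P`, white cells are blocks of `P`. Eliminating the
blocks by Euler's formula leaves an expression in cells and pairs, which is that of `perimeter_add`.
-/
theorem perimeter_refinement {P : Finset (ℤ × ℤ)} (h : IsHoleFreePolyomino P) :
    perimeter (refinement P) + 4 = 2 * perimeter P := by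
  have h1 := ((sub_refinement P).card_eq (isHoleFree_refinement h)).2
  have h2 := euler_formula h
  have h3 := perimeter_add P
  rw [card_gaps_refinement, card_white_refinement] at h1
  omega

/-! ### Subcomplexes from spanning trees -/

/-- A new black cell `b` is hung on the black cell `b + dir s + dir s` through the gap between them.
Apart from that gap, `b` is surrounded by cells outside `Q`, so the complement stays connected. -/
theorem Sub.grow {Q : Finset (ℤ × ℤ)} (h : Sub Q) (hQ : IsHoleFreePolyomino Q) {b : ℤ × ℤ}
    {s : ZMod 4} (hb : IsBlack b) (hbQ : b ∉ Q) (hs : b + dir s + dir s ∈ Q) :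
    Sub (insert b (insert (b + dir s) Q)) ∧
      IsHoleFreePolyomino (insert b (insert (b + dir s) Q)) := by
  -- A gap next to `b` in `Q` would force `b` into `Q`, and a white cell diagonal to `b` would force
  -- such a gap.
  have hg : ∀ t, b + dir t ∉ Q := fun t ht => hbQ ((h b t).1 hb ht)
  have hw : ∀ t, b + dir t + dir (t + 1) ∉ Q := fun t ht => by
    refine hg t ?_
    rw [← add_dir_add_dir_two (b + dir t) (t + 1)]
    refine (h _ _).2 ?_ ht
    have hodd : ∀ t, ((dir t).1 + (dir (t + 1)).1) % 2 = 1 ∧ ((dir t).2 + (dir (t + 1)).2) % 2 = 1 := by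
      decide
    obtain ⟨hb1, hb2⟩ := hb
    obtain ⟨h1, h2⟩ := hodd t
    simp only [IsWhite, Prod.fst_add, Prod.snd_add]
    omega
  have hpar : ∀ t, ¬IsBlack (b + dir t) ∧ ¬IsWhite (b + dir t) := by
    obtain ⟨hb1, hb2⟩ := hb
    refine forall_side.2 ⟨?_, ?_, ?_, ?_⟩ <;>
    constructor <;> simp [dir, IsBlack, IsWhite] <;> omega
  constructor
  · intro d t
    constructor
    · intro hd hdt
      rw [Finset.mem_insert, Finset.mem_insert] at hdt ⊢
      rcases hdt with hdt | hdt | hdt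
      · have := (hpar (t + 2)).1
        rw [← hdt, add_dir_add_dir_two] at this
        exact (this hd).elim
      · have hd' : d = b + dir s + dir (t + 2) := by rw [← hdt, add_dir_add_dir_two]
        by_cases hts : t = s
        · subst hts
          exact Or.inl (by rw [hd', add_dir_add_dir_two])
        · by_cases hts' : t + 2 = s
          · subst hts'
            exact Or.inr (Or.inr (by rwa [hd']))
          · exfalso
            obtain ⟨hb1, hb2⟩ := hb
            obtain ⟨hd1, hd2⟩ := hd
            rw [hd'] at hd1 hd2
            have heven : ∀ s t : ZMod 4, ((dir s).1 + (dir (t + 2)).1) % 2 = 0 →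
                ((dir s).2 + (dir (t + 2)).2) % 2 = 0 → t = s ∨ t + 2 = s := by
              decide
            simp only [Prod.fst_add, Prod.snd_add] at hd1 hd2
            rcases heven s t (by omega) (by omega) with h1 | h1
            exacts [hts h1, hts' h1]
      · exact Or.inr (Or.inr ((h d t).1 hd hdt))
    · intro hd hdQ
      rw [Finset.mem_insert, Finset.mem_insert] at hdQ ⊢
      rcases hdQ with rfl | rfl | hdQ
      · exact absurd hd.1 (by rw [hb.1]; decide)
      · exact ((hpar s).2 hd).elim
      · exact Or.inr (Or.inr ((h d t).2 hd hdQ))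
  · rw [isHoleFree_iff] at hQ ⊢
    obtain ⟨-, hQc, hQcc⟩ := hQ
    refine ⟨Finset.insert_nonempty _ _, ?_, ?_⟩
    · have hsub : (Q : Set (ℤ × ℤ)) ⊆ (insert b (insert (b + dir s) Q) : Finset (ℤ × ℤ)) := by
        intro x hx
        simp [Finset.mem_coe.1 hx]
      have key : ∀ a ∈ insert b (insert (b + dir s) Q),
          Conn (insert b (insert (b + dir s) Q) : Finset (ℤ × ℤ)) a (b + dir s + dir s) := by
        intro a ha
        have h1 : Conn (insert b (insert (b + dir s) Q) : Finset (ℤ × ℤ)) (b + dir s)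
            (b + dir s + dir s) := Conn.step s (by simp) (by simp [hs])
        rw [Finset.mem_insert, Finset.mem_insert] at ha
        rcases ha with rfl | rfl | ha
        · exact (Conn.step s (by simp) (by simp)).trans h1
        · exact h1
        · exact (hQc a ha _ hs).mono hsub
      exact fun a ha a' ha' => (key a ha).trans (key a' ha').symm
    · intro a ha a' ha'
      set S' : Set (ℤ × ℤ) := (((insert b (insert (b + dir s) Q) : Finset (ℤ × ℤ)) : Set (ℤ × ℤ)))ᶜ
        with hS'
      have hmem : ∀ x, x ∈ S' ↔ x ≠ b ∧ x ≠ b + dir s ∧ x ∉ Q := by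
        intro x
        simp [hS', not_or]
      have hE : ∀ r, r ≠ 0 → b + dir (s + r) ∈ S' := by
        intro r hr
        refine (hmem _).2 ⟨?_, ?_, hg _⟩
        · simpa using dir_ne_zero _
        · intro he
          have := dir_injective (add_left_cancel he)
          exact hr (by simpa using this)
      have hC : ∀ t, b + dir t + dir (t + 1) ∈ S' := by
        intro t
        refine (hmem _).2 ⟨?_, ?_, hw _⟩
        · rw [add_assoc]
          simp only [ne_eq, add_eq_left]
          clear * -
          revert t; decide
        · rw [add_assoc]
          simp only [ne_eq, add_right_inj]
          clear * -
          revert s t; decide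
      -- The ring of the seven cells around `b` other than the gap. It is a path in the complement,
      -- and it contains every remaining cell next to `b` or to the gap.
      let K : Set (ℤ × ℤ) := {x | x ∈ S' ∧ ∃ t, x = b + dir t ∨ x = b + dir t + dir (t + 1)}
      have hK : ∀ x ∈ K, Conn S' x (b + dir (s + 2)) := by
        have hcomm : ∀ t u : ZMod 4, b + dir t + dir u = b + dir u + dir t :=
          fun t u => add_right_comm _ _ _
        have e1 : Conn S' (b + dir (s + 1)) (b + dir (s + 2)) := by
          have c1 : Conn S' (b + dir (s + 1)) (b + dir (s + 1) + dir (s + 1 + 1)) :=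
            Conn.step _ (hE 1 (by decide)) (hC _)
          refine c1.trans (Conn.step' (s + 1 + 2) (hC _) (hE 2 (by decide)) ?_)
          rw [hcomm, add_dir_add_dir_two, add_assoc s]; rfl
        have e3 : Conn S' (b + dir (s + 3)) (b + dir (s + 2)) := by
          have hc := hC (s + 2)
          rw [add_assoc s, show (2 : ZMod 4) + 1 = 3 from rfl] at hc
          have c1 : Conn S' (b + dir (s + 2)) (b + dir (s + 2) + dir (s + 3)) :=
            Conn.step _ (hE 2 (by decide)) hc
          refine (c1.trans (Conn.step' (s + 2 + 2) hc (hE 3 (by decide)) ?_)).symm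
          rw [hcomm, add_dir_add_dir_two]
        rintro x ⟨hx, t, ht⟩
        obtain ⟨r, rfl⟩ : ∃ r, t = s + r := ⟨t - s, by ring⟩
        rcases ht with rfl | rfl
        · revert r
          refine forall_side.2 ⟨fun hx => ?_, fun _ => e1, fun _ => Conn.refl _, fun _ => e3⟩
          exact absurd (by rw [add_zero]) ((hmem _).1 hx).2.1
        · clear hx
          revert r
          refine forall_side.2 ⟨?_, ?_, ?_, ?_⟩
          · refine (Conn.step' (s + 0 + 2) (hC _) (hE 1 (by decide)) ?_).trans e1
            rw [hcomm, add_dir_add_dir_two, add_zero]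
          · refine (Conn.step' (s + 1 + 2) (hC _) (hE 2 (by decide)) ?_)
            rw [hcomm, add_dir_add_dir_two, add_assoc s]; rfl
          · refine (Conn.step' (s + 2 + 1 + 2) (hC _) (hE 2 (by decide)) ?_)
            rw [add_dir_add_dir_two]
          · refine (Conn.step' (s + 3 + 1 + 2) (hC _) (hE 3 (by decide)) ?_).trans e3
            rw [add_dir_add_dir_two]
      refine conn_remove (S := (Q : Set (ℤ × ℤ))ᶜ) (S' := S') (R := {b, b + dir s}) (K := K)
        ?_ ?_ ?_ (fun x hx y hy => (hK x hx).trans (hK y hy).symm) ha ha' ?_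
      · intro x hx
        by_cases h1 : x = b
        · exact Or.inr (Or.inl h1)
        · by_cases h2 : x = b + dir s
          · exact Or.inr (Or.inr h2)
          · exact Or.inl ((hmem x).2 ⟨h1, h2, hx⟩)
      · rintro x hx (h1 | h1)
        · exact ((hmem x).1 hx).1 h1
        · exact ((hmem x).1 hx).2.1 h1
      · rintro x hx t (ht | ht)
        · refine ⟨hx, t + 2, Or.inl ?_⟩
          rw [← ht, add_dir_add_dir_two]
        · have hx' : x = b + dir s + dir (t + 2) := by rw [← ht, add_dir_add_dir_two]
          obtain ⟨r, hr⟩ : ∃ r, t + 2 = s + r := ⟨t + 2 - s, by ring⟩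
          rw [hr] at hx'
          clear hr ht
          obtain ⟨h1, h2, h3⟩ := (hmem x).1 hx
          revert r
          refine forall_side.2 ⟨fun e => ?_, fun e => ?_, fun e => ?_, fun e => ?_⟩
          · rw [add_zero] at e
            exact (h3 (e ▸ hs)).elim
          · exact ⟨hx, s, Or.inr e⟩
          · rw [add_dir_add_dir_two] at e
            exact (h1 e).elim
          · refine ⟨hx, s + 3, Or.inr ?_⟩
            rw [e, add_right_comm, add_assoc s, show (3 : ZMod 4) + 1 = 0 from rfl, add_zero]
      · refine hQcc a (fun hh => ha ?_) a' (fun hh => ha' ?_) <;> simp [hh]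

/-- A path through `b` can be diverted along the ring of eight cells around it. -/
theorem isHoleFree_singleton (b : ℤ × ℤ) : IsHoleFreePolyomino {b} := by
  rw [isHoleFree_iff]
  refine ⟨Finset.singleton_nonempty b, ?_, ?_⟩
  · intro x hx y hy
    rw [Finset.mem_singleton] at hx hy
    exact Conn.of_eq (hx.trans hy.symm)
  · intro x hx y hy
    have hE : ∀ r, b + dir r ∈ ((({b} : Finset (ℤ × ℤ)) : Set (ℤ × ℤ)))ᶜ := by
      intro r
      simpa using dir_ne_zero r
    have hC : ∀ t, b + dir t + dir (t + 1) ∈ ((({b} : Finset (ℤ × ℤ)) : Set (ℤ × ℤ)))ᶜ := by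
      intro t
      rw [add_assoc]
      simp only [Finset.coe_singleton, Set.mem_compl_iff, Set.mem_singleton_iff, add_eq_left]
      revert t; decide
    have step : ∀ t, Conn ((({b} : Finset (ℤ × ℤ)) : Set (ℤ × ℤ)))ᶜ (b + dir t) (b + dir (t + 1)) := by
      intro t
      refine (Conn.step _ (hE _) (hC t)).trans (Conn.step' (t + 2) (hC t) (hE _) ?_)
      rw [add_right_comm, add_dir_add_dir_two]
    have hK : ∀ t, Conn ((({b} : Finset (ℤ × ℤ)) : Set (ℤ × ℤ)))ᶜ (b + dir t) (b + dir 0) := by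
      refine forall_side.2 ⟨Conn.refl _, (step 0).symm, ?_, step 3⟩
      exact (step 2).trans (step 3)
    refine conn_remove (S := Set.univ) (R := {b}) (K := {x | ∃ t, x = b + dir t})
      (fun x _ => ?_) (fun x hx => by simpa using hx) ?_ ?_ (by simpa using hx) (by simpa using hy) ?_
    · by_cases h : x = b
      · exact Or.inr h
      · exact Or.inl (by simpa using h)
    · intro a _ s hs
      exact ⟨s + 2, by rw [← Set.mem_singleton_iff.1 hs, add_dir_add_dir_two]⟩
    · rintro _ ⟨s, rfl⟩ _ ⟨t, rfl⟩
      exact (hK s).trans (hK t).symm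
    · exact (conn_horizontal (j := y.1) fun _ _ _ => Set.mem_univ _).trans
        (conn_vertical fun _ _ _ => Set.mem_univ _)

theorem sub_singleton {b : ℤ × ℤ} (hb : IsBlack b) : Sub {b} := by
  intro d s
  simp only [Finset.mem_singleton]
  constructor
  · intro hd h
    exfalso
    obtain ⟨hd1, hd2⟩ := hd
    subst h
    obtain ⟨hb1, hb2⟩ := hb
    revert s
    refine forall_side.2 ⟨?_, ?_, ?_, ?_⟩ <;> simp [dir] <;> omega
  · rintro hd rfl
    have h1 := hd.1
    have h2 := hb.1
    omega

/-- Every connected finite set of cells is the set of black cells of a tree-like subcomplex. -/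
theorem exists_tree {P : Finset (ℤ × ℤ)} (hne : P.Nonempty) (hP : ∀ a ∈ P, ∀ b ∈ P, Conn P a b) :
    ∃ Q, Sub Q ∧ IsHoleFreePolyomino Q ∧ Q.card + 1 = 2 * P.card ∧ ∀ x, x + x ∈ Q ↔ x ∈ P := by
  have hblack : ∀ x : ℤ × ℤ, IsBlack (x + x) := fun x => by
    constructor <;> simp only [Prod.fst_add, Prod.snd_add] <;> omega
  have hdbl : ∀ x y : ℤ × ℤ, x + x = y + y ↔ x = y := fun x y => by
    simp only [Prod.ext_iff, Prod.fst_add, Prod.snd_add]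
    omega
  -- Induction on the number of cells already in the tree. Each new cell brings exactly one gap,
  -- whence `2k - 1` cells for `k` cells of `P`.
  suffices H : ∀ k, 1 ≤ k → k ≤ P.card → ∃ P' ⊆ P, P'.card = k ∧ ∃ Q, Sub Q ∧
      IsHoleFreePolyomino Q ∧ Q.card + 1 = 2 * P'.card ∧ ∀ x, x + x ∈ Q ↔ x ∈ P' by
    obtain ⟨P', hP', hc, h⟩ := H P.card hne.card_pos le_rfl
    rwa [Finset.eq_of_subset_of_card_le hP' hc.ge] at h
  intro k hk
  induction k, hk using Nat.le_induction with
  | base =>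
    intro _
    obtain ⟨a, ha⟩ := hne
    refine ⟨{a}, by simpa using ha, rfl, {a + a}, sub_singleton (hblack a), isHoleFree_singleton _,
      rfl, fun x => ?_⟩
    rw [Finset.mem_singleton, Finset.mem_singleton, hdbl]
  | succ k hk ih =>
    intro hkP
    obtain ⟨P', hP', hc, Q, hQ, hQhf, hQc, hQP⟩ := ih (by omega)
    obtain ⟨a, ha⟩ : P'.Nonempty := Finset.card_pos.1 (by omega)
    obtain ⟨b, hb, hb'⟩ : ∃ b ∈ P, b ∉ P' := by
      by_contra! hcon
      have := Finset.card_le_card hcon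
      omega
    -- The first step by which a path in `P` leaves `P'`.
    obtain ⟨c, s, hcP, hcP', hcs⟩ : ∃ c s, c ∈ P ∧ c ∉ P' ∧ c + dir s ∈ P' := by
      have hab := hP a (hP' ha) b hb
      clear hb
      induction hab with
      | refl => exact (hb' ha).elim
      | @tail d e _ hde ihd =>
        obtain ⟨_, he, s, rfl⟩ := hde
        by_cases hd : d ∈ P'
        · exact ⟨d + dir s, s + 2, he, hb', by rwa [add_dir_add_dir_two]⟩
        · exact ihd hd
    have hbc : c + c ∉ Q := fun h => hcP' ((hQP c).1 h)
    have hcc : c + c + dir s + dir s ∈ Q := by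
      have := (hQP (c + dir s)).2 hcs
      rwa [show c + dir s + (c + dir s) = c + c + dir s + dir s by abel] at this
    obtain ⟨h1, h2⟩ := hQ.grow hQhf (hblack c) hbc hcc
    have hgap : c + c + dir s ∉ Q := fun h => hbc ((hQ _ s).1 (hblack c) h)
    refine ⟨insert c P', Finset.insert_subset hcP hP', by rw [Finset.card_insert_of_notMem hcP', hc],
      _, h1, h2, ?_, fun x => ?_⟩
    · rw [Finset.card_insert_of_notMem hcP', Finset.card_insert_of_notMem,
        Finset.card_insert_of_notMem hgap]
      · omega
      · rw [Finset.mem_insert, not_or]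
        exact ⟨by simpa using dir_ne_zero s, hbc⟩
    · rw [Finset.mem_insert, Finset.mem_insert, Finset.mem_insert, hQP, hdbl]
      refine or_congr_right (or_iff_right fun h => ?_)
      have h3 := hblack x
      rw [h] at h3
      obtain ⟨h3, h4⟩ := h3
      clear * - h3 h4
      revert s
      refine forall_side.2 ⟨?_, ?_, ?_, ?_⟩ <;> simp [dir] <;> omega


/-! ### Translations of polyominoes -/

/-- The translate of a set of cells. -/
def shift (v : ℤ × ℤ) (P : Finset (ℤ × ℤ)) : Finset (ℤ × ℤ) := P.image fun x => x + v

theorem mem_shift {v x : ℤ × ℤ} {P : Finset (ℤ × ℤ)} : x ∈ shift v P ↔ x - v ∈ P := by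
  simp only [shift, Finset.mem_image]
  exact ⟨by rintro ⟨y, hy, rfl⟩; simpa using hy, fun h => ⟨_, h, sub_add_cancel x v⟩⟩

theorem shift_zero (P : Finset (ℤ × ℤ)) : shift 0 P = P := by
  simp [shift]

theorem shift_shift (v w : ℤ × ℤ) (P : Finset (ℤ × ℤ)) : shift v (shift w P) = shift (w + v) P := by
  ext x
  rw [mem_shift, mem_shift, mem_shift, sub_sub, add_comm]

theorem card_shift (v : ℤ × ℤ) (P : Finset (ℤ × ℤ)) : (shift v P).card = P.card :=
  Finset.card_image_of_injective _ (add_left_injective v)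

theorem perimeter_shift (v : ℤ × ℤ) (P : Finset (ℤ × ℤ)) : perimeter (shift v P) = perimeter P := by
  rw [perimeter, shift, Finset.sum_image (add_left_injective v).injOn, perimeter]
  refine Finset.sum_congr rfl fun x _ => ?_
  change (cellNeighbors (x + v) \ shift v P).card = _
  rw [card_neighbors_sdiff, card_neighbors_sdiff]
  refine Finset.sum_congr rfl fun s _ => ?_
  simp only [mem_shift, add_right_comm x v, add_sub_cancel_right]

theorem conn_shift {S T : Set (ℤ × ℤ)} (v : ℤ × ℤ) (h : ∀ x, x ∈ S → x + v ∈ T) {a b : ℤ × ℤ}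
    (hab : Conn S a b) : Conn T (a + v) (b + v) := by
  refine Relation.ReflTransGen.lift (· + v) ?_ _ _ hab
  rintro x _ ⟨hx, hy, s, rfl⟩
  exact ⟨h _ hx, h _ hy, s, add_right_comm x (dir s) v⟩

theorem isHoleFree_shift {P : Finset (ℤ × ℤ)} (h : IsHoleFreePolyomino P) (v : ℤ × ℤ) :
    IsHoleFreePolyomino (shift v P) := by
  rw [isHoleFree_iff] at h ⊢
  obtain ⟨⟨x, hx⟩, h1, h2⟩ := h
  refine ⟨⟨x + v, mem_shift.2 (by simpa using hx)⟩, fun a ha b hb => ?_, fun a ha b hb => ?_⟩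
  · rw [mem_shift] at ha hb
    have := conn_shift (T := shift v P) v (fun x hx => ?_) (h1 _ ha _ hb)
    · simpa using this
    · rw [Finset.mem_coe, mem_shift]; simpa using hx
  · rw [mem_shift] at ha hb
    have := conn_shift (T := (shift v P : Set (ℤ × ℤ))ᶜ) v (fun x hx => ?_) (h2 _ ha _ hb)
    · simpa using this
    · rw [Set.mem_compl_iff, Finset.mem_coe, mem_shift]; simpa using hx

theorem sub_shift {Q : Finset (ℤ × ℤ)} (h : Sub Q) {v : ℤ × ℤ} (hv : IsBlack v) :
    Sub (shift v Q) := by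
  intro d s
  have := h (d - v) s
  obtain ⟨hv1, hv2⟩ := hv
  simp only [IsBlack, IsWhite, Prod.fst_sub, Prod.snd_sub, mem_shift, add_sub_right_comm] at this ⊢
  exact ⟨fun hd => this.1 (by omega), fun hd => this.2 (by omega)⟩

/-! ### Concatenation -/

/-- `P` and `Q` are joined at the side between the last cell `p` of `P` and the first cell of `Q`,
in the lexicographic order. -/
structure Joined (P Q : Finset (ℤ × ℤ)) (p : ℤ × ℤ) : Prop where
  mem_left : p ∈ P
  mem_right : p + (1, 0) ∈ Q
  left : ∀ x ∈ P, x.1 < p.1 ∨ x.1 = p.1 ∧ x.2 ≤ p.2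
  right : ∀ x ∈ Q, p.1 + 1 < x.1 ∨ x.1 = p.1 + 1 ∧ p.2 ≤ x.2

theorem exists_last {P : Finset (ℤ × ℤ)} (h : P.Nonempty) :
    ∃ p ∈ P, ∀ x ∈ P, x.1 < p.1 ∨ x.1 = p.1 ∧ x.2 ≤ p.2 := by
  obtain ⟨p, hp, hmax⟩ := P.exists_max_image toLex h
  exact ⟨p, hp, fun x hx => Prod.Lex.toLex_le_toLex.1 (hmax x hx)⟩

theorem exists_first {P : Finset (ℤ × ℤ)} (h : P.Nonempty) :
    ∃ p ∈ P, ∀ x ∈ P, p.1 < x.1 ∨ x.1 = p.1 ∧ p.2 ≤ x.2 := by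
  obtain ⟨p, hp, hmax⟩ := P.exists_min_image toLex h
  refine ⟨p, hp, fun x hx => ?_⟩
  rcases Prod.Lex.toLex_le_toLex.1 (hmax x hx) with h | h
  exacts [Or.inl h, Or.inr ⟨h.1.symm, h.2⟩]

theorem exists_joined {P Q : Finset (ℤ × ℤ)} (hP : P.Nonempty) (hQ : Q.Nonempty) :
    ∃ v p, Joined P (shift v Q) p := by
  obtain ⟨p, hp, hpl⟩ := exists_last hP
  obtain ⟨q, hq, hqf⟩ := exists_first hQ
  refine ⟨p + (1, 0) - q, p, hp, mem_shift.2 (by simpa using hq), hpl, fun x hx => ?_⟩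
  have := hqf _ (mem_shift.1 hx)
  simp only [Prod.fst_add, Prod.snd_add, Prod.fst_sub, Prod.snd_sub] at this
  omega

namespace Joined

variable {P Q : Finset (ℤ × ℤ)} {p : ℤ × ℤ}

theorem disjoint (h : Joined P Q p) : Disjoint P Q := by
  rw [Finset.disjoint_left]
  intro x hx hx'
  have h1 := h.left x hx
  have h2 := h.right x hx'
  omega

theorem shift (h : Joined P Q p) (v : ℤ × ℤ) : Joined (shift v P) (shift v Q) (p + v) where
  mem_left := mem_shift.2 (by simpa using h.mem_left)
  mem_right := mem_shift.2 (by
    rw [add_right_comm, add_sub_cancel_right]; exact h.mem_right)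
  left x hx := by
    have := h.left _ (mem_shift.1 hx)
    simp only [Prod.fst_sub, Prod.snd_sub, Prod.fst_add, Prod.snd_add] at this ⊢
    omega
  right x hx := by
    have := h.right _ (mem_shift.1 hx)
    simp only [Prod.fst_sub, Prod.snd_sub, Prod.fst_add, Prod.snd_add] at this ⊢
    omega

theorem card_union (h : Joined P Q p) : (P ∪ Q).card = P.card + Q.card :=
  Finset.card_union_of_disjoint h.disjoint

/-- The lexicographic order allows only one contact between the factors, that of `p` with `p + (1,
0)`. -/
theorem perimeter_union (h : Joined P Q p) :
    perimeter (P ∪ Q) + 2 = perimeter P + perimeter Q := by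
  have hor : horPairs (P ∪ Q) = insert p (horPairs P ∪ horPairs Q) := by
    ext x
    simp only [mem_horPairs, Finset.mem_insert, Finset.mem_union]
    constructor
    · rintro ⟨h1 | h1, h2 | h2⟩
      · exact Or.inr (Or.inl ⟨h1, h2⟩)
      · have h3 := h.left _ h1
        have h4 := h.right _ h2
        simp only [Prod.fst_add, Prod.snd_add] at h4
        exact Or.inl (Prod.ext (by omega) (by omega))
      · have h3 := h.left _ h2
        have h4 := h.right _ h1
        simp only [Prod.fst_add, Prod.snd_add] at h3
        omega
      · exact Or.inr (Or.inr ⟨h1, h2⟩)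
    · rintro (rfl | h1 | h1)
      · exact ⟨Or.inl h.mem_left, Or.inr h.mem_right⟩
      · exact ⟨Or.inl h1.1, Or.inl h1.2⟩
      · exact ⟨Or.inr h1.1, Or.inr h1.2⟩
  have ver : verPairs (P ∪ Q) = verPairs P ∪ verPairs Q := by
    ext x
    simp only [mem_verPairs, Finset.mem_union]
    constructor
    · rintro ⟨h1 | h1, h2 | h2⟩
      · exact Or.inl ⟨h1, h2⟩
      · have h3 := h.left _ h1
        have h4 := h.right _ h2
        simp only [Prod.fst_add, Prod.snd_add] at h4
        omega
      · have h3 := h.left _ h2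
        have h4 := h.right _ h1
        simp only [Prod.fst_add, Prod.snd_add] at h3
        omega
      · exact Or.inr ⟨h1, h2⟩
    · rintro (h1 | h1)
      · exact ⟨Or.inl h1.1, Or.inl h1.2⟩
      · exact ⟨Or.inr h1.1, Or.inr h1.2⟩
  have hd := h.disjoint
  have e1 : (horPairs (P ∪ Q)).card = (horPairs P).card + (horPairs Q).card + 1 := by
    rw [hor, Finset.card_insert_of_notMem, Finset.card_union_of_disjoint]
    · exact hd.mono (Finset.filter_subset _ _) (Finset.filter_subset _ _)
    · rw [Finset.mem_union, mem_horPairs, mem_horPairs]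
      rintro (h1 | h1)
      · exact Finset.disjoint_left.1 hd h1.2 h.mem_right
      · exact Finset.disjoint_left.1 hd h.mem_left h1.1
  have e2 : (verPairs (P ∪ Q)).card = (verPairs P).card + (verPairs Q).card := by
    rw [ver, Finset.card_union_of_disjoint]
    exact hd.mono (Finset.filter_subset _ _) (Finset.filter_subset _ _)
  have h1 := perimeter_add P
  have h2 := perimeter_add Q
  have h3 := perimeter_add (P ∪ Q)
  rw [h.card_union, e1, e2] at h3
  omega

/-- The column of `p` is free above `p` and the next column is free below `p + (1, 0)`; both
half-lines lead to infinity. A path to infinity in the complement of one factor can be followed on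
that factor's side of the cut until it would cross, and then continues along one of the half-lines.
-/
theorem isHoleFree (h : Joined P Q p) (hP : IsHoleFreePolyomino P) (hQ : IsHoleFreePolyomino Q) :
    IsHoleFreePolyomino (P ∪ Q) := by
  rw [isHoleFree_iff] at hP hQ ⊢
  obtain ⟨hPne, hPc, hPcc⟩ := hP
  obtain ⟨-, hQc, hQcc⟩ := hQ
  refine ⟨hPne.mono Finset.subset_union_left, ?_, ?_⟩
  · have key : ∀ a ∈ P ∪ Q, Conn ((P ∪ Q : Finset (ℤ × ℤ)) : Set (ℤ × ℤ)) a p := by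
      intro a ha
      rcases Finset.mem_union.1 ha with ha | ha
      · exact (hPc a ha p h.mem_left).mono (by simp)
      · refine ((hQc a ha _ h.mem_right).mono (by simp)).trans (Conn.symm ?_)
        refine Conn.step' 3 ?_ ?_ rfl
        · simp [h.mem_left]
        · simp [h.mem_right]
    exact fun a ha b hb => (key a ha).trans (key b hb).symm
  · set S : Set (ℤ × ℤ) := ((P ∪ Q : Finset (ℤ × ℤ)) : Set (ℤ × ℤ))ᶜ with hS
    have hmem : ∀ x, x ∈ S ↔ x ∉ P ∧ x ∉ Q := by
      intro x; simp [hS]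
    obtain ⟨N, hN, hbox⟩ := exists_outBox_disjoint (P ∪ Q)
    have hout : outBox N ⊆ S := fun x hx => by simpa [hS] using hbox x hx
    let hub : ℤ × ℤ := (0, N + 1)
    have hhub : hub ∈ outBox N := Or.inr (by simp only [hub]; rw [abs_of_nonneg] <;> omega)
    have htop : ∀ x : ℤ × ℤ, x.1 = p.1 → p.2 < x.2 → Conn S x hub := by
      rintro ⟨a, b⟩ rfl hb
      refine (conn_vertical (j := max b (N + 1)) fun t ht _ => ?_).trans
        ((conn_outBox hN (Or.inr ?_) hhub).mono hout)
      · rw [hmem]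
        refine ⟨fun h1 => ?_, fun h1 => ?_⟩
        · have := h.left _ h1; simp only at this hb; omega
        · have := h.right _ h1; simp only at this hb; omega
      · simp only; rw [abs_of_nonneg] <;> omega
    have hbot : ∀ x : ℤ × ℤ, x.1 = p.1 + 1 → x.2 < p.2 → Conn S x hub := by
      rintro ⟨a, b⟩ hx hb
      refine (conn_vertical (j := min b (-(N + 1))) fun t _ ht => ?_).trans
        ((conn_outBox hN (Or.inr ?_) hhub).mono hout)
      · rw [hmem]
        refine ⟨fun h1 => ?_, fun h1 => ?_⟩
        · have := h.left _ h1; simp only at this hb hx; omega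
        · have := h.right _ h1; simp only at this hb hx; omega
      · simp only; rw [abs_of_nonpos] <;> omega
    have hdir : ∀ s, (dir s).1 ≤ 1 ∧ -1 ≤ (dir s).1 ∧ ((dir s).1 = 0 ∨ (dir s).2 = 0) := by decide
    have hleft : ∀ x, x ∉ P → x.1 ≤ p.1 → Conn S x hub := by
      intro x hx
      have hfar : ((p.1, max (N + 1) (p.2 + 1)) : ℤ × ℤ) ∉ P := by
        intro hh; have := h.left _ hh; simp only at this; omega
      have hc := hPcc x hx _ hfar
      clear hx
      induction hc using Relation.ReflTransGen.head_induction_on with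
      | refl => exact fun _ => htop _ rfl (by simp only; omega)
      | @head y z hyz _ ih =>
        obtain ⟨hy, hz, s, rfl⟩ := hyz
        intro hy1
        have hyP : y ∉ P := hy
        have hzP : y + dir s ∉ P := hz
        have hyS : y ∈ S := (hmem _).2 ⟨hyP, fun hh => by have := h.right _ hh; omega⟩
        obtain ⟨d1, d2, d3⟩ := hdir s
        by_cases hz1 : (y + dir s).1 ≤ p.1
        · refine (Conn.step s hyS ?_).trans (ih hz1)
          exact (hmem _).2 ⟨hzP, fun hh => by have := h.right _ hh; omega⟩
        -- The path crosses the cut here: below `p` it steps onto the lower half-line, above `p` it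
        -- already is on the upper one, and it cannot be at `p`.
        · simp only [Prod.fst_add] at hz1
          have hyp : y.1 = p.1 := by omega
          rcases lt_trichotomy y.2 p.2 with hlt | heq | hgt
          · have hz2 : (y + dir s).2 < p.2 := by simp only [Prod.snd_add]; omega
            have hz3 : (y + dir s).1 = p.1 + 1 := by simp only [Prod.fst_add]; omega
            refine (Conn.step s hyS ((hmem _).2 ⟨hzP, fun hh => ?_⟩)).trans (hbot _ hz3 hz2)
            have := h.right _ hh; omega
          · exact (hyP (by rw [show y = p from Prod.ext hyp heq]; exact h.mem_left)).elim
          · exact htop _ hyp hgt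
    have hright : ∀ x, x ∉ Q → p.1 + 1 ≤ x.1 → Conn S x hub := by
      intro x hx
      have hfar : ((p.1 + 1, min (-(N + 1)) (p.2 - 1)) : ℤ × ℤ) ∉ Q := by
        intro hh; have := h.right _ hh; simp only at this; omega
      have hc := hQcc x hx _ hfar
      clear hx
      induction hc using Relation.ReflTransGen.head_induction_on with
      | refl => exact fun _ => hbot _ rfl (by simp only; omega)
      | @head y z hyz _ ih =>
        obtain ⟨hy, hz, s, rfl⟩ := hyz
        intro hy1
        have hyP : y ∉ Q := hy
        have hzP : y + dir s ∉ Q := hz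
        have hyS : y ∈ S := (hmem _).2 ⟨fun hh => by have := h.left _ hh; omega, hyP⟩
        obtain ⟨d1, d2, d3⟩ := hdir s
        by_cases hz1 : p.1 + 1 ≤ (y + dir s).1
        · refine (Conn.step s hyS ?_).trans (ih hz1)
          exact (hmem _).2 ⟨fun hh => by have := h.left _ hh; omega, hzP⟩
        · simp only [Prod.fst_add] at hz1
          have hyp : y.1 = p.1 + 1 := by omega
          rcases lt_trichotomy y.2 p.2 with hlt | heq | hgt
          · exact hbot _ hyp hlt
          · refine (hyP ?_).elim
            rw [show y = p + (1, 0) from Prod.ext hyp (by simpa using heq)]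
            exact h.mem_right
          · have hz2 : p.2 < (y + dir s).2 := by simp only [Prod.snd_add]; omega
            have hz3 : (y + dir s).1 = p.1 := by simp only [Prod.fst_add]; omega
            refine (Conn.step s hyS ((hmem _).2 ⟨fun hh => ?_, hzP⟩)).trans (htop _ hz3 hz2)
            have := h.left _ hh; omega
    have key : ∀ a, a ∉ P ∪ Q → Conn S a hub := by
      intro a ha
      rw [Finset.mem_union, not_or] at ha
      rcases le_or_gt a.1 p.1 with h1 | h1
      · exact hleft a ha.1 h1
      · exact hright a ha.2 h1
    exact fun a ha b hb => (key a ha).trans (key b hb).symm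

theorem subset_of_le {P' Q' : Finset (ℤ × ℤ)} {p' : ℤ × ℤ} (h : Joined P Q p)
    (h' : Joined P' Q' p') (heq : P ∪ Q = P' ∪ Q') (hle : p.1 ≤ p'.1) : P ⊆ P' := by
  intro x hx
  have hx' : x ∈ P' ∪ Q' := heq ▸ Finset.mem_union_left _ hx
  refine (Finset.mem_union.1 hx').resolve_right fun hxQ => ?_
  have h1 := h.left x hx
  have h2 := h'.right x hxQ
  omega

theorem right_eq {P' Q' : Finset (ℤ × ℤ)} {p' : ℤ × ℤ} (h : Joined P Q p)
    (h' : Joined P' Q' p') (heq : P ∪ Q = P' ∪ Q') (hP : P = P') : Q = Q' := by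
  subst hP
  rw [← Finset.union_sdiff_cancel_left h.disjoint, heq, Finset.union_sdiff_cancel_left h'.disjoint]

/-- First factors of the same union are nested, as each consists of the columns up to its cut. So
their area tells them apart. -/
theorem eq_of_card_eq {P' Q' : Finset (ℤ × ℤ)} {p' : ℤ × ℤ} (h : Joined P Q p)
    (h' : Joined P' Q' p') (heq : P ∪ Q = P' ∪ Q') (hc : P.card = P'.card) : P = P' ∧ Q = Q' := by
  have hP : P = P' := by
    rcases le_total p.1 p'.1 with hle | hle
    · exact Finset.eq_of_subset_of_card_le (h.subset_of_le h' heq hle) hc.ge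
    · exact (Finset.eq_of_subset_of_card_le (h'.subset_of_le h heq.symm hle) hc.le).symm
  exact ⟨hP, h.right_eq h' heq hP⟩

end Joined

/-- In each of the four directions, an extremal cell of `P` has a boundary side. -/
theorem four_le_perimeter {P : Finset (ℤ × ℤ)} (h : P.Nonempty) : 4 ≤ perimeter P := by
  rw [perimeter_eq_card]
  have hu : (boundarySides P).image Prod.snd = Finset.univ := by
    rw [Finset.eq_univ_iff_forall]
    intro s
    obtain ⟨x, hx, hmax⟩ := P.exists_max_image (fun x => x.1 * (dir s).1 + x.2 * (dir s).2) h
    refine Finset.mem_image.2 ⟨(x, s), mem_boundarySides.2 ⟨hx, fun hxs => ?_⟩, rfl⟩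
    have h1 := hmax _ hxs
    have h2 : ∀ s, (dir s).1 * (dir s).1 + (dir s).2 * (dir s).2 = 1 := by decide
    replace h2 := h2 s
    simp only [Prod.fst_add, Prod.snd_add] at h1
    linarith
  calc 4 = (Finset.univ : Finset (ZMod 4)).card := rfl
    _ = _ := by rw [← hu]
    _ ≤ _ := Finset.card_image_le

/-- If the cut of `P` comes strictly earlier, then `P'` itself is joined from `P` and `P' \ P`, so
its perimeter exceeds that of `P` by at least `4 - 2`. -/
theorem Joined.eq_of_perimeter_eq {P Q P' Q' : Finset (ℤ × ℤ)} {p p' : ℤ × ℤ} (h : Joined P Q p)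
    (h' : Joined P' Q' p') (heq : P ∪ Q = P' ∪ Q') (hc : perimeter P = perimeter P') :
    P = P' ∧ Q = Q' := by
  have hP : P = P' := by
    wlog hle : p.1 ≤ p'.1 generalizing P Q P' Q' p p'
    · exact (this h' h heq.symm hc.symm (by omega)).symm
    have hsub := h.subset_of_le h' heq hle
    rcases hle.eq_or_lt with he | hlt
    · exact hsub.antisymm (h'.subset_of_le h heq.symm he.ge)
    · exfalso
      have hj : Joined P (P' \ P) p := by
        refine ⟨h.mem_left, Finset.mem_sdiff.2 ⟨?_, ?_⟩, h.left, fun x hx => ?_⟩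
        · have h1 : p + (1, 0) ∈ P' ∪ Q' := heq ▸ Finset.mem_union_right _ h.mem_right
          refine (Finset.mem_union.1 h1).resolve_right fun h2 => ?_
          have := h'.right _ h2
          simp only [Prod.fst_add] at this
          omega
        · exact fun h1 => Finset.disjoint_left.1 h.disjoint h1 h.mem_right
        · rw [Finset.mem_sdiff] at hx
          have h1 : x ∈ P ∪ Q := heq ▸ Finset.mem_union_left _ hx.1
          exact h.right x ((Finset.mem_union.1 h1).resolve_left hx.2)
      have h1 := hj.perimeter_union
      rw [Finset.union_sdiff_of_subset hsub] at h1
      have h2 := four_le_perimeter ⟨_, hj.mem_right⟩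
      omega
  exact ⟨hP, h.right_eq h' heq hP⟩

/-! ### Counting classes -/

/-- A relation replaces the injection so that no representatives of classes have to be fixed in
applications. Finiteness is passed along because `Set.ncard` is `0` on infinite sets. -/
theorem ncard_le_of_rel {α β : Type*} {A : Set α} {B : Set β} (hB : B.Finite) (R : α → β → Prop)
    (h1 : ∀ a ∈ A, ∃ b ∈ B, R a b) (h2 : ∀ a ∈ A, ∀ a' ∈ A, ∀ b ∈ B, R a b → R a' b → a = a') :
    A.ncard ≤ B.ncard ∧ A.Finite := by
  rcases A.eq_empty_or_nonempty with rfl | ⟨a₀, ha₀⟩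
  · simp
  have : Nonempty β := ⟨(h1 a₀ ha₀).choose⟩
  choose! f hf using h1
  have hinj : Set.InjOn f A := fun a ha a' ha' h =>
    h2 a ha a' ha' (f a) (hf a ha).1 (hf a ha).2 (h ▸ (hf a' ha').2)
  exact ⟨Set.ncard_le_ncard_of_injOn f (fun a ha => (hf a ha).1) hinj hB,
    Set.Finite.of_injOn (fun a ha => (hf a ha).1) hinj hB⟩

/-- The classes of `r` that meet `S`. -/
def classes {α : Type*} (r : Setoid α) (S : Set α) : Set (Quotient r) :=
  (fun x : α => Quotient.mk r x) '' S

theorem classCount_eq {α : Type*} (r : Setoid α) (S : Set α) :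
    classCount r S = (classes r S).ncard := rfl

theorem classCount_le_of_rel {α β : Type*} {r : Setoid α} {s : Setoid β} {S : Set α} {T : Set β}
    (hT : (classes s T).Finite) (R : α → β → Prop) (h1 : ∀ x ∈ S, ∃ y ∈ T, R x y)
    (h2 : ∀ x ∈ S, ∀ x' ∈ S, ∀ y ∈ T, ∀ y' ∈ T, R x y → R x' y' → s y y' → r x x') :
    classCount r S ≤ classCount s T ∧ (classes r S).Finite := by
  refine ncard_le_of_rel hT (fun a b => ∃ x ∈ S, ∃ y ∈ T, R x y ∧ Quotient.mk r x = a ∧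
    Quotient.mk s y = b) ?_ ?_
  · rintro _ ⟨x, hx, rfl⟩
    obtain ⟨y, hy, hxy⟩ := h1 x hx
    exact ⟨_, ⟨y, hy, rfl⟩, x, hx, y, hy, hxy, rfl, rfl⟩
  · rintro _ - _ - _ - ⟨x, hx, y, hy, hxy, rfl, rfl⟩ ⟨x', hx', y', hy', hxy', rfl, he⟩
    exact Quotient.sound (h2 x hx x' hx' y hy y' hy' hxy hxy' (s.symm (Quotient.exact he)))

theorem classCount_mul_le_of_rel {α β γ : Type*} {r : Setoid α} {s : Setoid β} {t : Setoid γ}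
    {S : Set α} {S' : Set β} {T : Set γ} (hT : (classes t T).Finite) (R : α → β → γ → Prop)
    (h1 : ∀ x ∈ S, ∀ y ∈ S', ∃ z ∈ T, R x y z)
    (h2 : ∀ x ∈ S, ∀ y ∈ S', ∀ z, ∀ x' ∈ S, ∀ y' ∈ S', ∀ z', R x y z → R x' y' z' → t z z' →
      r x x' ∧ s y y') :
    classCount r S * classCount s S' ≤ classCount t T := by
  rw [classCount_eq, classCount_eq, ← Set.ncard_prod]
  refine (ncard_le_of_rel hT (fun a c => ∃ x ∈ S, ∃ y ∈ S', ∃ z ∈ T, R x y z ∧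
    Quotient.mk r x = a.1 ∧ Quotient.mk s y = a.2 ∧ Quotient.mk t z = c) ?_ ?_).1
  · rintro ⟨_, _⟩ ⟨⟨x, hx, rfl⟩, ⟨y, hy, rfl⟩⟩
    obtain ⟨z, hz, hxyz⟩ := h1 x hx y hy
    exact ⟨_, ⟨z, hz, rfl⟩, x, hx, y, hy, z, hz, hxyz, rfl, rfl, rfl⟩
  · rintro ⟨_, _⟩ - ⟨_, _⟩ - _ - ⟨x, hx, y, hy, z, hz, hR, rfl, rfl, rfl⟩
      ⟨x', hx', y', hy', z', hz', hR', rfl, rfl, he⟩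
    obtain ⟨h3, h4⟩ := h2 x hx y hy z x' hx' y' hy' z' hR hR' (t.symm (Quotient.exact he))
    exact Prod.ext (Quotient.sound h3) (Quotient.sound h4)

/-- Concatenation of polyominoes, up to translations, is injective if a translation invariant
quantity that detects the first factor is prescribed. -/
theorem classCount_mul_le_of_joined {S S' T : Set (Finset (ℤ × ℤ))}
    (hT : (classes polyominoSetoid T).Finite)
    (hS : ∀ P ∈ S, P.Nonempty) (hS' : ∀ P ∈ S', P.Nonempty)
    (hST : ∀ P ∈ S, ∀ Q v p, Q ∈ S' → Joined P (shift v Q) p → P ∪ shift v Q ∈ T)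
    (hinj : ∀ P ∈ S, ∀ P' ∈ S, ∀ A B p v A' B' p' v', A = shift v P → A' = shift v' P' →
      Joined A B p → Joined A' B' p' → A ∪ B = A' ∪ B' → A = A' ∧ B = B') :
    classCount polyominoSetoid S * classCount polyominoSetoid S' ≤ classCount polyominoSetoid T := by
  refine classCount_mul_le_of_rel hT
    (fun P Q R => ∃ v w p, Joined (shift v P) (shift w Q) p ∧ R = shift v P ∪ shift w Q) ?_ ?_
  · intro P hP Q hQ
    obtain ⟨v, p, h⟩ := exists_joined (hS P hP) (hS' Q hQ)
    exact ⟨_, hST P hP Q v p hQ h, 0, v, p, by rwa [shift_zero], by rw [shift_zero]⟩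
  · rintro P hP Q hQ R P' hP' Q' hQ' R' ⟨v, w, p, h, rfl⟩ ⟨v', w', p', h', rfl⟩ ⟨u, hu⟩
    have hu' : shift v' P' ∪ shift w' Q' = shift (v + u) P ∪ shift (w + u) Q := by
      rw [hu, ← shift_shift, ← shift_shift]
      exact Finset.image_union _ _
    have hj := h.shift u
    rw [shift_shift, shift_shift] at hj
    obtain ⟨e1, e2⟩ := hinj P hP P' hP' _ _ _ _ _ _ _ _ rfl rfl hj h' hu'.symm
    exact ⟨polyominoSetoid.trans ⟨v + u, rfl⟩ (polyominoSetoid.symm ⟨v', e1⟩),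
      polyominoSetoid.trans ⟨w + u, rfl⟩ (polyominoSetoid.symm ⟨w', e2⟩)⟩

theorem isHoleFree_nonempty {P : Finset (ℤ × ℤ)} (h : IsHoleFreePolyomino P) : P.Nonempty :=
  ((isHoleFree_iff P).1 h).1

theorem classCount_area_mul_le (m n : ℕ)
    (hT : (classes polyominoSetoid {P | IsHoleFreePolyomino P ∧ P.card = m + n}).Finite) :
    polyominoesOfArea m * polyominoesOfArea n ≤ polyominoesOfArea (m + n) := by
  refine classCount_mul_le_of_joined hT (fun P hP => isHoleFree_nonempty hP.1)
    (fun P hP => isHoleFree_nonempty hP.1) ?_ ?_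
  · intro P hP Q v p hQ h
    exact ⟨h.isHoleFree hP.1 (isHoleFree_shift hQ.1 v), by
      rw [h.card_union, card_shift, hP.2, hQ.2]⟩
  · rintro P hP P' hP' _ B p v _ B' p' v' rfl rfl h h' heq
    exact h.eq_of_card_eq h' heq (by rw [card_shift, card_shift, hP.2, hP'.2])

/-- Gluing costs two units of perimeter: `2(m + 1) + 2(n + 1) - 2 = 2(m + n + 1)`. -/
theorem classCount_halfPerimeter_mul_le (m n : ℕ)
    (hT : (classes polyominoSetoid
      {P | IsHoleFreePolyomino P ∧ perimeter P = 2 * (m + n + 1)}).Finite) :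
    polyominoesOfHalfPerimeter (m + 1) * polyominoesOfHalfPerimeter (n + 1) ≤
      polyominoesOfHalfPerimeter (m + n + 1) := by
  refine classCount_mul_le_of_joined hT (fun P hP => isHoleFree_nonempty hP.1)
    (fun P hP => isHoleFree_nonempty hP.1) ?_ ?_
  · intro P hP Q v p hQ h
    refine ⟨h.isHoleFree hP.1 (isHoleFree_shift hQ.1 v), ?_⟩
    have := h.perimeter_union
    rw [perimeter_shift, hP.2, hQ.2] at this
    omega
  · rintro P hP P' hP' _ B p v _ B' p' v' rfl rfl h h' heq
    exact h.eq_of_perimeter_eq h' heq (by rw [perimeter_shift, perimeter_shift, hP.2, hP'.2])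

/-! ### Concatenation of subcomplexes -/

theorem perimeter_singleton (b : ℤ × ℤ) : perimeter {b} = 4 := by
  rw [perimeter, Finset.sum_singleton, card_neighbors_sdiff]
  simp only [Finset.mem_singleton, add_eq_left, dir_ne_zero, not_false_eq_true, if_true]
  rfl

/-- A cell of `Q` with an odd coordinate has its upper or its right neighbour in `Q`, which comes
later in the order. -/
theorem Sub.isBlack_last {P : Finset (ℤ × ℤ)} (h : Sub P) {p : ℤ × ℤ} (hp : p ∈ P)
    (hl : ∀ x ∈ P, x.1 < p.1 ∨ x.1 = p.1 ∧ x.2 ≤ p.2) : IsBlack p := by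
  rcases Int.emod_two_eq_zero_or_one p.1 with h1 | h1
  · rcases Int.emod_two_eq_zero_or_one p.2 with h2 | h2
    · exact ⟨h1, h2⟩
    · have := hl _ (h.down_up hp h2).1
      simp only [Prod.fst_add, Prod.snd_add] at this
      omega
  · have := hl _ (h.left_right hp h1).1
    simp only [Prod.fst_add, Prod.snd_add] at this
    omega

theorem Sub.isBlack_first {P : Finset (ℤ × ℤ)} (h : Sub P) {p : ℤ × ℤ} (hp : p ∈ P)
    (hl : ∀ x ∈ P, p.1 < x.1 ∨ x.1 = p.1 ∧ p.2 ≤ x.2) : IsBlack p := by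
  rcases Int.emod_two_eq_zero_or_one p.1 with h1 | h1
  · rcases Int.emod_two_eq_zero_or_one p.2 with h2 | h2
    · exact ⟨h1, h2⟩
    · have := hl _ (h.down_up hp h2).2
      simp only [Prod.fst_sub, Prod.snd_sub] at this
      omega
  · have := hl _ (h.left_right hp h1).2
    simp only [Prod.fst_sub, Prod.snd_sub] at this
    omega

theorem joined_singleton {P : Finset (ℤ × ℤ)} {p : ℤ × ℤ} (hp : p ∈ P)
    (hl : ∀ x ∈ P, x.1 < p.1 ∨ x.1 = p.1 ∧ x.2 ≤ p.2) : Joined P {p + (1, 0)} p :=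
  ⟨hp, Finset.mem_singleton_self _, hl, fun x hx => by
    rw [Finset.mem_singleton.1 hx]
    exact Or.inr ⟨rfl, by simp⟩⟩

/-- `P` together with the cell to the right of its last cell. -/
def Extends (P R : Finset (ℤ × ℤ)) : Prop :=
  ∃ p, Joined P {p + (1, 0)} p ∧ R = P ∪ {p + (1, 0)}

/-- The connecting cell is a gap with black neighbours `p` and `p + (2, 0)`, one in each part. -/
theorem Sub.union_of_joined {P Q : Finset (ℤ × ℤ)} {p : ℤ × ℤ} (hP : Sub P) (hQ : Sub Q)
    (h : Joined (P ∪ {p + (1, 0)}) Q (p + (1, 0))) (hp : p ∈ P) (hb : IsBlack p) :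
    Sub (P ∪ {p + (1, 0)} ∪ Q) := by
  obtain ⟨hb1, hb2⟩ := hb
  intro d s
  simp only [Finset.mem_union, Finset.mem_singleton]
  constructor
  · rintro hd ((h1 | h1) | h1)
    · exact Or.inl (Or.inl ((hP d s).1 hd h1))
    · have hd' : d = p + (1, 0) + dir (s + 2) := by rw [← h1, add_dir_add_dir_two]
      obtain ⟨hd1, hd2⟩ := hd
      revert s
      refine forall_side.2 ⟨?_, ?_, ?_, ?_⟩ <;> intro h1 hd'
      · have e : (dir (0 + 2)).1 = 0 := rfl
        rw [hd'] at hd1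
        simp only [Prod.fst_add, e] at hd1
        omega
      · right
        rw [hd']
        exact h.mem_right
      · have e : (dir (2 + 2)).1 = 0 := rfl
        rw [hd'] at hd1
        simp only [Prod.fst_add, e] at hd1
        omega
      · left; left
        rw [add_right_cancel h1]
        exact hp
    · exact Or.inr ((hQ d s).1 hd h1)
  · rintro hd ((h1 | h1) | h1)
    · exact Or.inl (Or.inl ((hP d s).2 hd h1))
    · have := hd.2
      rw [h1] at this
      simp only [Prod.snd_add] at this
      omega
    · exact Or.inr ((hQ d s).2 hd h1)

/-- Last and first cells of subcomplexes are black, so gluing needs a gap in between. This is done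
in two joins: `P` is first extended by a gap, injectively on classes, and then `Q` is joined to the
extension. Areas simply add up with the gap; the perimeters add up since `2` for the gap is lost
again in the second join. -/
theorem classCount_sub_mul_le {S S' T : Set (Finset (ℤ × ℤ))}
    (hT : (classes polyominoSetoid T).Finite)
    (hT' : ∀ P ∈ S, (classes polyominoSetoid {R | ∃ P ∈ S, Extends P R}).Finite)
    (hS : ∀ P ∈ S, Sub P ∧ IsHoleFreePolyomino P) (hS' : ∀ P ∈ S', Sub P ∧ IsHoleFreePolyomino P)
    (hST : ∀ P ∈ S, ∀ Q ∈ S', ∀ R, Sub R → IsHoleFreePolyomino R →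
      R.card = P.card + Q.card + 1 → perimeter R = perimeter P + perimeter Q → R ∈ T)
    (hinj : (∀ P ∈ S, ∀ P' ∈ S, P.card = P'.card) ∨
      ∀ P ∈ S, ∀ P' ∈ S, perimeter P = perimeter P') :
    classCount polyominoSetoid S * classCount polyominoSetoid S' ≤ classCount polyominoSetoid T := by
  rcases S.eq_empty_or_nonempty with rfl | ⟨P₀, hP₀⟩
  · simp [classCount_eq, classes]
  have heq : ∀ P ∈ S, ∀ P' ∈ S, ∀ v v' B B' p p', Joined (shift v P) B p → Joined (shift v' P') B' p' →
      shift v P ∪ B = shift v' P' ∪ B' → shift v P = shift v' P' := by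
    intro P hP P' hP' v v' B B' p p' h h' e
    rcases hinj with hi | hi
    · exact (h.eq_of_card_eq h' e (by rw [card_shift, card_shift, hi P hP P' hP'])).1
    · exact (h.eq_of_perimeter_eq h' e (by rw [perimeter_shift, perimeter_shift, hi P hP P' hP'])).1
  have h1 : classCount polyominoSetoid S ≤
      classCount polyominoSetoid {R | ∃ P ∈ S, Extends P R} := by
    refine (classCount_le_of_rel (hT' P₀ hP₀) Extends ?_ ?_).1
    · intro P hP
      obtain ⟨p, hp, hl⟩ := exists_last (isHoleFree_nonempty (hS P hP).2)
      exact ⟨_, ⟨P, hP, p, joined_singleton hp hl, rfl⟩, p, joined_singleton hp hl, rfl⟩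
    · rintro P hP P' hP' _ - R' - ⟨p, h, rfl⟩ ⟨p', h', rfl⟩ ⟨u, hu⟩
      have hj := h.shift u
      have hj' := h'
      rw [← shift_zero P'] at hj'
      have := heq P hP P' hP' u 0 _ _ _ _ hj hj' (by
        rw [shift_zero, hu]
        exact (Finset.image_union _ _).symm)
      exact ⟨u, by rw [← shift_zero P', ← this]; rfl⟩
  refine (Nat.mul_le_mul_right _ h1).trans
    (classCount_mul_le_of_joined hT ?_ (fun P hP => isHoleFree_nonempty (hS' P hP).2) ?_ ?_)
  · rintro _ ⟨P, hP, p, h, rfl⟩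
    exact (isHoleFree_nonempty (hS P hP).2).mono Finset.subset_union_left
  · rintro _ ⟨P, hP, p, h, rfl⟩ Q v p' hQ h'
    obtain rfl : p' = p + (1, 0) := by
      have e1 := h'.left _ (Finset.mem_union_right _ h.mem_right)
      rcases Finset.mem_union.1 h'.mem_left with e2 | e2
      · have e3 := h.left _ e2
        simp only [Prod.fst_add] at e1
        omega
      · exact Finset.mem_singleton.1 e2
    have hb := (hS P hP).1.isBlack_last h.mem_left h.left
    -- The first cell of `Q` is black and is moved to `p + (2, 0)`, which is black; hence the
    -- translation preserves colours.
    have hv : IsBlack v := by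
      have hbq := (hS' Q hQ).1.isBlack_first (mem_shift.1 h'.mem_right) fun x hx => by
        have := h'.right (x + v) (mem_shift.2 (by simpa using hx))
        simp only [Prod.fst_add, Prod.snd_add, Prod.fst_sub, Prod.snd_sub] at this ⊢
        omega
      obtain ⟨b1, b2⟩ := hb
      obtain ⟨b3, b4⟩ := hbq
      simp only [Prod.fst_add, Prod.snd_add, Prod.fst_sub, Prod.snd_sub] at b3 b4
      exact ⟨by omega, by omega⟩
    refine hST P hP Q hQ _
      ((hS P hP).1.union_of_joined (sub_shift (hS' Q hQ).1 hv) h' h.mem_left hb) ?_ ?_ ?_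
    · exact h'.isHoleFree (h.isHoleFree (hS P hP).2 (isHoleFree_singleton _))
        (isHoleFree_shift (hS' Q hQ).2 v)
    · rw [h'.card_union, h.card_union, card_shift, Finset.card_singleton]
      ring
    · have e1 := h'.perimeter_union
      have e2 := h.perimeter_union
      rw [perimeter_shift] at e1
      rw [perimeter_singleton] at e2
      omega
  · rintro _ ⟨P, hP, q, hj, rfl⟩ _ ⟨P', hP', q', hj', rfl⟩ _ B p v _ B' p' v' rfl rfl h h' e
    rcases hinj with hi | hi
    · exact h.eq_of_card_eq h' e (by
        rw [card_shift, card_shift, hj.card_union, hj'.card_union, hi P hP P' hP',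
          Finset.card_singleton, Finset.card_singleton])
    · refine h.eq_of_perimeter_eq h' e ?_
      have e1 := hj.perimeter_union
      have e2 := hj'.perimeter_union
      rw [perimeter_singleton] at e1 e2
      rw [perimeter_shift, perimeter_shift]
      have := hi P hP P' hP'
      omega


/-! ### Loops of links

A link is one of the sides of a disc cell (a cell whose coordinates have an even sum), together with
a sense of rotation around this cell. -/

/-- A side of a cell with a sense of rotation. -/
@[ext] structure Link where
  cell : ℤ × ℤ
  side : ZMod 4
  sgn : ℤˣ

/-- The position of the corner `q` (between the sides `q - 1` and `q`) of a cell; a corner is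
identified with the cell of which it is the upper right corner. -/
def cornerOffset (q : ZMod 4) : ℤ × ℤ :=
  (![(0, 0), (-1, 0), (-1, -1), (0, -1)] : Fin 4 → ℤ × ℤ) q

/-- A sign as an element of `ZMod 4`. -/
def turn (ε : ℤˣ) : ZMod 4 := ((ε : ℤ) : ZMod 4)

theorem turn_one : turn 1 = 1 := rfl
theorem turn_neg_one : turn (-1) = 3 := rfl

theorem turn_neg (ε : ℤˣ) : turn (-ε) = turn ε + 2 := by
  rcases Int.units_eq_one_or ε with rfl | rfl
  · rfl
  · rw [neg_neg]; rfl

theorem turn_ne_zero (ε : ℤˣ) : turn ε ≠ 0 := by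
  rcases Int.units_eq_one_or ε with rfl | rfl <;> decide

namespace Link

/-- The corner at which a link starts. -/
def start (L : Link) : ℤ × ℤ :=
  L.cell + cornerOffset (if L.sgn = 1 then L.side else L.side + 1)

/-- The corner at which a link ends. -/
def finish (L : Link) : ℤ × ℤ :=
  L.cell + cornerOffset (if L.sgn = 1 then L.side + 1 else L.side)

/-- `L'` continues `L` smoothly: along the same circle, or along the kissing circle. -/
def Step (L L' : Link) : Prop :=
  (L'.cell = L.cell ∧ L'.side = L.side + turn L.sgn ∧ L'.sgn = L.sgn) ∨
    (L'.cell = L.cell + dir L.side + dir (L.side + turn L.sgn) ∧ L'.side = L.side + 2 ∧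
      L'.sgn = -L.sgn)

theorem neg_one_ne_one : (-1 : ℤˣ) ≠ 1 := by decide

theorem Step.finish_eq {L L' : Link} (h : L.Step L') : L.finish = L'.start := by
  rcases h with ⟨h1, h2, h3⟩ | ⟨h1, h2, h3⟩ <;>
  rcases Int.units_eq_one_or L.sgn with h | h <;>
  simp only [finish, start, h1, h2, h3, h, if_true, if_neg neg_one_ne_one, turn_one, turn_neg_one,
    neg_neg, add_assoc, add_right_inj] <;> generalize L.side = s <;> revert s <;> decide

end Link

/-- The side `s` of the cell `c` as a function on the sides of all cells. -/
def sideChain (c : ℤ × ℤ) (s : ZMod 4) (x : ℤ × ℤ) (t : ZMod 4) : ZMod 2 :=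
  (if c = x ∧ s = t then 1 else 0) + if c = x + dir t ∧ s = t + 2 then 1 else 0

theorem sideChain_symm (c : ℤ × ℤ) (s : ZMod 4) (x : ℤ × ℤ) (t : ZMod 4) :
    sideChain c s (x + dir t) (t + 2) = sideChain c s x t := by
  have e : t + 2 + 2 = t := by
    revert t; decide
  rw [sideChain, sideChain, add_dir_add_dir_two, e, add_comm]

/-- The four sides at the corner `x` detect whether `x` is one of the two ends of the given side. -/
theorem sideChain_closed (c : ℤ × ℤ) (s : ZMod 4) (x : ℤ × ℤ) :
    sideChain c s x 0 + sideChain c s x 3 + sideChain c s (x + (1, 1)) 1 +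
      sideChain c s (x + (1, 1)) 2 =
    (if c + cornerOffset s = x then 1 else 0) + if c + cornerOffset (s + 1) = x then 1 else 0 := by
  obtain ⟨a, b⟩ := c
  obtain ⟨i, j⟩ := x
  revert s
  have e5 : (0 : ZMod 4) + 1 = 1 := rfl
  have e6 : (1 : ZMod 4) + 1 = 2 := rfl
  have e7 : (2 : ZMod 4) + 1 = 3 := rfl
  have e8 : (3 : ZMod 4) + 1 = 0 := rfl
  have c0 : cornerOffset 0 = (0, 0) := rfl
  have c1 : cornerOffset 1 = (-1, 0) := rfl
  have c2 : cornerOffset 2 = (-1, -1) := rfl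
  have c3 : cornerOffset 3 = (0, -1) := rfl
  refine forall_side.2 ⟨?_, ?_, ?_, ?_⟩ <;>
  simp +decide only [sideChain, dir_zero, dir_one, dir_two, dir_three, c0, c1, c2, c3, e5, e6, e7, e8, Prod.mk_add_mk, Prod.mk.injEq, and_true, and_false, if_false, add_zero,
    zero_add, add_neg_cancel_right, add_neg_eq_iff_eq_add, add_comm]

/-! ### Closed polygons of links and the two sides of such a polygon -/

section Loop

variable {n : ℕ} (L : ZMod n → Link)

/-- The side `t` of the cell `x` is a side of the polygon formed by the links. -/
def IsEdge (x : ℤ × ℤ) (t : ZMod 4) : Prop :=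
  ∃ k, ((L k).cell = x ∧ (L k).side = t) ∨ ((L k).cell = x + dir t ∧ (L k).side = t + 2)

variable {L}

theorem parity_dir (x : ℤ × ℤ) (t : ZMod 4) (h : (x.1 + x.2) % 2 = 0) :
    ((x + dir t).1 + (x + dir t).2) % 2 = 1 := by
  have h2 : ∀ t, ((dir t).1 + (dir t).2) % 2 = 1 := by decide
  have := h2 t
  simp only [Prod.fst_add, Prod.snd_add]
  omega

theorem parity_dir' (x : ℤ × ℤ) (t : ZMod 4) (h : (x.1 + x.2) % 2 = 1) :
    ((x + dir t).1 + (x + dir t).2) % 2 = 0 := by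
  have h2 : ∀ t, ((dir t).1 + (dir t).2) % 2 = 1 := by decide
  have := h2 t
  simp only [Prod.fst_add, Prod.snd_add]
  omega

theorem isEdge_symm (x : ℤ × ℤ) (t : ZMod 4) : IsEdge L (x + dir t) (t + 2) ↔ IsEdge L x t := by
  have e : t + 2 + 2 = t := by
    revert t; decide
  simp only [IsEdge, add_dir_add_dir_two, e]
  exact exists_congr fun k => or_comm

theorem isEdge_iff (heven : ∀ k, ((L k).cell.1 + (L k).cell.2) % 2 = 0) {x : ℤ × ℤ}
    (hx : (x.1 + x.2) % 2 = 0) (t : ZMod 4) :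
    IsEdge L x t ↔ ∃ k, (L k).cell = x ∧ (L k).side = t := by
  refine exists_congr fun k => or_iff_left fun h => ?_
  have h1 := parity_dir x t hx
  have h2 := heven k
  rw [h.1] at h2
  omega

-- At every corner as many links start as end, so the sum of the sides is closed modulo two. As no
-- side is used twice, the potential jumps exactly across the polygon.
open Classical in
theorem exists_loop_potential [NeZero n] (hclosed : ∀ k, (L k).finish = (L (k + 1)).start)
    (heven : ∀ k, ((L k).cell.1 + (L k).cell.2) % 2 = 0)
    (hinj : ∀ k k', (L k).cell = (L k').cell → (L k).side = (L k').side → k = k') :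
    ∃ f : ℤ × ℤ → ZMod 2, ∀ x t, f x + f (x + dir t) = if IsEdge L x t then 1 else 0 := by
  obtain ⟨f, hf⟩ := exists_potential_sides
    (fun x t => ∑ k, sideChain (L k).cell (L k).side x t)
    (fun x t => Finset.sum_congr rfl fun k _ => sideChain_symm _ _ _ _) (by
      intro x
      simp only [← Finset.sum_add_distrib, sideChain_closed]
      have h1 : ∀ k, ((if (L k).cell + cornerOffset (L k).side = x then 1 else 0) +
          if (L k).cell + cornerOffset ((L k).side + 1) = x then 1 else 0 : ZMod 2) =
          (if (L k).start = x then 1 else 0) + if (L k).finish = x then 1 else 0 := by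
        intro k
        rcases Int.units_eq_one_or (L k).sgn with h | h
        · simp only [Link.start, Link.finish, h, if_true]
        · simp only [Link.start, Link.finish, h, if_neg Link.neg_one_ne_one]
          rw [add_comm]
      simp only [h1, hclosed, Finset.sum_add_distrib]
      -- The end of link `k` is the start of link `k + 1`, so both sums agree after a cyclic shift
      -- and cancel modulo two.
      have h2 := Equiv.sum_comp (Equiv.addRight (1 : ZMod n))
        (fun k => if (L k).start = x then (1 : ZMod 2) else 0)
      simp only [Equiv.coe_addRight] at h2
      refine Eq.trans (congrArg _ ?_) (zmod_two_add_self _)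
      convert h2 using 1
      exact Finset.sum_congr rfl fun _ _ => by congr)
  refine ⟨f, fun x t => ?_⟩
  rw [hf]
  have hodd : ∀ k, (L k).cell ≠ x ∨ (L k).cell ≠ x + dir t := by
    intro k
    by_contra! h
    exact dir_ne_zero t (by simpa using h.1.symm.trans h.2)
  have hs : ∀ k, sideChain (L k).cell (L k).side x t =
      if ((L k).cell = x ∧ (L k).side = t) ∨ ((L k).cell = x + dir t ∧ (L k).side = t + 2)
      then 1 else 0 := by
    intro k
    unfold sideChain
    have := hodd k
    split_ifs <;> tauto
  simp only [hs]
  split_ifs with h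
  · obtain ⟨k, hk⟩ := h
    rw [Finset.sum_eq_single k, if_pos hk]
    · intro m _ hmk
      refine if_neg fun hm => hmk ?_
      have p1 := heven k
      have p2 := heven m
      rcases Int.emod_two_eq_zero_or_one (x.1 + x.2) with hx | hx
      · have hx' := parity_dir x t hx
        rcases hk with hk | hk
        · rcases hm with hm | hm
          · exact hinj _ _ (hm.1.trans hk.1.symm) (hm.2.trans hk.2.symm)
          · rw [hm.1] at p2; omega
        · rw [hk.1] at p1; omega
      · rcases hk with hk | hk
        · rw [hk.1] at p1; omega
        · rcases hm with hm | hm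
          · rw [hm.1] at p2; omega
          · exact hinj _ _ (hm.1.trans hk.1.symm) (hm.2.trans hk.2.symm)
    · simp
  · exact Finset.sum_eq_zero fun k _ => if_neg fun hk => h ⟨k, hk⟩

/-- Of the four sides at the corner between `L k` and `L (k + 1)`, only those two are sides of the
polygon. -/
theorem corner_isEdge (hstep : ∀ k, (L k).Step (L (k + 1)))
    (heven : ∀ k, ((L k).cell.1 + (L k).cell.2) % 2 = 0)
    (hstart : Function.Injective fun k => (L k).start) (k : ZMod n) {c : ℤ × ℤ} {t : ZMod 4}
    (hc : (c.1 + c.2) % 2 = 0)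
    (ht : (L k).finish = c + cornerOffset t ∨ (L k).finish = c + cornerOffset (t + 1))
    (h : IsEdge L c t) : ((L k).cell = c ∧ (L k).side = t) ∨
      ((L (k + 1)).cell = c ∧ (L (k + 1)).side = t) := by
  obtain ⟨m, h1, h2⟩ := (isEdge_iff heven hc t).1 h
  have hm : (L m).start = (L k).finish ∨ (L m).finish = (L k).finish := by
    rcases Int.units_eq_one_or (L m).sgn with h3 | h3 <;> rcases ht with ht | ht <;>
    simp only [ht, Link.start, (Link.finish.eq_1 (L m)), h1, h2, h3, if_true,
      if_neg Link.neg_one_ne_one, true_or, or_true]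
  rcases hm with hm | hm
  · rw [(hstep k).finish_eq] at hm
    obtain rfl := hstart hm
    exact Or.inr ⟨h1, h2⟩
  · rw [(hstep k).finish_eq, (hstep m).finish_eq] at hm
    obtain rfl := add_right_cancel (hstart hm)
    exact Or.inl ⟨h1, h2⟩

theorem dir_add_dir_turn_ne_zero (s : ZMod 4) (ε : ℤˣ) : dir s + dir (s + turn ε) ≠ 0 := by
  rcases Int.units_eq_one_or ε with rfl | rfl <;> revert s <;> decide

theorem parity_dir_dir (x : ℤ × ℤ) (s t : ZMod 4) (h : (x.1 + x.2) % 2 = 0) :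
    ((x + dir s + dir t).1 + (x + dir s + dir t).2) % 2 = 0 :=
  parity_dir' _ _ (parity_dir _ _ h)

/-- Corners of the opposite circle at the end of a link. -/
theorem finish_eq_opposite (L : Link) :
    (L.finish = L.cell + dir L.side + dir (L.side + turn L.sgn) +
        cornerOffset (L.side + turn L.sgn + 2) ∨
      L.finish = L.cell + dir L.side + dir (L.side + turn L.sgn) +
        cornerOffset (L.side + turn L.sgn + 2 + 1)) ∧
    (L.finish = L.cell + dir L.side + dir (L.side + turn L.sgn) + cornerOffset (L.side + 2) ∨
      L.finish = L.cell + dir L.side + dir (L.side + turn L.sgn) +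
        cornerOffset (L.side + 2 + 1)) ∧
    (L.finish = L.cell + cornerOffset (L.side + turn L.sgn) ∨
      L.finish = L.cell + cornerOffset (L.side + turn L.sgn + 1)) := by
  obtain ⟨c, s, ε⟩ := L
  rcases Int.units_eq_one_or ε with rfl | rfl <;>
  simp only [Link.finish, if_true, if_neg Link.neg_one_ne_one, turn_one, turn_neg_one, add_assoc,
    add_right_inj] <;> revert s <;> decide

/-- At a corner where the polygon changes circles, the side that would continue on the first circle
is not a side of the polygon. -/
theorem not_isEdge_of_switch (hstep : ∀ k, (L k).Step (L (k + 1)))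
    (heven : ∀ k, ((L k).cell.1 + (L k).cell.2) % 2 = 0)
    (hstart : Function.Injective fun k => (L k).start) (k : ZMod n)
    (h : (L (k + 1)).cell = (L k).cell + dir (L k).side + dir ((L k).side + turn (L k).sgn)) :
    ¬IsEdge L (L k).cell ((L k).side + turn (L k).sgn) := by
  intro he
  rcases corner_isEdge hstep heven hstart k (heven k) (finish_eq_opposite (L k)).2.2 he with h1 | h1
  · exact turn_ne_zero _ (left_eq_add.1 h1.2)
  · rw [h, add_assoc] at h1
    exact dir_add_dir_turn_ne_zero _ _ (add_eq_left.1 h1.1)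

/-- At the end of a link the polygon continues on the same disc or along the far side of the
opposite disc. The side between the opposite disc and the gap just passed is used in neither case.
-/
theorem not_isEdge_opposite (hstep : ∀ k, (L k).Step (L (k + 1)))
    (heven : ∀ k, ((L k).cell.1 + (L k).cell.2) % 2 = 0)
    (hstart : Function.Injective fun k => (L k).start) (k : ZMod n) :
    ¬IsEdge L ((L k).cell + dir (L k).side + dir ((L k).side + turn (L k).sgn))
        ((L k).side + turn (L k).sgn + 2) := by
  intro he
  rcases corner_isEdge hstep heven hstart k (parity_dir_dir _ _ _ (heven k))
    (finish_eq_opposite (L k)).1 he with h1 | h1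
  · rw [add_assoc] at h1
    exact dir_add_dir_turn_ne_zero _ _ (left_eq_add.1 h1.1)
  · rcases hstep k with h2 | h2
    · rw [h2.1, add_assoc] at h1
      exact dir_add_dir_turn_ne_zero _ _ (left_eq_add.1 h1.1)
    · rw [h2.2.1] at h1
      exact turn_ne_zero (L k).sgn (left_eq_add.1 (add_right_cancel h1.2))

/-- If the polygon stays on its circle, the opposite disc is also open towards the next gap. -/
theorem not_isEdge_opposite_of_stay (hstep : ∀ k, (L k).Step (L (k + 1)))
    (heven : ∀ k, ((L k).cell.1 + (L k).cell.2) % 2 = 0)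
    (hstart : Function.Injective fun k => (L k).start) (k : ZMod n)
    (h : (L (k + 1)).cell = (L k).cell) :
    ¬IsEdge L ((L k).cell + dir (L k).side + dir ((L k).side + turn (L k).sgn))
        ((L k).side + 2) := by
  intro he
  rcases corner_isEdge hstep heven hstart k (parity_dir_dir _ _ _ (heven k))
    (finish_eq_opposite (L k)).2.1 he with h1 | h1
  · rw [add_assoc] at h1
    exact dir_add_dir_turn_ne_zero _ _ (left_eq_add.1 h1.1)
  · rw [h, add_assoc] at h1
    exact dir_add_dir_turn_ne_zero _ _ (left_eq_add.1 h1.1)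

/-- Reachability without crossing the polygon. -/
def Uncrossed (L : ZMod n → Link) : ℤ × ℤ → ℤ × ℤ → Prop :=
  Relation.ReflTransGen fun a b => ∃ t, b = a + dir t ∧ ¬IsEdge L a t

theorem Uncrossed.step {a : ℤ × ℤ} (t : ZMod 4) (h : ¬IsEdge L a t) : Uncrossed L a (a + dir t) :=
  Relation.ReflTransGen.single ⟨t, rfl, h⟩

theorem Uncrossed.symm {a b : ℤ × ℤ} (h : Uncrossed L a b) : Uncrossed L b a := by
  refine Relation.ReflTransGen.head_induction_on h Relation.ReflTransGen.refl ?_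
  rintro a _ ⟨t, rfl, h⟩ _ ih
  exact Relation.ReflTransGen.tail ih
    ⟨t + 2, (add_dir_add_dir_two a t).symm, by rwa [isEdge_symm]⟩

theorem Uncrossed.trans {a b c : ℤ × ℤ} (h : Uncrossed L a b) (h' : Uncrossed L b c) :
    Uncrossed L a c := Relation.ReflTransGen.trans h h'

theorem Uncrossed.apply_eq {f : ℤ × ℤ → ZMod 2}
    (hf : ∀ x t, ¬IsEdge L x t → f x = f (x + dir t)) {a b : ℤ × ℤ} (h : Uncrossed L a b) :
    f a = f b := by
  induction h with
  | refl => rfl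
  | tail _ h ih =>
    obtain ⟨t, rfl, ht⟩ := h
    exact ih.trans (hf _ _ ht)

theorem Uncrossed.conn {f : ℤ × ℤ → ZMod 2}
    (hf : ∀ x t, ¬IsEdge L x t → f x = f (x + dir t)) {a b : ℤ × ℤ} (h : Uncrossed L a b) :
    Conn {x | f x = f a} a b := by
  induction h with
  | refl => exact Conn.refl _
  | @tail c d hac h ih =>
    obtain ⟨t, rfl, ht⟩ := h
    have := Uncrossed.apply_eq hf hac
    exact ih.trans (Conn.step t this.symm ((hf _ _ ht).symm.trans this.symm))

/-- Every cell can be reached from one of the two cells at the link `L 0` without crossing the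
polygon. -/
theorem uncrossed_or [NeZero n] (hstep : ∀ k, (L k).Step (L (k + 1)))
    (heven : ∀ k, ((L k).cell.1 + (L k).cell.2) % 2 = 0)
    (hstart : Function.Injective fun k => (L k).start) (x : ℤ × ℤ) :
    Uncrossed L (L 0).cell x ∨ Uncrossed L ((L 0).cell + dir (L 0).side) x := by
  set R : ℤ × ℤ → Prop := fun x =>
    Uncrossed L (L 0).cell x ∨ Uncrossed L ((L 0).cell + dir (L 0).side) x with hR
  have htrans : ∀ {x y}, R x → Uncrossed L x y → R y := by
    rintro x y (h | h) h'
    exacts [Or.inl (h.trans h'), Or.inr (h.trans h')]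
  -- The disc and the gap at a link are carried along to the next link. At the joint, the gap
  -- reaches the opposite disc; then either this disc reaches the next gap, or the old disc does.
  have hlink : ∀ k, R (L k).cell ∧ R ((L k).cell + dir (L k).side) := by
    intro k
    rw [← ZMod.natCast_zmod_val k]
    induction k.val with
    | zero =>
      rw [Nat.cast_zero]
      exact ⟨Or.inl Relation.ReflTransGen.refl, Or.inr Relation.ReflTransGen.refl⟩
    | succ m ih =>
      rw [Nat.cast_succ]
      generalize (m : ZMod n) = k at ih
      obtain ⟨ih1, ih2⟩ := ih
      have e1 := not_isEdge_opposite hstep heven hstart k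
      have hC : R ((L k).cell + dir (L k).side + dir ((L k).side + turn (L k).sgn)) := by
        refine htrans ih2 (Uncrossed.symm ?_)
        have := Uncrossed.step _ e1
        rwa [add_dir_add_dir_two] at this
      have hg : (L k).cell + dir (L k).side + dir ((L k).side + turn (L k).sgn) +
          dir ((L k).side + 2) = (L k).cell + dir ((L k).side + turn (L k).sgn) := by
        rw [add_right_comm (L k).cell, add_dir_add_dir_two]
      rcases hstep k with h | h
      · have e2 := Uncrossed.step _ (not_isEdge_opposite_of_stay hstep heven hstart k h.1)
        rw [hg] at e2
        rw [h.1, h.2.1]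
        exact ⟨ih1, htrans hC e2⟩
      · have e2 := Uncrossed.step _ (not_isEdge_of_switch hstep heven hstart k h.1)
        rw [h.1, h.2.1, hg]
        exact ⟨hC, htrans ih1 e2⟩
  have hx : Conn Set.univ (L 0).cell x := (conn_horizontal (j := x.1) fun _ _ _ => Set.mem_univ _).trans
    (conn_vertical fun _ _ _ => Set.mem_univ _)
  induction hx with
  | refl => exact (hlink 0).1
  | @tail y z _ hyz ih =>
    obtain ⟨-, -, t, rfl⟩ := hyz
    -- A step across the polygon ends at a face next to some link, and these are all reached.
    by_cases ht : IsEdge L y t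
    · obtain ⟨k, ⟨h1, h2⟩ | ⟨h1, h2⟩⟩ := ht
      · rw [← h1, ← h2]
        exact (hlink k).2
      · rw [← h1]
        exact (hlink k).1
    · exact htrans ih (Uncrossed.step t ht)

/-- The Jordan curve theorem for polygons of links: a simple loop is the boundary of a hole-free
polyomino. -/
theorem exists_polyomino_of_loop [NeZero n] (hstep : ∀ k, (L k).Step (L (k + 1)))
    (heven : ∀ k, ((L k).cell.1 + (L k).cell.2) % 2 = 0)
    (hstart : Function.Injective fun k => (L k).start)
    (hinj : ∀ k k', (L k).cell = (L k').cell → (L k).side = (L k').side → k = k') :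
    ∃ P : Finset (ℤ × ℤ), IsHoleFreePolyomino P ∧
      ∀ x t, IsEdge L x t ↔ (x ∈ P ↔ x + dir t ∉ P) := by
  classical
  obtain ⟨f, hf⟩ := exists_loop_potential (fun k => (hstep k).finish_eq) heven hinj
  have hne : ∀ x t, ¬IsEdge L x t → f x = f (x + dir t) := fun x t h => by
    have := hf x t
    rwa [if_neg h, CharTwo.add_eq_zero] at this
  have hedge : ∀ x t, IsEdge L x t → f x + f (x + dir t) = 1 := fun x t h => by rw [hf, if_pos h]
  obtain ⟨N, hN, hbox⟩ := exists_outBox_disjoint (Finset.univ.image fun k => (L k).cell)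
  have hfar : ∀ a ∈ outBox N, ∀ b ∈ outBox N, f a = f b := by
    intro a ha b hb
    have := conn_outBox hN ha hb
    induction this with
    | refl => rfl
    | @tail c d _ hcd ih =>
      obtain ⟨hc, hd, t, rfl⟩ := hcd
      refine (ih hc).trans (hne _ _ ?_)
      rintro ⟨k, h | h⟩
      · exact hbox _ hc (Finset.mem_image.2 ⟨k, Finset.mem_univ _, h.1⟩)
      · exact hbox _ hd (Finset.mem_image.2 ⟨k, Finset.mem_univ _, h.1⟩)
  -- The value of the potential at infinity; the polyomino is where `f` differs from it.
  set c := f (N + 1, 0) with hcdef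
  have hc : ∀ a ∈ outBox N, f a = c := fun a ha =>
    hfar a ha _ (Or.inl (by simp only; rw [abs_of_nonneg] <;> omega))
  have hfin : {x | f x ≠ c}.Finite := by
    refine (Set.finite_Icc ((-N, -N) : ℤ × ℤ) (N, N)).subset fun x hx => ?_
    have hx' : x ∉ outBox N := fun h => hx (hc x h)
    simp only [outBox, Set.mem_ofPred_eq, not_or, not_lt, abs_le] at hx'
    exact ⟨⟨hx'.1.1, hx'.2.1⟩, ⟨hx'.1.2, hx'.2.2⟩⟩
  have h2 : ∀ a b e : ZMod 2, a ≠ e → b ≠ e → a = b := by decide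
  have h3 : ∀ a b e : ZMod 2, a + b = 1 ↔ (a ≠ e ↔ ¬b ≠ e) := by decide
  have hmem : ∀ x, x ∈ hfin.toFinset ↔ f x ≠ c := fun x => hfin.mem_toFinset
  have h0 := hedge _ _ ⟨0, Or.inl ⟨rfl, rfl⟩⟩
  -- There are at most two uncrossed pieces and `f` takes different values on the two sides of `L
  -- 0`. So each level set of `f` is one piece.
  have hconn : ∀ a b, f a = f b → Conn {x | f x = f a} a b := by
    intro a b hab
    have key : ∀ a, (f a = f (L 0).cell → Uncrossed L (L 0).cell a) ∧
        (f a ≠ f (L 0).cell → Uncrossed L ((L 0).cell + dir (L 0).side) a) := by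
      intro a
      have h4 : f (L 0).cell ≠ f ((L 0).cell + dir (L 0).side) := fun h => by
        rw [h, zmod_two_add_self] at h0
        exact zero_ne_one h0
      rcases uncrossed_or hstep heven hstart a with h | h
      · exact ⟨fun _ => h, fun hn => (hn (h.apply_eq hne).symm).elim⟩
      · exact ⟨fun he => (h4 (he.symm.trans (h.apply_eq hne).symm)).elim, fun _ => h⟩
    refine Uncrossed.conn hne ?_
    by_cases ha : f a = f (L 0).cell
    · exact ((key a).1 ha).symm.trans ((key b).1 (hab ▸ ha))
    · exact ((key a).2 ha).symm.trans ((key b).2 (hab ▸ ha))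
  refine ⟨hfin.toFinset, (isHoleFree_iff _).2 ⟨?_, ?_, ?_⟩, ?_⟩
  · rw [(h3 _ _ c)] at h0
    by_cases h5 : f (L 0).cell ≠ c
    · exact ⟨_, (hmem _).2 h5⟩
    · exact ⟨(L 0).cell + dir (L 0).side, (hmem ((L 0).cell + dir (L 0).side)).2 fun h6 =>
        h5 (h0.2 (not_not.2 h6))⟩
  · intro a ha b hb
    rw [hmem] at ha hb
    refine (hconn a b (h2 _ _ _ ha hb)).mono fun x hx => ?_
    rw [Finset.mem_coe, hmem]
    rwa [show f x = f a from hx]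
  · intro a ha b hb
    rw [hmem, not_not] at ha hb
    refine (hconn a b (ha.trans hb.symm)).mono fun x hx => ?_
    rw [Set.mem_compl_iff, Finset.mem_coe, hmem, not_not]
    rwa [show f x = f a from hx]
  · intro x t
    rw [hmem, hmem, ← h3, hf]
    split_ifs with h <;> simp [h]

end Loop

/-- The perimeter counts the disc cells' sides that separate `P` from its complement. -/
theorem perimeter_eq_card_of_sides {ι : Type*} [Fintype ι] {P : Finset (ℤ × ℤ)}
    (c : ι → ℤ × ℤ) (s : ι → ZMod 4) (heven : ∀ k, ((c k).1 + (c k).2) % 2 = 0)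
    (hinj : ∀ k k', c k = c k' → s k = s k' → k = k')
    (hb : ∀ k, c k ∈ P ↔ c k + dir (s k) ∉ P)
    (hsurj : ∀ x t, (x.1 + x.2) % 2 = 0 → (x ∈ P ↔ x + dir t ∉ P) → ∃ k, c k = x ∧ s k = t) :
    perimeter P = Fintype.card ι := by
  classical
  rw [perimeter_eq_card, ← Finset.card_univ]
  symm
  have e : ∀ t : ZMod 4, t + 2 + 2 = t := by decide
  -- Exactly one of the two cells at a side is a disc. The side is named from inside `P`, hence by
  -- the disc or by the gap.
  refine Finset.card_bij
    (fun k _ => if c k ∈ P then (c k, s k) else (c k + dir (s k), s k + 2)) ?_ ?_ ?_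
  · intro k _
    rw [mem_boundarySides]
    have := hb k
    split_ifs with h
    · exact ⟨h, this.1 h⟩
    · rw [add_dir_add_dir_two]
      exact ⟨by tauto, h⟩
  · intro k _ k' _ h
    have p1 := heven k
    have p2 := heven k'
    split_ifs at h <;> rw [Prod.mk.injEq] at h
    · exact hinj _ _ h.1 h.2
    · have := parity_dir _ (s k') p2
      rw [h.1] at p1
      omega
    · have := parity_dir _ (s k) p1
      rw [← h.1] at p2
      omega
    · have hs := add_right_cancel h.2
      rw [hs] at h
      exact hinj _ _ (add_right_cancel h.1) hs
  · rintro ⟨x, t⟩ hx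
    rw [mem_boundarySides] at hx
    rcases Int.emod_two_eq_zero_or_one (x.1 + x.2) with h | h
    · obtain ⟨k, h1, h2⟩ := hsurj x t h (by tauto)
      refine ⟨k, Finset.mem_univ _, ?_⟩
      rw [if_pos (by rw [h1]; exact hx.1), h1, h2]
    · obtain ⟨k, h1, h2⟩ := hsurj (x + dir t) (t + 2) (parity_dir' x t h) (by
        rw [add_dir_add_dir_two]; tauto)
      refine ⟨k, Finset.mem_univ _, ?_⟩
      rw [if_neg (by rw [h1]; exact hx.2), h1, h2, add_dir_add_dir_two, e]

/-! ### Tracing the boundary -/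

/-- A link that separates `P` from its complement, with `P` on its left. -/
def IsBoundaryLink (P : Finset (ℤ × ℤ)) (L : Link) : Prop :=
  (L.cell.1 + L.cell.2) % 2 = 0 ∧ (L.cell ∈ P ↔ L.cell + dir L.side ∉ P) ∧
    (L.sgn = 1 ↔ L.cell ∈ P)

open Classical in
/-- The boundary link that follows a boundary link if `ε` is its sign, and the one that precedes it
if `ε` is the opposite of its sign. -/
def advance (P : Finset (ℤ × ℤ)) (ε : ℤˣ) (L : Link) : Link :=
  if L.cell + dir (L.side + turn ε) ∈ P ↔ L.cell + dir L.side ∈ P then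
    ⟨L.cell, L.side + turn ε, L.sgn⟩
  else ⟨L.cell + dir L.side + dir (L.side + turn ε), L.side + 2, -L.sgn⟩

theorem side_four (t : ZMod 4) : t + 2 + 2 = t := by
  revert t; decide

/-- Walking on and then turning back returns to the same link. It makes the successor map injective,
so that orbits close up. -/
theorem advance_advance (P : Finset (ℤ × ℤ)) (L : Link) :
    advance P (-(advance P L.sgn L).sgn) (advance P L.sgn L) = L := by
  obtain ⟨c, s, ε⟩ := L
  have e : s + turn ε + turn (-ε) = s := by
    rw [turn_neg, add_assoc, ← add_assoc (turn ε)]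
    rcases Int.units_eq_one_or ε with rfl | rfl <;> revert s <;> decide
  by_cases h : c + dir (s + turn ε) ∈ P ↔ c + dir s ∈ P
  · have h1 : advance P ε ⟨c, s, ε⟩ = ⟨c, s + turn ε, ε⟩ := if_pos h
    simp only [h1]
    rw [advance, if_pos]
    · simp only [e]
    · simp only [e]
      exact h.symm
  · have h1 : advance P ε ⟨c, s, ε⟩ = ⟨c + dir s + dir (s + turn ε), s + 2, -ε⟩ := if_neg h
    have e2 : c + dir s + dir (s + turn ε) + dir (s + 2) = c + dir (s + turn ε) := by
      rw [add_right_comm c, add_dir_add_dir_two]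
    have e3 : s + 2 + turn ε = s + turn ε + 2 := add_right_comm _ _ _
    simp only [h1, neg_neg]
    rw [advance, if_neg]
    · simp only [neg_neg, e2, e3, add_dir_add_dir_two, side_four]
    · simp only [e2, e3, add_dir_add_dir_two]
      exact fun h' => h h'.symm

theorem step_advance (P : Finset (ℤ × ℤ)) (L : Link) : L.Step (advance P L.sgn L) := by
  rw [advance]
  split_ifs
  · exact Or.inl ⟨rfl, rfl, rfl⟩
  · exact Or.inr ⟨rfl, rfl, rfl⟩

theorem isBlack_or_isWhite {d : ℤ × ℤ} (h : (d.1 + d.2) % 2 = 0) : IsBlack d ∨ IsWhite d := by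
  simp only [IsBlack, IsWhite]
  omega

/-- A black disc outside `P` has no adjacent gap in `P`, and a white disc in `P` has none outside.
So on the boundary, inner discs are black and outer ones white. -/
theorem Sub.mem_iff_isBlack {P : Finset (ℤ × ℤ)} (hP : Sub P) {d : ℤ × ℤ} {s : ZMod 4}
    (hd : (d.1 + d.2) % 2 = 0) (hb : d ∈ P ↔ d + dir s ∉ P) : d ∈ P ↔ IsBlack d := by
  rcases isBlack_or_isWhite hd with h | h
  · have := (hP d s).1 h
    tauto
  · have h1 := (hP d s).2 h
    have h2 : ¬IsBlack d := fun hh => by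
      have h3 := hh.1
      have h4 := h.1
      omega
    tauto

theorem isBlack_opposite {d : ℤ × ℤ} (hd : (d.1 + d.2) % 2 = 0) (s : ZMod 4) (ε : ℤˣ) :
    IsBlack (d + dir s + dir (s + turn ε)) ↔ ¬IsBlack d := by
  have h : ∀ s : ZMod 4, ∀ t ∈ ({1, 3} : Finset (ZMod 4)), ((dir s).1 + (dir (s + t)).1) % 2 = 1 ∧
      ((dir s).2 + (dir (s + t)).2) % 2 = 1 := by decide
  have h2 := h s (turn ε) (by rcases Int.units_eq_one_or ε with rfl | rfl <;> decide)
  simp only [IsBlack, Prod.fst_add, Prod.snd_add]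
  omega

/-- The circle is changed when the gap before the joint and the gap after it are on different sides.
The opposite disc has the other colour and borders both gaps, so it lies on the other side than the
old disc, in accordance with the reversed sign. -/
theorem isBoundaryLink_advance {P : Finset (ℤ × ℤ)} (hP : Sub P) {L : Link}
    (h : IsBoundaryLink P L) : IsBoundaryLink P (advance P L.sgn L) := by
  obtain ⟨c, s, ε⟩ := L
  obtain ⟨h1, h2, h3⟩ := h
  simp only at h1 h2 h3 ⊢
  rw [advance]
  split_ifs with h4 <;> simp only at h4
  · exact ⟨h1, by simp only; tauto, h3⟩
  · have hpar := parity_dir_dir c s (s + turn ε) h1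
    have e2 : c + dir s + dir (s + turn ε) + dir (s + 2) = c + dir (s + turn ε) := by
      rw [add_right_comm c, add_dir_add_dir_two]
    have hb := hP.mem_iff_isBlack h1 h2
    have hopp := isBlack_opposite h1 s ε
    have hC : c + dir s + dir (s + turn ε) ∈ P ↔ c ∉ P := by
      have k1 := (hP (c + dir s + dir (s + turn ε)) (s + turn ε + 2)).2
      have k2 := (hP (c + dir s + dir (s + turn ε)) (s + turn ε + 2)).1
      rw [add_dir_add_dir_two] at k1 k2
      rcases isBlack_or_isWhite hpar with k3 | k3
      · have := k2 k3
        tauto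
      · have k4 : ¬IsBlack (c + dir s + dir (s + turn ε)) := fun hh => by
          have h5 := hh.1
          have h6 := k3.1
          omega
        have := k1 k3
        tauto
    refine ⟨hpar, ?_, ?_⟩
    · simp only [e2]
      tauto
    · simp only [hC, ← h3]
      rcases Int.units_eq_one_or ε with rfl | rfl <;> decide

theorem finite_isBoundaryLink (P : Finset (ℤ × ℤ)) : {L | IsBoundaryLink P L}.Finite := by
  classical
  refine Set.Finite.of_injOn (f := fun L : Link => ((L.cell, L.side), L.sgn))
    (t := (((P ∪ P.biUnion cellNeighbors) ×ˢ Finset.univ) ×ˢ Finset.univ :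
      Finset (((ℤ × ℤ) × ZMod 4) × ℤˣ))) ?_ ?_
    (Finset.finite_toSet _)
  · rintro L ⟨-, h, -⟩
    simp only [Finset.coe_product, Set.mem_prod, Finset.mem_coe, Finset.mem_univ, and_true,
      Finset.mem_union, Finset.mem_biUnion, mem_cellNeighbors]
    by_cases hc : L.cell ∈ P
    · exact Or.inl hc
    · exact Or.inr ⟨L.cell + dir L.side, by tauto, L.side + 2, (add_dir_add_dir_two _ _).symm⟩
  · intro L _ L' _ h
    simp only [Prod.mk.injEq] at h
    exact Link.ext h.1.1 h.1.2 h.2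

theorem exists_isBoundaryLink {P : Finset (ℤ × ℤ)} (hne : P.Nonempty) :
    ∃ L, IsBoundaryLink P L := by
  have := four_le_perimeter hne
  rw [perimeter_eq_card] at this
  obtain ⟨⟨x, t⟩, hx⟩ := Finset.card_pos.1 (by omega : 0 < (boundarySides P).card)
  rw [mem_boundarySides] at hx
  rcases Int.emod_two_eq_zero_or_one (x.1 + x.2) with h | h
  · exact ⟨⟨x, t, 1⟩, h, by simp only; tauto, by simp only; tauto⟩
  · refine ⟨⟨x + dir t, t + 2, -1⟩, parity_dir' x t h, ?_, ?_⟩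
    · simp only [add_dir_add_dir_two]
      tauto
    · simp only [Link.neg_one_ne_one, false_iff]
      exact hx.2

/-- The boundary of a hole-free subcomplex is a single loop of links. -/
theorem exists_loop_of_polyomino {P : Finset (ℤ × ℤ)} (hP : IsHoleFreePolyomino P) (hS : Sub P) :
    ∃ L : ZMod (perimeter P) → Link, (∀ k, (L k).Step (L (k + 1))) ∧
      (∀ k, IsBoundaryLink P (L k)) ∧ Function.Injective L ∧
      ∀ x t, (x.1 + x.2) % 2 = 0 → (x ∈ P ↔ x + dir t ∉ P) → ∃ k, (L k).cell = x ∧ (L k).side = t := by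
  classical
  have hPne := isHoleFree_nonempty hP
  obtain ⟨-, hPc, hPcc⟩ := (isHoleFree_iff P).1 hP
  obtain ⟨L₀, hL₀⟩ := exists_isBoundaryLink hPne
  let T := {L // IsBoundaryLink P L}
  have : Finite T := (finite_isBoundaryLink P).to_subtype
  -- The successor map permutes the finite set of boundary links; the loop is the orbit of one of
  -- them.
  let next : T → T := fun L => ⟨advance P L.1.sgn L.1, isBoundaryLink_advance hS L.2⟩
  have hnext : Function.Injective next := by
    intro L L' h
    have h' : advance P L.1.sgn L.1 = advance P L'.1.sgn L'.1 := congrArg Subtype.val h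
    apply Subtype.ext
    rw [← advance_advance P L.1, h', advance_advance]
  let a : T := ⟨L₀, hL₀⟩
  let r := Function.minimalPeriod next a
  have hr : 0 < r := Function.minimalPeriod_pos_of_mem_periodicPts (hnext.mem_periodicPts a)
  have : NeZero r := ⟨hr.ne'⟩
  let M : ZMod r → T := fun k => next^[k.val] a
  have hM : ∀ k, M (k + 1) = next (M k) := by
    intro k
    have e : (k + 1).val = (k.val + 1) % r := by
      rcases eq_or_ne r 1 with h1 | h1
      · have h2 := ZMod.val_lt (k + 1)
        have h3 := Nat.mod_lt (k.val + 1) hr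
        omega
      · have : Fact (1 < r) := ⟨by omega⟩
        rw [ZMod.val_add, ZMod.val_one]
    simp only [M]
    rw [← Function.iterate_succ_apply' next, e, Function.iterate_mod_minimalPeriod_eq]
  have hMinj : Function.Injective M := by
    intro k k' h
    exact ZMod.val_injective r (Function.iterate_injOn_Iio_minimalPeriod (ZMod.val_lt k)
      (ZMod.val_lt k') h)
  let L : ZMod r → Link := fun k => (M k).1
  have hL : ∀ k, IsBoundaryLink P (L k) := fun k => (M k).2
  have hstep : ∀ k, (L k).Step (L (k + 1)) := by
    intro k
    simp only [L, hM]
    exact step_advance P (M k).1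
  have hinj : ∀ k k', (L k).cell = (L k').cell → (L k).side = (L k').side → k = k' := by
    intro k k' h1 h2
    refine hMinj (Subtype.ext (Link.ext h1 h2 ?_))
    have e1 := (hL k).2.2
    have e2 := (hL k').2.2
    rw [h1, ← e2] at e1
    rcases Int.units_eq_one_or (L k).sgn with h3 | h3
    · exact h3.trans (e1.1 h3).symm
    · rcases Int.units_eq_one_or (L k').sgn with h4 | h4
      · exact (e1.2 h4).trans h4.symm
      · exact h3.trans h4.symm
  -- The potential of this one orbit is constant on `P` and on its complement, both being connected,
  -- and the two values differ at `L 0`. So it jumps across every boundary side, and the orbit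
  -- contains them all.
  obtain ⟨f, hf⟩ := exists_loop_potential (fun k => (hstep k).finish_eq) (fun k => (hL k).1) hinj
  have hcross : ∀ x t, IsEdge L x t → (x ∈ P ↔ x + dir t ∉ P) := by
    rintro x t ⟨k, ⟨h1, h2⟩ | ⟨h1, h2⟩⟩
    · have := (hL k).2.1
      rwa [h1, h2] at this
    · have := (hL k).2.1
      rw [h1, h2, add_dir_add_dir_two] at this
      tauto
  have hconst : ∀ S : Set (ℤ × ℤ), (∀ x ∈ S, ∀ y ∈ S, (x ∈ P ↔ y ∈ P)) → ∀ x y, Conn S x y →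
      f x = f y := by
    intro S hS x y hxy
    induction hxy with
    | refl => rfl
    | @tail c d _ hcd ih =>
      obtain ⟨hc, hd, t, rfl⟩ := hcd
      rw [ih]
      have h1 := hf c t
      have h2 := hS _ hc _ hd
      rw [if_neg fun h => by have := hcross c t h; tauto] at h1
      rwa [CharTwo.add_eq_zero] at h1
  have hconst1 : ∀ x ∈ P, ∀ y ∈ P, f x = f y := fun x hx y hy =>
    hconst P (fun x hx y hy => iff_of_true hx hy) x y (hPc x hx y hy)
  have hconst2 : ∀ x ∉ P, ∀ y ∉ P, f x = f y := fun x hx y hy =>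
    hconst _ (fun x hx y hy => iff_of_false hx hy) x y (hPcc x hx y hy)
  have h0 : ∀ x ∈ P, ∀ y ∉ P, f x + f y = 1 := by
    intro x hx y hy
    have h1 := hf (L 0).cell (L 0).side
    rw [if_pos ⟨0, Or.inl ⟨rfl, rfl⟩⟩] at h1
    have h2 := (hL 0).2.1
    by_cases h3 : (L 0).cell ∈ P
    · rw [← h1, hconst1 x hx _ h3, hconst2 y hy _ (h2.1 h3)]
    · rw [← h1, add_comm, hconst1 x hx ((L 0).cell + dir (L 0).side) (by tauto), hconst2 y hy _ h3]
  have hsurj : ∀ x t, (x.1 + x.2) % 2 = 0 → (x ∈ P ↔ x + dir t ∉ P) →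
      ∃ k, (L k).cell = x ∧ (L k).side = t := by
    intro x t hx hxt
    rw [← isEdge_iff (fun k => (hL k).1) hx]
    by_contra hcon
    have h1 := hf x t
    rw [if_neg hcon] at h1
    by_cases h2 : x ∈ P
    · rw [h0 x h2 _ (hxt.1 h2)] at h1
      exact one_ne_zero h1
    · rw [add_comm, h0 (x + dir t) (by tauto) x h2] at h1
      exact one_ne_zero h1
  have hper : perimeter P = r := by
    rw [perimeter_eq_card_of_sides (fun k => (L k).cell) (fun k => (L k).side) (fun k => (hL k).1)
      hinj (fun k => (hL k).2.1) hsurj, ZMod.card]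
  rw [hper]
  exact ⟨L, hstep, hL, fun k k' h => hMinj (Subtype.ext h), hsurj⟩


/-! ### Colours along a loop -/

section Colour

variable {n : ℕ} {L : ZMod n → Link} {P : Finset (ℤ × ℤ)}

theorem forall_zmod_of_step [NeZero n] {p : ZMod n → Prop} (h0 : p 0) (h : ∀ k, p k → p (k + 1)) (k : ZMod n) :
    p k := by
  have key : ∀ m : ℕ, p (m : ZMod n) := by
    intro m
    induction m with
    | zero => simpa using h0
    | succ m ih => simpa using h _ ih
  simpa using key k.val

/-- When the loop changes circles, both the colour of the disc and its membership in `P` are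
reversed. -/
theorem mem_iff_isBlack_step (hstep : ∀ k, (L k).Step (L (k + 1)))
    (heven : ∀ k, ((L k).cell.1 + (L k).cell.2) % 2 = 0)
    (hstart : Function.Injective fun k => (L k).start)
    (hP : ∀ x t, IsEdge L x t ↔ (x ∈ P ↔ x + dir t ∉ P)) (k : ZMod n) :
    ((L (k + 1)).cell ∈ P ↔ IsBlack (L (k + 1)).cell) ↔ ((L k).cell ∈ P ↔ IsBlack (L k).cell) := by
  rcases hstep k with h | ⟨h, h', -⟩
  · rw [h.1]
  · have h1 := not_isEdge_of_switch hstep heven hstart k h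
    have h2 : IsEdge L (L (k + 1)).cell (L (k + 1)).side := ⟨k + 1, Or.inl ⟨rfl, rfl⟩⟩
    rw [hP] at h1 h2
    have h3 := isBlack_opposite (heven k) (L k).side (L k).sgn
    rw [h', h, add_right_comm, add_dir_add_dir_two, add_right_comm] at h2
    rw [h]
    tauto

/-- All along the loop either the inner discs are the black ones or the outer discs are. In the
second case a shift by `(1, 1)` exchanges the colours. -/
theorem sub_or_sub_shift [NeZero n] (hstep : ∀ k, (L k).Step (L (k + 1)))
    (heven : ∀ k, ((L k).cell.1 + (L k).cell.2) % 2 = 0)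
    (hstart : Function.Injective fun k => (L k).start)
    (hP : ∀ x t, IsEdge L x t ↔ (x ∈ P ↔ x + dir t ∉ P)) : Sub P ∨ Sub (shift (1, 1) P) := by
  have key : ∀ k, ((L k).cell ∈ P ↔ IsBlack (L k).cell) ↔ ((L 0).cell ∈ P ↔ IsBlack (L 0).cell) :=
    forall_zmod_of_step Iff.rfl fun k h =>
      (mem_iff_isBlack_step hstep heven hstart hP k).trans h
  have hcol : ∀ d s, (d.1 + d.2) % 2 = 0 → (d ∈ P ↔ d + dir s ∉ P) →
      ((d ∈ P ↔ IsBlack d) ↔ ((L 0).cell ∈ P ↔ IsBlack (L 0).cell)) := by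
    intro d s hd h
    obtain ⟨k, h1, -⟩ := (isEdge_iff heven hd s).1 ((hP d s).2 h)
    rw [← h1]
    exact key k
  by_cases h0 : (L 0).cell ∈ P ↔ IsBlack (L 0).cell
  · left
    intro d s
    constructor
    · intro hb
      have hd : (d.1 + d.2) % 2 = 0 := by
        simp only [IsBlack] at hb
        omega
      have := hcol d s hd
      tauto
    · intro hw
      have hd : (d.1 + d.2) % 2 = 0 ∧ ¬IsBlack d := by
        simp only [IsWhite] at hw
        simp only [IsBlack]
        omega
      have := hcol d s hd.1
      tauto
  · right
    intro d s
    rw [mem_shift, mem_shift, add_sub_right_comm]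
    constructor
    · intro hb
      have hd : ((d - (1, 1)).1 + (d - (1, 1)).2) % 2 = 0 ∧ ¬IsBlack (d - (1, 1)) := by
        simp only [IsBlack, Prod.fst_sub, Prod.snd_sub] at hb ⊢
        omega
      have := hcol (d - (1, 1)) s hd.1
      tauto
    · intro hw
      have hd : ((d - (1, 1)).1 + (d - (1, 1)).2) % 2 = 0 ∧ IsBlack (d - (1, 1)) := by
        simp only [IsWhite] at hw
        simp only [IsBlack, Prod.fst_sub, Prod.snd_sub]
        omega
      have := hcol (d - (1, 1)) s hd.1
      tauto

end Colour


/-! ### Coordinates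

The circles of a packing have their centres at the points `pt o x` with `x.1 + x.2` even; the other
points `pt o x` are the centres of the gaps.  In the coordinates `cu`, `cv`, rotated by `π / 4`, the
links are the quadrants of the circles. -/

/-- The centre of the face that corresponds to the cell `x`. -/
noncomputable def pt (o : ℂ) (x : ℤ × ℤ) : ℂ := o + (Real.sqrt 2 : ℂ) * ((x.1 : ℂ) + (x.2 : ℂ) * Complex.I)

/-- The first rotated coordinate. -/
noncomputable def cu (o z : ℂ) : ℝ := ((z - o).re + (z - o).im) / Real.sqrt 2

/-- The second rotated coordinate. -/
noncomputable def cv (o z : ℂ) : ℝ := ((z - o).im - (z - o).re) / Real.sqrt 2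

/-- The first rotated coordinate of a cell. -/
def cellU (x : ℤ × ℤ) : ℤ := x.1 + x.2

/-- The second rotated coordinate of a cell. -/
def cellV (x : ℤ × ℤ) : ℤ := x.2 - x.1

theorem cellU_add (x y : ℤ × ℤ) : cellU (x + y) = cellU x + cellU y := by
  simp only [cellU, Prod.fst_add, Prod.snd_add]; ring

theorem cellV_add (x y : ℤ × ℤ) : cellV (x + y) = cellV x + cellV y := by
  simp only [cellV, Prod.fst_add, Prod.snd_add]; ring

theorem cell_ext {x y : ℤ × ℤ} (hu : cellU x = cellU y) (hv : cellV x = cellV y) : x = y := by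
  simp only [cellU, cellV] at hu hv
  ext <;> omega

theorem cell_parity (x : ℤ × ℤ) : (cellU x + cellV x) % 2 = 0 := by
  simp only [cellU, cellV]; omega

theorem exists_cell {u v : ℤ} (h : (u + v) % 2 = 0) : ∃ x, cellU x = u ∧ cellV x = v :=
  ⟨((u - v) / 2, (u + v) / 2), by simp only [cellU]; omega, by simp only [cellV]; omega⟩

theorem dir_uv : ∀ s : ZMod 4, (cellU (dir s) = 1 ∨ cellU (dir s) = -1) ∧
    (cellV (dir s) = 1 ∨ cellV (dir s) = -1) := by decide

theorem exists_dir {u v : ℤ} (hu : u = 1 ∨ u = -1) (hv : v = 1 ∨ v = -1) :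
    ∃ s, cellU (dir s) = u ∧ cellV (dir s) = v := by
  rcases hu with rfl | rfl <;> rcases hv with rfl | rfl <;> decide

theorem dir_eq_of_uv : ∀ s t : ZMod 4, cellU (dir s) = cellU (dir t) → cellV (dir s) = cellV (dir t) →
    s = t := by decide

theorem sqrt_two_pos : 0 < Real.sqrt 2 := Real.sqrt_pos.2 two_pos

theorem sqrt_two_ne : Real.sqrt 2 ≠ 0 := sqrt_two_pos.ne'

theorem sqrt_two_sq : Real.sqrt 2 ^ 2 = 2 := Real.sq_sqrt zero_le_two

theorem cu_pt (o : ℂ) (x : ℤ × ℤ) : cu o (pt o x) = cellU x := by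
  simp only [cu, pt, cellU, add_sub_cancel_left, Complex.mul_re, Complex.mul_im, Complex.add_re,
    Complex.add_im, Complex.ofReal_re, Complex.ofReal_im, Complex.intCast_re, Complex.intCast_im,
    Complex.I_re, Complex.I_im]
  field_simp
  push_cast
  ring

theorem cv_pt (o : ℂ) (x : ℤ × ℤ) : cv o (pt o x) = cellV x := by
  simp only [cv, pt, cellV, add_sub_cancel_left, Complex.mul_re, Complex.mul_im, Complex.add_re,
    Complex.add_im, Complex.ofReal_re, Complex.ofReal_im, Complex.intCast_re, Complex.intCast_im,
    Complex.I_re, Complex.I_im]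
  field_simp
  push_cast
  ring

theorem uv_ext {o z w : ℂ} (hu : cu o z = cu o w) (hv : cv o z = cv o w) : z = w := by
  simp only [cu, cv, Complex.sub_re, Complex.sub_im] at hu hv
  rw [div_left_inj' sqrt_two_ne] at hu hv
  apply Complex.ext <;> linarith

theorem pt_injective (o : ℂ) : Function.Injective (pt o) := by
  intro x y h
  have hu := cu_pt o x
  have hv := cv_pt o x
  rw [h, cu_pt] at hu
  rw [h, cv_pt] at hv
  exact cell_ext (by exact_mod_cast hu.symm) (by exact_mod_cast hv.symm)

theorem dist_sq (o z w : ℂ) : dist z w ^ 2 = (cu o z - cu o w) ^ 2 + (cv o z - cv o w) ^ 2 := by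
  rw [Complex.dist_eq, ← Complex.normSq_eq_norm_sq, Complex.normSq_apply]
  have h := sqrt_two_sq
  simp only [cu, cv, Complex.sub_re, Complex.sub_im]
  field_simp
  rw [h]
  ring

theorem pt_add (o : ℂ) (x y : ℤ × ℤ) : pt o (x + y) = pt (pt o x) y := by
  simp only [pt, Prod.fst_add, Prod.snd_add]
  push_cast
  ring

theorem cu_pt_right (o z : ℂ) (v : ℤ × ℤ) : cu (pt o v) z = cu o z - cellU v := by
  rw [← cu_pt o v]
  simp only [cu, Complex.sub_re, Complex.sub_im]
  ring

theorem cv_pt_right (o z : ℂ) (v : ℤ × ℤ) : cv (pt o v) z = cv o z - cellV v := by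
  rw [← cv_pt o v]
  simp only [cv, Complex.sub_re, Complex.sub_im]
  ring

theorem cu_lineMap (o z w : ℂ) (t : ℝ) :
    cu o (AffineMap.lineMap z w t) = cu o z + t * (cu o w - cu o z) := by
  simp only [cu, AffineMap.lineMap_apply, vsub_eq_sub, vadd_eq_add, Complex.sub_re, Complex.sub_im,
    Complex.add_re, Complex.add_im, Complex.real_smul, Complex.mul_re, Complex.mul_im,
    Complex.ofReal_re, Complex.ofReal_im]
  ring

theorem cv_lineMap (o z w : ℂ) (t : ℝ) :
    cv o (AffineMap.lineMap z w t) = cv o z + t * (cv o w - cv o z) := by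
  simp only [cv, AffineMap.lineMap_apply, vsub_eq_sub, vadd_eq_add, Complex.sub_re, Complex.sub_im,
    Complex.add_re, Complex.add_im, Complex.real_smul, Complex.mul_re, Complex.mul_im,
    Complex.ofReal_re, Complex.ofReal_im]
  ring

theorem continuous_cu (o : ℂ) : Continuous (cu o) := by
  unfold cu
  fun_prop

theorem continuous_cv (o : ℂ) : Continuous (cv o) := by
  unfold cv
  fun_prop

/-! ### Links in coordinates -/

/-- The cosine of `q π / 2`. -/
def qcos (q : ZMod 4) : ℤ := (![1, 0, -1, 0] : Fin 4 → ℤ) q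

/-- The sine of `q π / 2`. -/
def qsin (q : ZMod 4) : ℤ := (![0, 1, 0, -1] : Fin 4 → ℤ) q

theorem cos_sin_quarter (j : ℤ) : Real.cos (j * (Real.pi / 2)) = qcos (j : ZMod 4) ∧
    Real.sin (j * (Real.pi / 2)) = qsin (j : ZMod 4) := by
  have h : ((j : ℝ) * (Real.pi / 2)) = ((j % 4 : ℤ) : ℝ) * (Real.pi / 2) +
      ((j / 4 : ℤ) : ℝ) * (2 * Real.pi) := by
    have := congrArg (fun z : ℤ => (z : ℝ)) (Int.emod_add_mul_ediv j 4)
    simp only [Int.cast_add, Int.cast_mul, Int.cast_ofNat] at this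
    linear_combination (-Real.pi / 2) * this
  have h2 : (j : ZMod 4) = ((j % 4 : ℤ) : ZMod 4) := by
    rw [ZMod.intCast_eq_intCast_iff']
    simp
  rw [h, Real.cos_add_int_mul_two_pi, Real.sin_add_int_mul_two_pi, h2]
  have h3 : j % 4 = 0 ∨ j % 4 = 1 ∨ j % 4 = 2 ∨ j % 4 = 3 := by omega
  have e3 : ((3 : ℝ) * (Real.pi / 2)) = Real.pi + Real.pi / 2 := by ring
  rcases h3 with h3 | h3 | h3 | h3 <;> rw [h3]
  · simp [qcos, qsin]
  · simp [qcos, qsin]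
  · simp only [Int.cast_ofNat]
    rw [mul_div_cancel₀ _ two_ne_zero, Real.cos_pi, Real.sin_pi]
    have : qcos 2 = -1 ∧ qsin 2 = 0 := by decide
    rw [this.1, this.2]
    simp
  · simp only [Int.cast_ofNat]
    rw [e3, add_comm, Real.cos_add_pi, Real.sin_add_pi]
    have : qcos 3 = 0 ∧ qsin 3 = -1 := by decide
    rw [this.1, this.2]
    simp

theorem linkPoint_re (c : ℂ) (j : ℤ) (ε : ℤˣ) (s : ℝ) : (linkPoint c j ε s).re = c.re +
    Real.cos (Real.pi / 4 + j * (Real.pi / 2) + ((ε : ℤ) : ℝ) * s) := by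
  rw [linkPoint, Complex.add_re, Complex.exp_ofReal_mul_I_re]

theorem linkPoint_im (c : ℂ) (j : ℤ) (ε : ℤˣ) (s : ℝ) : (linkPoint c j ε s).im = c.im +
    Real.sin (Real.pi / 4 + j * (Real.pi / 2) + ((ε : ℤ) : ℝ) * s) := by
  rw [linkPoint, Complex.add_im, Complex.exp_ofReal_mul_I_im]

theorem cos_sin_units (ε : ℤˣ) (s : ℝ) : Real.cos (((ε : ℤ) : ℝ) * s) = Real.cos s ∧
    Real.sin (((ε : ℤ) : ℝ) * s) = ((ε : ℤ) : ℝ) * Real.sin s := by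
  rcases Int.units_eq_one_or ε with rfl | rfl <;> simp

theorem cu_linkPoint (o c : ℂ) (j : ℤ) (ε : ℤˣ) (s : ℝ) : cu o (linkPoint c j ε s) =
    cu o c + (qcos j * Real.cos s - qsin j * (((ε : ℤ) : ℝ) * Real.sin s)) := by
  simp only [cu, Complex.sub_re, Complex.sub_im, linkPoint_re, linkPoint_im]
  simp only [Real.cos_add, Real.sin_add, Real.cos_pi_div_four, Real.sin_pi_div_four,
    (cos_sin_quarter j).1, (cos_sin_quarter j).2, (cos_sin_units ε s).1, (cos_sin_units ε s).2]
  field_simp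
  ring

theorem cv_linkPoint (o c : ℂ) (j : ℤ) (ε : ℤˣ) (s : ℝ) : cv o (linkPoint c j ε s) =
    cv o c + (qsin j * Real.cos s + qcos j * (((ε : ℤ) : ℝ) * Real.sin s)) := by
  simp only [cv, Complex.sub_re, Complex.sub_im, linkPoint_re, linkPoint_im]
  simp only [Real.cos_add, Real.sin_add, Real.cos_pi_div_four, Real.sin_pi_div_four,
    (cos_sin_quarter j).1, (cos_sin_quarter j).2, (cos_sin_units ε s).1, (cos_sin_units ε s).2]
  field_simp
  ring

theorem linkTangent_eq (j : ℤ) (ε : ℤˣ) (s : ℝ) :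
    linkTangent j ε s = ((ε : ℤ) : ℂ) * Complex.I * linkPoint 0 j ε s := by
  rw [linkTangent, linkPoint, zero_add]

/-- The side on which the link lies that starts in direction `j` with orientation `ε`. -/
def sideOf (j : ZMod 4) (ε : ℤˣ) : ZMod 4 := if ε = 1 then j else j - 1

/-- The quarter circle that separates the face `d` from its neighbour in direction `s`. -/
def arc (o : ℂ) (d : ℤ × ℤ) (s : ZMod 4) : Set ℂ :=
  {z | (cu o z - cellU d) ^ 2 + (cv o z - cellV d) ^ 2 = 1 ∧
    0 ≤ (cu o z - cellU d) * cellU (dir s) ∧ 0 ≤ (cv o z - cellV d) * cellV (dir s)}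

/-- In the rotated coordinates joints lie on the axes, so a link is the part of the circle in one
closed quadrant. The starting direction and the orientation select the quadrant. -/
theorem linkPoint_image (o : ℂ) (d : ℤ × ℤ) (j : ℤ) (ε : ℤˣ) :
    linkPoint (pt o d) j ε '' Set.Icc 0 (Real.pi / 2) = arc o d (sideOf j ε) := by
  have hq : ∀ q : ZMod 4, (q = 0 ∧ qcos q = 1 ∧ qsin q = 0) ∨ (q = 1 ∧ qcos q = 0 ∧ qsin q = 1) ∨
    (q = 2 ∧ qcos q = -1 ∧ qsin q = 0) ∨ (q = 3 ∧ qcos q = 0 ∧ qsin q = -1) := by decide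
  have hd : cellU (dir 0) = 1 ∧ cellV (dir 0) = 1 ∧ cellU (dir 1) = -1 ∧ cellV (dir 1) = 1 ∧
    cellU (dir 2) = -1 ∧ cellV (dir 2) = -1 ∧ cellU (dir 3) = 1 ∧ cellV (dir 3) = -1 := by decide
  obtain ⟨d1, d2, d3, d4, d5, d6, d7, d8⟩ := hd
  have hs : sideOf 0 (-1) = 3 ∧ sideOf 1 (-1) = 0 ∧ sideOf 2 (-1) = 1 ∧ sideOf 3 (-1) = 2 ∧
    ∀ q, sideOf q 1 = q := by decide
  obtain ⟨s0, s1, s2, s3, s4⟩ := hs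
  have hexists : ∀ p q : ℝ, p ^ 2 + q ^ 2 = 1 → 0 ≤ p → 0 ≤ q →
      ∃ t ∈ Set.Icc 0 (Real.pi / 2), Real.cos t = p ∧ Real.sin t = q := by
    intro p q h hp hq
    have hp1 : p ≤ 1 := by nlinarith
    refine ⟨Real.arccos p, ⟨Real.arccos_nonneg _, Real.arccos_le_pi_div_two.2 hp⟩,
      Real.cos_arccos (by linarith) hp1, ?_⟩
    rw [Real.sin_arccos, show 1 - p ^ 2 = q ^ 2 by linarith, Real.sqrt_sq hq]
  ext z
  simp only [arc, Set.mem_image, Set.mem_ofPred_eq]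
  constructor
  · rintro ⟨t, ht, rfl⟩
    have hc := Real.cos_nonneg_of_mem_Icc ⟨by linarith [ht.1, Real.pi_pos], ht.2⟩
    have hsn := Real.sin_nonneg_of_mem_Icc ⟨ht.1, by linarith [ht.2, Real.pi_pos]⟩
    have h1 := Real.cos_sq_add_sin_sq t
    rw [cu_linkPoint, cv_linkPoint, cu_pt, cv_pt, add_sub_cancel_left, add_sub_cancel_left]
    generalize (j : ZMod 4) = q
    rcases Int.units_eq_one_or ε with rfl | rfl <;>
    rcases hq q with ⟨rfl, h2, h3⟩ | ⟨rfl, h2, h3⟩ | ⟨rfl, h2, h3⟩ | ⟨rfl, h2, h3⟩ <;>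
    simp only [h2, h3, s0, s1, s2, s3, s4, d1, d2, d3, d4, d5, d6, d7, d8] <;> push_cast <;>
    refine ⟨by linarith, by linarith, by linarith⟩
  · rintro ⟨h1, hu, hv⟩
    have key : ∀ t ∈ Set.Icc 0 (Real.pi / 2),
        qcos j * Real.cos t - qsin j * (((ε : ℤ) : ℝ) * Real.sin t) = cu o z - cellU d →
        qsin j * Real.cos t + qcos j * (((ε : ℤ) : ℝ) * Real.sin t) = cv o z - cellV d →
        ∃ x ∈ Set.Icc 0 (Real.pi / 2), linkPoint (pt o d) j ε x = z := by
      intro t ht h2 h3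
      refine ⟨t, ht, uv_ext (o := o) ?_ ?_⟩
      · rw [cu_linkPoint, h2, cu_pt]; ring
      · rw [cv_linkPoint, h3, cv_pt]; ring
    generalize (j : ZMod 4) = q at *
    generalize cu o z - cellU d = a at *
    generalize cv o z - cellV d = b at *
    have fin : ∀ p r : ℝ, p ^ 2 + r ^ 2 = 1 → 0 ≤ p → 0 ≤ r →
        qcos q * p - qsin q * (((ε : ℤ) : ℝ) * r) = a →
        qsin q * p + qcos q * (((ε : ℤ) : ℝ) * r) = b →
        ∃ x ∈ Set.Icc 0 (Real.pi / 2), linkPoint (pt o d) j ε x = z := by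
      intro p r h4 h5 h6 h7 h8
      obtain ⟨t, ht, rfl, rfl⟩ := hexists p r h4 h5 h6
      exact key t ht h7 h8
    rcases Int.units_eq_one_or ε with rfl | rfl <;>
    rcases hq q with ⟨rfl, h2, h3⟩ | ⟨rfl, h2, h3⟩ | ⟨rfl, h2, h3⟩ | ⟨rfl, h2, h3⟩ <;>
    simp only [h2, h3, s0, s1, s2, s3, s4, d1, d2, d3, d4, d5, d6, d7, d8] at fin hu hv <;>
    push_cast at fin hu hv
    · exact fin a b (by linarith) (by linarith) (by linarith) (by ring) (by ring)
    · exact fin b (-a) (by linarith) (by linarith) (by linarith) (by ring) (by ring)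
    · exact fin (-a) (-b) (by linarith) (by linarith) (by linarith) (by ring) (by ring)
    · exact fin (-b) a (by linarith) (by linarith) (by linarith) (by ring) (by ring)
    · exact fin a (-b) (by linarith) (by linarith) (by linarith) (by ring) (by ring)
    · exact fin b a (by linarith) (by linarith) (by linarith) (by ring) (by ring)
    · exact fin (-a) b (by linarith) (by linarith) (by linarith) (by ring) (by ring)
    · exact fin (-b) (-a) (by linarith) (by linarith) (by linarith) (by ring) (by ring)


/-! ### The curve around a set of faces -/

/-- The links that separate faces in `Q` from faces outside `Q`. -/
def curve (o : ℂ) (Q : Finset (ℤ × ℤ)) : Set ℂ :=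
  {z | ∃ d s, (d.1 + d.2) % 2 = 0 ∧ (d ∈ Q ↔ d + dir s ∉ Q) ∧ z ∈ arc o d s}

/-- The face of the packing that corresponds to the cell `x`: a disc, or the gap between four
discs. -/
def face (o : ℂ) (x : ℤ × ℤ) : Set ℂ :=
  {z | ((x.1 + x.2) % 2 = 0 ∧ (cu o z - cellU x) ^ 2 + (cv o z - cellV x) ^ 2 ≤ 1) ∨
    ((x.1 + x.2) % 2 = 1 ∧ |cu o z - cellU x| ≤ 1 ∧ |cv o z - cellV x| ≤ 1 ∧
      ∀ s, 1 ≤ (cu o z - cellU (x + dir s)) ^ 2 + (cv o z - cellV (x + dir s)) ^ 2)}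

theorem face_subset {o z : ℂ} {x : ℤ × ℤ} (h : z ∈ face o x) :
    |cu o z - cellU x| ≤ 1 ∧ |cv o z - cellV x| ≤ 1 := by
  rcases h with ⟨-, h⟩ | ⟨-, h1, h2, -⟩
  · exact ⟨abs_le_one_iff_mul_self_le_one.2 (by nlinarith [sq_nonneg (cv o z - cellV x)]),
      abs_le_one_iff_mul_self_le_one.2 (by nlinarith [sq_nonneg (cu o z - cellU x)])⟩
  · exact ⟨h1, h2⟩

theorem isClosed_face (o : ℂ) (x : ℤ × ℤ) : IsClosed (face o x) := by
  have h1 := continuous_cu o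
  have h2 := continuous_cv o
  have hs : face o x = {z | (x.1 + x.2) % 2 = 0 ∧
      (cu o z - cellU x) ^ 2 + (cv o z - cellV x) ^ 2 ≤ 1} ∪
      {z | (x.1 + x.2) % 2 = 1 ∧ |cu o z - cellU x| ≤ 1 ∧ |cv o z - cellV x| ≤ 1 ∧
      ∀ s, 1 ≤ (cu o z - cellU (x + dir s)) ^ 2 + (cv o z - cellV (x + dir s)) ^ 2} := rfl
  rw [hs]
  refine IsClosed.union ?_ ?_
  · exact isClosed_const.and (isClosed_le (by fun_prop) (by fun_prop))
  · refine isClosed_const.and ((isClosed_le (by fun_prop) (by fun_prop)).and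
      ((isClosed_le (by fun_prop) (by fun_prop)).and ?_))
    simp only [Set.ofPred_forall]
    exact isClosed_iInter fun s => isClosed_le (by fun_prop) (by fun_prop)

/-- The plane is tiled by squares of side `2` around the gaps in the rotated coordinates. A point of
such a square is in one of the four discs at the corners or in the gap. -/
theorem exists_face (o z : ℂ) : ∃ x, z ∈ face o x := by
  obtain ⟨g, hu, hv⟩ := exists_cell (u := 2 * ⌊cu o z / 2⌋ + 1) (v := 2 * ⌊cv o z / 2⌋ + 1)
    (by omega)
  have hg : (g.1 + g.2) % 2 = 1 := by
    simp only [cellU] at hu; omega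
  have a1 := Int.floor_le (cu o z / 2)
  have a2 := Int.lt_floor_add_one (cu o z / 2)
  have a3 := Int.floor_le (cv o z / 2)
  have a4 := Int.lt_floor_add_one (cv o z / 2)
  by_cases h : ∀ s, 1 ≤ (cu o z - cellU (g + dir s)) ^ 2 + (cv o z - cellV (g + dir s)) ^ 2
  · refine ⟨g, Or.inr ⟨hg, ?_, ?_, h⟩⟩
    · rw [hu, abs_le]; push_cast
      constructor <;> linarith
    · rw [hv, abs_le]; push_cast
      constructor <;> linarith
  · push Not at h
    obtain ⟨s, hs⟩ := h
    exact ⟨g + dir s, Or.inl ⟨parity_dir' _ _ hg, hs.le⟩⟩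

/-- A disc and a gap only meet along a link. -/
theorem mem_arc_of_mem_face {o z : ℂ} {d g : ℤ × ℤ} (hd : (d.1 + d.2) % 2 = 0)
    (hg : (g.1 + g.2) % 2 = 1) (h : z ∈ face o d) (h' : z ∈ face o g) :
    ∃ s, g = d + dir s ∧ z ∈ arc o d s := by
  obtain ⟨a1, a2⟩ := face_subset h
  replace h := (h.resolve_right fun hh => by omega).2
  obtain ⟨b1, b2, b3⟩ := (h'.resolve_left fun hh => by omega).2
  rw [abs_le] at a1 a2 b1 b2
  have p1 := cell_parity d
  have p2 := cell_parity g
  have p3 : cellU d % 2 = 0 := hd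
  have p4 : cellU g % 2 = 1 := hg
  have u1 : cellU g - cellU d ≤ 2 := by
    have : ((cellU g - cellU d : ℤ) : ℝ) ≤ 2 := by push_cast; linarith
    exact_mod_cast this
  have u2 : -2 ≤ cellU g - cellU d := by
    have : (-2 : ℝ) ≤ ((cellU g - cellU d : ℤ) : ℝ) := by push_cast; linarith
    exact_mod_cast this
  have v1 : cellV g - cellV d ≤ 2 := by
    have : ((cellV g - cellV d : ℤ) : ℝ) ≤ 2 := by push_cast; linarith
    exact_mod_cast this
  have v2 : -2 ≤ cellV g - cellV d := by
    have : (-2 : ℝ) ≤ ((cellV g - cellV d : ℤ) : ℝ) := by push_cast; linarith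
    exact_mod_cast this
  -- Both coordinate differences are odd and at most `2` in absolute value, hence `1` or `-1`.
  obtain ⟨s, hs1, hs2⟩ := exists_dir (u := cellU g - cellU d) (v := cellV g - cellV d)
    (by omega) (by omega)
  have hgd : g = d + dir s := cell_ext (by rw [cellU_add, hs1]; ring) (by rw [cellV_add, hs2]; ring)
  refine ⟨s, hgd, ?_, ?_, ?_⟩
  · have := b3 (s + 2)
    rw [hgd, add_dir_add_dir_two] at this
    linarith
  · have e : (cellU g : ℝ) = cellU d + cellU (dir s) := by rw [hgd, cellU_add]; push_cast; rfl
    rcases (dir_uv s).1 with h1 | h1 <;> rw [h1] at e ⊢ <;> push_cast at e ⊢ <;> linarith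
  · have e : (cellV g : ℝ) = cellV d + cellV (dir s) := by rw [hgd, cellV_add]; push_cast; rfl
    rcases (dir_uv s).2 with h1 | h1 <;> rw [h1] at e ⊢ <;> push_cast at e ⊢ <;> linarith

/-- An axis through the centre of a gap stays at distance at least `1` from the centres of the four
discs. -/
theorem mem_face_of_cu_eq {o z : ℂ} {g : ℤ × ℤ} (hg : (g.1 + g.2) % 2 = 1)
    (hu : cu o z = cellU g) (hv : |cv o z - cellV g| ≤ 1) : z ∈ face o g := by
  refine Or.inr ⟨hg, by rw [hu]; norm_num, hv, fun s => ?_⟩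
  rw [hu, cellU_add]
  rcases (dir_uv s).1 with h | h <;> rw [h] <;> push_cast <;>
    nlinarith [sq_nonneg (cv o z - cellV (g + dir s))]

theorem mem_face_of_cv_eq {o z : ℂ} {g : ℤ × ℤ} (hg : (g.1 + g.2) % 2 = 1)
    (hv : cv o z = cellV g) (hu : |cu o z - cellU g| ≤ 1) : z ∈ face o g := by
  refine Or.inr ⟨hg, hu, by rw [hv]; norm_num, fun s => ?_⟩
  rw [hv, cellV_add]
  rcases (dir_uv s).2 with h | h <;> rw [h] <;> push_cast <;>
    nlinarith [sq_nonneg (cu o z - cellU (g + dir s))]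

theorem abs_sub_le_two {x : ℝ} {m n : ℤ} (h : |x - m| ≤ 1) (h' : |x - n| ≤ 1) :
    n - m ≤ 2 ∧ -2 ≤ n - m := by
  rw [abs_le] at h h'
  constructor
  · have : ((n - m : ℤ) : ℝ) ≤ 2 := by push_cast; linarith
    exact_mod_cast this
  · have : (-2 : ℝ) ≤ ((n - m : ℤ) : ℝ) := by push_cast; linarith
    exact_mod_cast this

/-- Two discs only meet in joints, and these also belong to a gap. -/
theorem exists_gap_of_mem_face {o z : ℂ} {d d' : ℤ × ℤ} (hd : (d.1 + d.2) % 2 = 0)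
    (hd' : (d'.1 + d'.2) % 2 = 0) (hne : d ≠ d') (h : z ∈ face o d) (h' : z ∈ face o d') :
    ((cu o z - cellU d) * (cv o z - cellV d) = 0 ∧
      (cu o z - cellU d) ^ 2 + (cv o z - cellV d) ^ 2 = 1) ∧
    ∃ g, (g.1 + g.2) % 2 = 1 ∧ z ∈ face o g := by
  obtain ⟨a1, a2⟩ := face_subset h
  obtain ⟨b1, b2⟩ := face_subset h'
  replace h := (h.resolve_right fun hh => by omega).2
  replace h' := (h'.resolve_right fun hh => by omega).2
  obtain ⟨u1, u2⟩ := abs_sub_le_two a1 b1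
  obtain ⟨v1, v2⟩ := abs_sub_le_two a2 b2
  have p3 : cellU d % 2 = 0 := hd
  have p4 : cellU d' % 2 = 0 := hd'
  have p1 := cell_parity d
  have p2 := cell_parity d'
  have q1 : cellU d' = cellU d ∨ cellU d' = cellU d + 2 ∨ cellU d' = cellU d - 2 := by omega
  have q2 : cellV d' = cellV d ∨ cellV d' = cellV d + 2 ∨ cellV d' = cellV d - 2 := by omega
  have hu : ∀ k : ℤ, cu o z - cellU d = k → (k = 1 ∨ k = -1) → cv o z - cellV d = 0 →
      ∃ g, (g.1 + g.2) % 2 = 1 ∧ z ∈ face o g := by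
    intro k h1 h2 h3
    obtain ⟨g, g1, g2⟩ := exists_cell (u := cellU d + k) (v := cellV d + 1) (by omega)
    have hg : (g.1 + g.2) % 2 = 1 := by simp only [cellU] at g1 p3; omega
    refine ⟨g, hg, mem_face_of_cu_eq hg ?_ ?_⟩
    · rw [g1]; push_cast; linarith
    · rw [g2, show cv o z = cellV d by linarith]; push_cast; norm_num
  have hv : ∀ k : ℤ, cv o z - cellV d = k → (k = 1 ∨ k = -1) → cu o z - cellU d = 0 →
      ∃ g, (g.1 + g.2) % 2 = 1 ∧ z ∈ face o g := by
    intro k h1 h2 h3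
    obtain ⟨g, g1, g2⟩ := exists_cell (u := cellU d + 1) (v := cellV d + k) (by omega)
    have hg : (g.1 + g.2) % 2 = 1 := by simp only [cellU] at g1 p3; omega
    refine ⟨g, hg, mem_face_of_cv_eq hg ?_ ?_⟩
    · rw [g2]; push_cast; linarith
    · rw [g1, show cu o z = cellU d by linarith]; push_cast; norm_num
  generalize cu o z = X at *
  generalize cv o z = Y at *
  rcases q1 with e1 | e1 | e1 <;> rcases q2 with e2 | e2 | e2 <;> rw [e1, e2] at h' <;>
    push_cast at h'
  · exact (hne (cell_ext e1.symm e2.symm)).elim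
  · have c1 : Y - cellV d = 1 := by nlinarith [sq_nonneg (X - cellU d), sq_nonneg (Y - cellV d - 1)]
    have c2 : X - cellU d = 0 := by rw [c1] at h; nlinarith [sq_nonneg (X - cellU d)]
    exact ⟨by rw [c1, c2]; norm_num, hv 1 (by simpa using c1) (by norm_num) c2⟩
  · have c1 : Y - cellV d = -1 := by
      nlinarith [sq_nonneg (X - cellU d), sq_nonneg (Y - cellV d + 1)]
    have c2 : X - cellU d = 0 := by rw [c1] at h; nlinarith [sq_nonneg (X - cellU d)]
    exact ⟨by rw [c1, c2]; norm_num, hv (-1) (by simpa using c1) (by norm_num) c2⟩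
  · have c1 : X - cellU d = 1 := by nlinarith [sq_nonneg (Y - cellV d), sq_nonneg (X - cellU d - 1)]
    have c2 : Y - cellV d = 0 := by rw [c1] at h; nlinarith [sq_nonneg (Y - cellV d)]
    exact ⟨by rw [c1, c2]; norm_num, hu 1 (by simpa using c1) (by norm_num) c2⟩
  · nlinarith [sq_nonneg (X - cellU d - 1), sq_nonneg (Y - cellV d - 1)]
  · nlinarith [sq_nonneg (X - cellU d - 1), sq_nonneg (Y - cellV d + 1)]
  · have c1 : X - cellU d = -1 := by
      nlinarith [sq_nonneg (Y - cellV d), sq_nonneg (X - cellU d + 1)]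
    have c2 : Y - cellV d = 0 := by rw [c1] at h; nlinarith [sq_nonneg (Y - cellV d)]
    exact ⟨by rw [c1, c2]; norm_num, hu (-1) (by simpa using c1) (by norm_num) c2⟩
  · nlinarith [sq_nonneg (X - cellU d + 1), sq_nonneg (Y - cellV d - 1)]
  · nlinarith [sq_nonneg (X - cellU d + 1), sq_nonneg (Y - cellV d + 1)]

/-- Two gaps only meet in points that also belong to a disc. -/
theorem exists_disc_of_mem_face {o z : ℂ} {g g' : ℤ × ℤ} (hg : (g.1 + g.2) % 2 = 1)
    (hg' : (g'.1 + g'.2) % 2 = 1) (hne : g ≠ g') (h : z ∈ face o g) (h' : z ∈ face o g') :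
    ∃ d, (d.1 + d.2) % 2 = 0 ∧ z ∈ face o d := by
  obtain ⟨a1, a2⟩ := face_subset h
  obtain ⟨b1, b2⟩ := face_subset h'
  obtain ⟨-, -, h⟩ := (h.resolve_left fun hh => by omega).2
  obtain ⟨u1, u2⟩ := abs_sub_le_two a1 b1
  obtain ⟨v1, v2⟩ := abs_sub_le_two a2 b2
  have p3 : cellU g % 2 = 1 := hg
  have p4 : cellU g' % 2 = 1 := hg'
  have p1 := cell_parity g
  have p2 := cell_parity g'
  have q1 : cellU g' = cellU g ∨ cellU g' = cellU g + 2 ∨ cellU g' = cellU g - 2 := by omega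
  have q2 : cellV g' = cellV g ∨ cellV g' = cellV g + 2 ∨ cellV g' = cellV g - 2 := by omega
  have hcase : (∃ k : ℤ, (k = 1 ∨ k = -1) ∧ cu o z - cellU g = k) ∨
      ∃ k : ℤ, (k = 1 ∨ k = -1) ∧ cv o z - cellV g = k := by
    rw [abs_le] at a1 a2 b1 b2
    rcases q1 with e1 | e1 | e1
    · rcases q2 with e2 | e2 | e2
      · exact (hne (cell_ext e1.symm e2.symm)).elim
      · rw [e2] at b2; push_cast at b2
        exact Or.inr ⟨1, Or.inl rfl, by push_cast; linarith⟩
      · rw [e2] at b2; push_cast at b2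
        exact Or.inr ⟨-1, Or.inr rfl, by push_cast; linarith⟩
    · rw [e1] at b1; push_cast at b1
      exact Or.inl ⟨1, Or.inl rfl, by push_cast; linarith⟩
    · rw [e1] at b1; push_cast at b1
      exact Or.inl ⟨-1, Or.inr rfl, by push_cast; linarith⟩
  rw [abs_le] at a1 a2
  rcases hcase with ⟨k, hk, e⟩ | ⟨k, hk, e⟩
  · obtain ⟨s, s1, s2⟩ := exists_dir hk (Or.inl rfl : (1 : ℤ) = 1 ∨ (1 : ℤ) = -1)
    obtain ⟨t, t1, t2⟩ := exists_dir hk (Or.inr rfl : (-1 : ℤ) = 1 ∨ (-1 : ℤ) = -1)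
    have c1 := h s
    have c2 := h t
    rw [cellU_add, cellV_add, s1, s2] at c1
    rw [cellU_add, cellV_add, t1, t2] at c2
    push_cast at c1 c2
    rw [← sub_sub, e, sub_self] at c1 c2
    have c3 : cv o z - cellV g = 0 := by nlinarith
    refine ⟨g + dir s, parity_dir' _ _ hg, Or.inl ⟨parity_dir' _ _ hg, ?_⟩⟩
    rw [cellU_add, cellV_add, s1, s2]
    push_cast
    rw [← sub_sub, e, sub_self, ← sub_sub, c3]
    norm_num
  · obtain ⟨s, s1, s2⟩ := exists_dir (Or.inl rfl : (1 : ℤ) = 1 ∨ (1 : ℤ) = -1) hk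
    obtain ⟨t, t1, t2⟩ := exists_dir (Or.inr rfl : (-1 : ℤ) = 1 ∨ (-1 : ℤ) = -1) hk
    have c1 := h s
    have c2 := h t
    rw [cellU_add, cellV_add, s1, s2] at c1
    rw [cellU_add, cellV_add, t1, t2] at c2
    push_cast at c1 c2
    rw [← sub_sub (cv o z), e, sub_self] at c1 c2
    have c3 : cu o z - cellU g = 0 := by nlinarith
    refine ⟨g + dir s, parity_dir' _ _ hg, Or.inl ⟨parity_dir' _ _ hg, ?_⟩⟩
    rw [cellU_add, cellV_add, s1, s2]
    push_cast
    rw [← sub_sub, c3, ← sub_sub, e, sub_self]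
    norm_num

/-- If `x` and `y` are of the same kind, the common point also lies in a face of the other kind.
That face is on the other side of the boundary from `x` or from `y`, which reduces everything to a
disc and a gap. -/
theorem mem_curve_of_mem_face {o z : ℂ} {Q : Finset (ℤ × ℤ)} {x y : ℤ × ℤ} (hx : x ∈ Q) (hy : y ∉ Q)
    (h : z ∈ face o x) (h' : z ∈ face o y) : z ∈ curve o Q := by
  have key : ∀ d g, (d.1 + d.2) % 2 = 0 → (g.1 + g.2) % 2 = 1 → (d ∈ Q ↔ g ∉ Q) →
      z ∈ face o d → z ∈ face o g → z ∈ curve o Q := by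
    intro d g hd hg hQ h1 h2
    obtain ⟨s, rfl, hs⟩ := mem_arc_of_mem_face hd hg h1 h2
    exact ⟨d, s, hd, hQ, hs⟩
  have hne : x ≠ y := fun e => hy (e ▸ hx)
  rcases Int.emod_two_eq_zero_or_one (x.1 + x.2) with px | px <;>
  rcases Int.emod_two_eq_zero_or_one (y.1 + y.2) with py | py
  · obtain ⟨-, g, hg, hz⟩ := exists_gap_of_mem_face px py hne h h'
    by_cases hgQ : g ∈ Q
    · exact key y g py hg (by tauto) h' hz
    · exact key x g px hg (by tauto) h hz
  · exact key x y px py (by tauto) h h'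
  · exact key y x py px (by tauto) h' h
  · obtain ⟨d, hd, hz⟩ := exists_disc_of_mem_face px py hne h h'
    by_cases hdQ : d ∈ Q
    · exact key d y hd py (by tauto) hz h'
    · exact key d x hd px (by tauto) hz h

theorem pt_mem_face (o : ℂ) (x : ℤ × ℤ) : pt o x ∈ face o x := by
  rcases Int.emod_two_eq_zero_or_one (x.1 + x.2) with h | h
  · refine Or.inl ⟨h, ?_⟩
    rw [cu_pt, cv_pt]
    norm_num
  · refine Or.inr ⟨h, ?_, ?_, fun s => ?_⟩
    · rw [cu_pt]; norm_num
    · rw [cv_pt]; norm_num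
    · rw [cu_pt, cv_pt, cellU_add, cellV_add]
      rcases dir_uv s with ⟨h1 | h1, h2 | h2⟩ <;> rw [h1, h2] <;> push_cast <;> norm_num

/-- The coordinate differences from a disc centre have even sum, so the sum of their squares is even
and not `1`. -/
theorem pt_notMem_curve (o : ℂ) (Q : Finset (ℤ × ℤ)) (x : ℤ × ℤ) : pt o x ∉ curve o Q := by
  rintro ⟨d, s, hd, -, h, -⟩
  rw [cu_pt, cv_pt] at h
  have h' : (cellU x - cellU d) ^ 2 + (cellV x - cellV d) ^ 2 = 1 := by exact_mod_cast h
  have p1 := cell_parity d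
  have p2 := cell_parity x
  obtain ⟨k, hk⟩ : ∃ k, cellU x - cellU d + (cellV x - cellV d) = 2 * k :=
    ⟨(cellU x - cellU d + (cellV x - cellV d)) / 2, by omega⟩
  have h3 : cellV x - cellV d = 2 * k - (cellU x - cellU d) := by linarith
  rw [h3] at h'
  have : 2 * ((cellU x - cellU d) ^ 2 - 2 * k * (cellU x - cellU d) + 2 * k ^ 2) = 1 := by
    linarith
  omega

/-- Needed to see that the union of the infinitely many faces outside `Q` is closed. -/
theorem locallyFinite_face (o : ℂ) : LocallyFinite (face o) := by
  intro z
  refine ⟨{w | |cu o w - cu o z| < 1 ∧ |cv o w - cv o z| < 1}, ?_, ?_⟩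
  · refine IsOpen.mem_nhds ?_ ?_
    · exact (isOpen_lt ((continuous_cu o).sub continuous_const).abs continuous_const).and
        (isOpen_lt ((continuous_cv o).sub continuous_const).abs continuous_const)
    · simp
  · refine (Set.finite_Icc (((⌊cu o z⌋ - ⌊cv o z⌋) / 2 - 4, (⌊cu o z⌋ + ⌊cv o z⌋) / 2 - 4) : ℤ × ℤ)
      ((⌊cu o z⌋ - ⌊cv o z⌋) / 2 + 4, (⌊cu o z⌋ + ⌊cv o z⌋) / 2 + 4)).subset ?_
    rintro x ⟨w, hw, hw1, hw2⟩
    obtain ⟨h1, h2⟩ := face_subset hw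
    rw [abs_le] at h1 h2
    rw [abs_lt] at hw1 hw2
    have a1 := Int.floor_le (cu o z)
    have a2 := Int.lt_floor_add_one (cu o z)
    have a3 := Int.floor_le (cv o z)
    have a4 := Int.lt_floor_add_one (cv o z)
    have u1 : cellU x < ⌊cu o z⌋ + 3 := by
      have : (cellU x : ℝ) < ((⌊cu o z⌋ + 3 : ℤ) : ℝ) := by push_cast; linarith
      exact_mod_cast this
    have u2 : ⌊cu o z⌋ - 2 < cellU x := by
      have : ((⌊cu o z⌋ - 2 : ℤ) : ℝ) < (cellU x : ℝ) := by push_cast; linarith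
      exact_mod_cast this
    have v1 : cellV x < ⌊cv o z⌋ + 3 := by
      have : (cellV x : ℝ) < ((⌊cv o z⌋ + 3 : ℤ) : ℝ) := by push_cast; linarith
      exact_mod_cast this
    have v2 : ⌊cv o z⌋ - 2 < cellV x := by
      have : ((⌊cv o z⌋ - 2 : ℤ) : ℝ) < (cellV x : ℝ) := by push_cast; linarith
      exact_mod_cast this
    simp only [cellU, cellV] at u1 u2 v1 v2
    simp only [Set.mem_Icc, Prod.le_def]
    omega

/-- The diagonal from `(0, 0)` to `(2, 2)` passes the discs around `(0, 2)` and `(2, 0)` at distance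
`√2`, so it meets only those at its ends. -/
theorem eq_of_diagonal {t : ℝ} (h0 : 0 ≤ t) (h2 : t ≤ 2) {p q : ℤ} (hp : p % 2 = 0) (hq : q % 2 = 0)
    (h : (t - p) ^ 2 + (t - q) ^ 2 ≤ 1) : (p = 0 ∧ q = 0) ∨ (p = 2 ∧ q = 2) := by
  have key : ∀ p q : ℤ, p % 2 = 0 → (t - p) ^ 2 + (t - q) ^ 2 ≤ 1 → p = 0 ∨ p = 2 := by
    intro p q hp h
    have h3 : |t - p| ≤ 1 :=
      abs_le_one_iff_mul_self_le_one.2 (by nlinarith [sq_nonneg (t - q)])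
    rw [abs_le] at h3
    have h4 : p ≤ 3 := by
      have : (p : ℝ) ≤ 3 := by linarith
      exact_mod_cast this
    have h5 : -1 ≤ p := by
      have : (-1 : ℝ) ≤ p := by linarith
      exact_mod_cast this
    omega
  have h' := h
  rw [add_comm] at h'
  rcases key p q hp h with rfl | rfl <;> rcases key q _ hq h' with rfl | rfl
  · exact Or.inl ⟨rfl, rfl⟩
  · push_cast at h
    nlinarith [sq_nonneg (t - 1)]
  · push_cast at h
    nlinarith [sq_nonneg (t - 1)]
  · exact Or.inr ⟨rfl, rfl⟩

/-- The discs close to a point of the segment from the centre of `d` through that of `d + dir s`. -/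
theorem eq_of_mem_ray {o : ℂ} {d d' : ℤ × ℤ} {s : ZMod 4} (hd : (d.1 + d.2) % 2 = 0)
    (hd' : (d'.1 + d'.2) % 2 = 0) {t : ℝ} (h0 : 0 ≤ t) (h2 : t ≤ 2) {z : ℂ}
    (hu : cu o z = cellU d + t * cellU (dir s)) (hv : cv o z = cellV d + t * cellV (dir s))
    (h : (cu o z - cellU d') ^ 2 + (cv o z - cellV d') ^ 2 ≤ 1) :
    d' = d ∨ d' = d + dir s + dir s := by
  have p1 : cellU d % 2 = 0 := hd
  have p2 : cellU d' % 2 = 0 := hd'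
  have p3 := cell_parity d
  have p4 := cell_parity d'
  have e1 := (dir_uv s).1
  have e2 := (dir_uv s).2
  have key := eq_of_diagonal h0 h2 (p := (cellU d' - cellU d) * cellU (dir s))
    (q := (cellV d' - cellV d) * cellV (dir s))
    (by rcases e1 with e | e <;> rw [e] <;> omega) (by rcases e2 with e | e <;> rw [e] <;> omega) (by
      rw [hu, hv] at h
      rcases e1 with e1 | e1 <;> rcases e2 with e2 | e2 <;> rw [e1, e2] at h ⊢ <;>
        push_cast at h ⊢ <;> linarith)
  rcases key with ⟨k1, k2⟩ | ⟨k1, k2⟩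
  · left
    refine cell_ext ?_ ?_
    · rcases e1 with e | e <;> rw [e] at k1 <;> omega
    · rcases e2 with e | e <;> rw [e] at k2 <;> omega
  · right
    refine cell_ext ?_ ?_
    · rw [cellU_add, cellU_add]
      rcases e1 with e | e <;> rw [e] at k1 ⊢ <;> omega
    · rw [cellV_add, cellV_add]
      rcases e2 with e | e <;> rw [e] at k2 ⊢ <;> omega

/-- The segment between the centres of neighbouring faces does not meet the curve, if both faces lie
on the same side. -/
theorem segment_disjoint_curve {o : ℂ} {Q : Finset (ℤ × ℤ)} {d : ℤ × ℤ} {s : ZMod 4}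
    (h : d ∈ Q ↔ d + dir s ∈ Q) : Disjoint (segment ℝ (pt o d) (pt o (d + dir s))) (curve o Q) := by
  have key : ∀ d s, (d.1 + d.2) % 2 = 0 → (d ∈ Q ↔ d + dir s ∈ Q) →
      Disjoint (segment ℝ (pt o d) (pt o (d + dir s))) (curve o Q) := by
    intro d s hd h
    rw [segment_eq_image_lineMap, Set.disjoint_left]
    rintro _ ⟨t, ⟨h0, h1⟩, rfl⟩ ⟨d', s', hd', hQ, hz1, hz2, hz3⟩
    set z := AffineMap.lineMap (pt o d) (pt o (d + dir s)) t with hz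
    have hu : cu o z = cellU d + t * cellU (dir s) := by
      rw [hz, cu_lineMap, cu_pt, cu_pt, cellU_add]; push_cast; ring
    have hv : cv o z = cellV d + t * cellV (dir s) := by
      rw [hz, cv_lineMap, cv_pt, cv_pt, cellV_add]; push_cast; ring
    have e1 := (dir_uv s).1
    have e2 := (dir_uv s).2
    have e3 := (dir_uv s').1
    have e4 := (dir_uv s').2
    rcases eq_of_mem_ray hd hd' h0 (by linarith) hu hv hz1.le with rfl | rfl
    · simp only [hu, hv, add_sub_cancel_left] at hz1 hz2 hz3
      have ht : 0 < t := by
        rcases h0.eq_or_lt with rfl | h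
        · norm_num at hz1
        · exact h
      have : s' = s := by
        refine dir_eq_of_uv _ _ ?_ ?_
        · rcases e1 with e | e <;> rcases e3 with e' | e' <;> rw [e, e'] at hz2 ⊢ <;>
            push_cast at hz2 <;> linarith
        · rcases e2 with e | e <;> rcases e4 with e' | e' <;> rw [e, e'] at hz3 ⊢ <;>
            push_cast at hz3 <;> linarith
      subst this
      tauto
    -- The second disc is out of reach: its centre is at distance `√2 (2 - t)`, at least `√2`.
    · rw [hu, hv, cellU_add, cellU_add, cellV_add, cellV_add] at hz1
      push_cast at hz1
      rcases e1 with e1 | e1 <;> rcases e2 with e2 | e2 <;> rw [e1, e2] at hz1 <;>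
        push_cast at hz1 <;> nlinarith
  rcases Int.emod_two_eq_zero_or_one (d.1 + d.2) with hd | hd
  · exact key d s hd h
  · have := key (d + dir s) (s + 2) (parity_dir' _ _ hd) (by rw [add_dir_add_dir_two]; exact h.symm)
    rwa [add_dir_add_dir_two, segment_symm] at this

/-! ### Inside and outside -/

/-- The faces in `Q` and those outside `Q` form two closed sets that cover the plane and meet only
in the curve. A component of the complement of the curve thus stays in one of them, and the first is
bounded. -/
theorem pt_mem_inside {o : ℂ} {Q : Finset (ℤ × ℤ)} {x : ℤ × ℤ} (hx : x ∈ Q) :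
    pt o x ∈ inside (curve o Q) := by
  refine ⟨pt_notMem_curve o Q x, ?_⟩
  have hA : IsClosed (⋃ y ∈ Q, face o y) := Q.finite_toSet.isClosed_biUnion fun y _ => isClosed_face o y
  have hB : IsClosed (⋃ y : {y // y ∉ Q}, face o y) :=
    ((locallyFinite_face o).comp_injective Subtype.val_injective).isClosed_iUnion
      fun y => isClosed_face o y
  have hcover : ∀ z, z ∉ (⋃ y : {y // y ∉ Q}, face o y) → z ∈ ⋃ y ∈ Q, face o y := by
    intro z hz
    obtain ⟨y, hy⟩ := exists_face o z
    by_cases hyQ : y ∈ Q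
    · exact Set.mem_biUnion hyQ hy
    · exact (hz (Set.mem_iUnion.2 ⟨⟨y, hyQ⟩, hy⟩)).elim
  have hmeet : ∀ z, z ∈ (⋃ y ∈ Q, face o y) → z ∈ (⋃ y : {y // y ∉ Q}, face o y) →
      z ∈ curve o Q := by
    intro z h1 h2
    obtain ⟨y, hy, h1⟩ := Set.mem_iUnion₂.1 h1
    obtain ⟨⟨y', hy'⟩, h2⟩ := Set.mem_iUnion.1 h2
    exact mem_curve_of_mem_face hy hy' h1 h2
  have hsub : connectedComponentIn (curve o Q)ᶜ (pt o x) ⊆ (⋃ y : {y // y ∉ Q}, face o y)ᶜ := by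
    refine IsPreconnected.subset_left_of_subset_union hB.isOpen_compl hA.isOpen_compl ?_ ?_ ?_
      isPreconnected_connectedComponentIn
    · rw [Set.disjoint_left]
      exact fun z h1 h2 => h2 (hcover z h1)
    · intro z hz
      by_contra h
      rw [Set.mem_union, not_or, Set.notMem_compl_iff, Set.notMem_compl_iff] at h
      exact connectedComponentIn_subset _ _ hz (hmeet z h.2 h.1)
    · refine ⟨pt o x, mem_connectedComponentIn (pt_notMem_curve o Q x), fun h => ?_⟩
      exact pt_notMem_curve o Q x (hmeet _ (Set.mem_biUnion hx (pt_mem_face o x)) h)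
  refine Bornology.IsBounded.subset ?_ (hsub.trans hcover)
  refine (Bornology.isBounded_biUnion Q.finite_toSet).2 fun y _ => ?_
  refine (Metric.isBounded_closedBall (x := pt o y) (r := 2)).subset fun z hz => ?_
  obtain ⟨h1, h2⟩ := face_subset hz
  rw [abs_le] at h1 h2
  have h := dist_sq o z (pt o y)
  rw [cu_pt, cv_pt] at h
  rw [Metric.mem_closedBall]
  nlinarith [dist_nonneg (x := z) (y := pt o y)]

theorem Conn.pt_connected {o : ℂ} {Q : Finset (ℤ × ℤ)} {x y : ℤ × ℤ}
    (h : Conn ((Q : Set (ℤ × ℤ))ᶜ) x y) :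
    pt o y ∈ connectedComponentIn (curve o Q)ᶜ (pt o x) := by
  induction h with
  | refl => exact mem_connectedComponentIn (pt_notMem_curve o Q x)
  | @tail b c _ hbc ih =>
    obtain ⟨hb, hc, s, rfl⟩ := hbc
    rw [connectedComponentIn_eq ih]
    have hd : Disjoint (segment ℝ (pt o b) (pt o (b + dir s))) (curve o Q) :=
      segment_disjoint_curve (iff_of_false hb hc)
    exact (convex_segment _ _).isPreconnected.subset_connectedComponentIn
      (left_mem_segment ℝ _ _) (Set.disjoint_left.1 hd) (right_mem_segment ℝ _ _)

/-- For a cell outside `Q`, segments between centres of neighbouring faces join its centre to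
arbitrarily distant ones, since the complement of `Q` is connected. -/
theorem pt_mem_inside_iff {o : ℂ} {Q : Finset (ℤ × ℤ)} (hQ : IsHoleFreePolyomino Q) (x : ℤ × ℤ) :
    pt o x ∈ inside (curve o Q) ↔ x ∈ Q := by
  refine ⟨fun ⟨_, h⟩ => ?_, pt_mem_inside⟩
  by_contra hx
  obtain ⟨-, -, hc⟩ := (isHoleFree_iff Q).1 hQ
  have hsub : pt o '' ((Q : Set (ℤ × ℤ))ᶜ) ⊆ connectedComponentIn (curve o Q)ᶜ (pt o x) := by
    rintro _ ⟨y, hy, rfl⟩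
    exact (hc x hx y hy).pt_connected
  obtain ⟨r, hr⟩ := (h.subset hsub).subset_closedBall o
  obtain ⟨N, hN⟩ := exists_nat_gt r
  obtain ⟨M, hM0, hM⟩ := exists_outBox_disjoint Q
  have hy : ((N + M + 1, 0) : ℤ × ℤ) ∉ Q :=
    hM _ (Or.inl (by simp only; rw [abs_of_nonneg] <;> omega))
  have h1 := hr (Set.mem_image_of_mem _ (Set.mem_compl (by simpa using hy)))
  rw [Metric.mem_closedBall] at h1
  have h2 := dist_sq o (pt o (N + M + 1, 0)) o
  have h3 : cu o o = 0 := by simp [cu]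
  rw [cu_pt, h3] at h2
  simp only [cellU] at h2
  push_cast at h2
  have h4 : (0 : ℝ) ≤ M := by exact_mod_cast hM0
  have h5 : (0 : ℝ) ≤ N := Nat.cast_nonneg N
  nlinarith [dist_nonneg (x := pt o (N + M + 1, 0)) (y := o), sq_nonneg (cv o (pt o (N + M + 1, 0)) - cv o o)]


/-! ### Tangles as boundaries -/

/-- The direction in which the link with side `s` and orientation `ε` starts. -/
def startOf (s : ZMod 4) (ε : ℤˣ) : ZMod 4 := if ε = 1 then s else s + 1

theorem sideOf_startOf (s : ZMod 4) (ε : ℤˣ) : sideOf (startOf s ε) ε = s := by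
  revert s ε; decide

theorem startOf_sideOf (j : ZMod 4) (ε : ℤˣ) : startOf (sideOf j ε) ε = j := by
  revert j ε; decide

theorem Link.start_eq (L : Link) : L.start = L.cell + cornerOffset (startOf L.side L.sgn) := rfl

theorem Link.finish_eq (L : Link) :
    L.finish = L.cell + cornerOffset (startOf L.side L.sgn + turn L.sgn) := by
  have h : ∀ (s : ZMod 4) (ε : ℤˣ), (if ε = 1 then s + 1 else s) = startOf s ε + turn ε := by decide
  rw [← h]; rfl

/-- The parametrised link. -/
noncomputable def Link.point (o : ℂ) (L : Link) : ℝ → ℂ :=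
  linkPoint (pt o L.cell) ((startOf L.side L.sgn).val : ℤ) L.sgn

/-- The unit tangent of a link. -/
noncomputable def Link.tangent (L : Link) : ℝ → ℂ :=
  linkTangent ((startOf L.side L.sgn).val : ℤ) L.sgn

theorem cast_val_zmod (q : ZMod 4) : (((q.val : ℕ) : ℤ) : ZMod 4) = q := by
  rw [Int.cast_natCast, ZMod.natCast_zmod_val]

theorem linkPoint_congr {c : ℂ} {j j' : ℤ} (h : (j : ZMod 4) = j') (ε : ℤˣ) :
    linkPoint c j ε = linkPoint c j' ε := by
  funext s
  apply uv_ext (o := 0)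
  · rw [cu_linkPoint, cu_linkPoint, h]
  · rw [cv_linkPoint, cv_linkPoint, h]

theorem linkPoint_eq_point {o : ℂ} {d : ℤ × ℤ} (j : ℤ) (ε : ℤˣ) :
    linkPoint (pt o d) j ε = Link.point o ⟨d, sideOf j ε, ε⟩ :=
  linkPoint_congr (by rw [startOf_sideOf, cast_val_zmod]) ε

theorem linkTangent_eq_tangent {d : ℤ × ℤ} (j : ℤ) (ε : ℤˣ) :
    linkTangent j ε = Link.tangent ⟨d, sideOf j ε, ε⟩ := by
  funext s
  rw [Link.tangent, linkTangent_eq, linkTangent_eq, linkPoint_congr (j := j)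
    (j' := ((startOf (sideOf j ε) ε).val : ℤ)) (by rw [startOf_sideOf, cast_val_zmod])]

theorem Link.image_point (o : ℂ) (L : Link) :
    L.point o '' Set.Icc 0 (Real.pi / 2) = arc o L.cell L.side := by
  rw [Link.point, linkPoint_image, cast_val_zmod, sideOf_startOf]

/-- The upper right corner of a cell is half a step from its centre in both grid directions, which
is `(1, 0)` in the rotated coordinates. -/
theorem Link.point_zero (o : ℂ) (L : Link) :
    cu o (L.point o 0) = cellU L.start + 1 ∧ cv o (L.point o 0) = cellV L.start := by
  have h : ∀ q, cellU (cornerOffset q) + 1 = qcos q ∧ cellV (cornerOffset q) = qsin q := by decide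
  rw [Link.point, cu_linkPoint, cv_linkPoint, cast_val_zmod, cu_pt, cv_pt, Link.start_eq, cellU_add,
    cellV_add, ← (h _).1, ← (h _).2]
  push_cast
  rw [Real.cos_zero, Real.sin_zero]
  constructor <;> ring

theorem Link.point_finish (o : ℂ) (L : Link) :
    cu o (L.point o (Real.pi / 2)) = cellU L.finish + 1 ∧
      cv o (L.point o (Real.pi / 2)) = cellV L.finish := by
  have h : ∀ (q : ZMod 4) (ε : ℤˣ), cellU (cornerOffset (q + turn ε)) + 1 = -(qsin q * ε) ∧
      cellV (cornerOffset (q + turn ε)) = qcos q * ε := by decide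
  rw [Link.point, cu_linkPoint, cv_linkPoint, cast_val_zmod, cu_pt, cv_pt, Link.finish_eq, cellU_add,
    cellV_add]
  have h1 := congrArg (fun z : ℤ => (z : ℝ)) (h (startOf L.side L.sgn) L.sgn).1
  have h2 := congrArg (fun z : ℤ => (z : ℝ)) (h (startOf L.side L.sgn) L.sgn).2
  push_cast at h1 h2 ⊢
  rw [Real.cos_pi_div_two, Real.sin_pi_div_two, h2]
  constructor <;> linarith

theorem Link.point_eq_iff (o : ℂ) (L L' : Link) :
    L.point o (Real.pi / 2) = L'.point o 0 ↔ L.finish = L'.start := by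
  obtain ⟨h1, h2⟩ := L.point_finish o
  obtain ⟨h3, h4⟩ := L'.point_zero o
  constructor
  · intro h
    rw [h, h3, add_left_inj] at h1
    rw [h, h4] at h2
    exact cell_ext (by exact_mod_cast h1.symm) (by exact_mod_cast h2.symm)
  · intro h
    rw [h] at h1 h2
    exact uv_ext (h1.trans h3.symm) (h2.trans h4.symm)

theorem Link.point_zero_eq_iff (o : ℂ) (L L' : Link) :
    L.point o 0 = L'.point o 0 ↔ L.start = L'.start := by
  obtain ⟨h1, h2⟩ := L.point_zero o
  obtain ⟨h3, h4⟩ := L'.point_zero o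
  constructor
  · intro h
    rw [h, h3, add_left_inj] at h1
    rw [h, h4] at h2
    exact cell_ext (by exact_mod_cast h1.symm) (by exact_mod_cast h2.symm)
  · intro h
    rw [h] at h1 h2
    exact uv_ext (h1.trans h3.symm) (h2.trans h4.symm)

theorem Link.tangent_eq_iff (L L' : Link) : L.tangent (Real.pi / 2) = L'.tangent 0 ↔
    (L'.side = L.side + turn L.sgn ∧ L'.sgn = L.sgn) ∨ (L'.side = L.side + 2 ∧ L'.sgn = -L.sgn) := by
  have key : ∀ (s s' : ZMod 4) (ε ε' : ℤˣ), ((ε : ℤ) * -(qsin (startOf s ε) * ε) =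
      ε' * qcos (startOf s' ε') ∧ (ε : ℤ) * (qcos (startOf s ε) * ε) = ε' * qsin (startOf s' ε')) ↔
      (s' = s + turn ε ∧ ε' = ε) ∨ (s' = s + 2 ∧ ε' = -ε) := by decide
  rw [← key, Link.tangent, Link.tangent, linkTangent_eq, linkTangent_eq]
  have hmul : ∀ (ε : ℤˣ) (z : ℂ), cu 0 (((ε : ℤ) : ℂ) * Complex.I * z) = -(((ε : ℤ) : ℝ) * cv 0 z) ∧
      cv 0 (((ε : ℤ) : ℂ) * Complex.I * z) = ((ε : ℤ) : ℝ) * cu 0 z := by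
    intro ε z
    rcases Int.units_eq_one_or ε with rfl | rfl <;> constructor <;>
      simp only [cu, cv, Units.val_one, Units.val_neg, Int.cast_one, Int.cast_neg, sub_zero,
        Complex.mul_re, Complex.mul_im, Complex.I_re, Complex.I_im, Complex.one_re, Complex.one_im,
        Complex.neg_re, Complex.neg_im] <;> ring
  have h0 : cu 0 0 = 0 ∧ cv 0 0 = 0 := by simp [cu, cv]
  have e1 : ∀ z w : ℂ, z = w ↔ cu 0 z = cu 0 w ∧ cv 0 z = cv 0 w :=
    fun z w => ⟨by rintro rfl; simp, fun h => uv_ext h.1 h.2⟩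
  rw [e1, (hmul _ _).1, (hmul _ _).2, (hmul _ _).1, (hmul _ _).2, cu_linkPoint, cv_linkPoint,
    cu_linkPoint, cv_linkPoint, h0.1, h0.2, cast_val_zmod, cast_val_zmod, Real.cos_pi_div_two,
    Real.sin_pi_div_two, Real.cos_zero, Real.sin_zero, neg_inj, and_comm]
  rw [← @Int.cast_inj ℝ, ← @Int.cast_inj ℝ]
  push_cast
  simp only [zero_add, mul_zero, mul_one, add_zero, sub_zero, zero_sub]

/-- Equal tangents leave two possibilities for side and sign of the next link, and the common joint
then determines its cell. -/
theorem Link.step_iff (o : ℂ) (L L' : Link) : L.Step L' ↔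
    L.point o (Real.pi / 2) = L'.point o 0 ∧ L.tangent (Real.pi / 2) = L'.tangent 0 := by
  rw [Link.point_eq_iff, Link.tangent_eq_iff]
  constructor
  · intro h
    exact ⟨h.finish_eq, h.imp (fun h => h.2) fun h => h.2⟩
  · rintro ⟨h1, h2⟩
    rw [Link.finish_eq, Link.start_eq] at h1
    rcases h2 with ⟨h2, h3⟩ | ⟨h2, h3⟩ <;> rw [h2, h3] at h1
    · refine Or.inl ⟨?_, h2, h3⟩
      have : ∀ (s : ZMod 4) (ε : ℤˣ), startOf (s + turn ε) ε = startOf s ε + turn ε := by decide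
      rw [this] at h1
      exact (add_right_cancel h1).symm
    · refine Or.inr ⟨?_, h2, h3⟩
      have : ∀ (s : ZMod 4) (ε : ℤˣ), cornerOffset (startOf s ε + turn ε) =
        dir s + dir (s + turn ε) + cornerOffset (startOf (s + 2) (-ε)) := by decide
      rw [this, ← add_assoc] at h1
      rw [add_assoc L.cell]
      exact (add_right_cancel h1).symm

/-- A boundary link is determined by the corner at which it starts. -/
theorem IsBoundaryLink.eq_of_start_eq {P : Finset (ℤ × ℤ)} (hP : Sub P) {L L' : Link}
    (h : IsBoundaryLink P L) (h' : IsBoundaryLink P L') (he : L.start = L'.start) : L = L' := by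
  obtain ⟨h1, h2, h3⟩ := h
  obtain ⟨h1', h2', h3'⟩ := h'
  have hb := hP.mem_iff_isBlack h1 h2
  have hb' := hP.mem_iff_isBlack h1' h2'
  rw [Link.start_eq, Link.start_eq] at he
  -- Discs that share a corner are equal or opposite to each other.
  have key : ∀ q q' : ZMod 4, ((cornerOffset q - cornerOffset q').1 +
      (cornerOffset q - cornerOffset q').2) % 2 = 0 → q' = q ∨ (q' = q + 2 ∧
      (cornerOffset q - cornerOffset q').1 % 2 = 1) := by decide
  have hc : L'.cell = L.cell + (cornerOffset (startOf L.side L.sgn) -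
      cornerOffset (startOf L'.side L'.sgn)) := by
    rw [← add_sub_assoc, he, add_sub_cancel_right]
  have hpar : ((cornerOffset (startOf L.side L.sgn) - cornerOffset (startOf L'.side L'.sgn)).1 +
      (cornerOffset (startOf L.side L.sgn) - cornerOffset (startOf L'.side L'.sgn)).2) % 2 = 0 := by
    have e1 := congrArg Prod.fst hc
    have e2 := congrArg Prod.snd hc
    rw [Prod.fst_add] at e1
    rw [Prod.snd_add] at e2
    omega
  rcases key _ _ hpar with hq | ⟨hq, hodd⟩
  · rw [hq, sub_self, add_zero] at hc
    have hs : L.sgn = L'.sgn := by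
      rw [hc] at h3'
      rcases Int.units_eq_one_or L.sgn with e | e <;> rcases Int.units_eq_one_or L'.sgn with e' | e'
      · rw [e, e']
      · exact (Link.neg_one_ne_one (e'.symm.trans (h3'.2 (h3.1 e)))).elim
      · exact (Link.neg_one_ne_one (e.symm.trans (h3.2 (h3'.1 e')))).elim
      · rw [e, e']
    refine Link.ext hc.symm ?_ hs
    have := congrArg (fun q => sideOf q L.sgn) hq
    simp only [sideOf_startOf] at this
    rw [hs] at this
    rw [← this, sideOf_startOf]
  -- Opposite discs have different colours, so one is in `P` and the other is not, and the signs are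
  -- opposite. Then both links border the same gap, which would have to be both inside and outside.
  · have hbb : IsBlack L.cell ↔ ¬IsBlack L'.cell := by
      have e1 := congrArg Prod.fst hc
      rw [Prod.fst_add] at e1
      simp only [IsBlack]
      omega
    have hs : L'.sgn = -L.sgn := by
      rcases Int.units_eq_one_or L.sgn with e | e <;>
        rcases Int.units_eq_one_or L'.sgn with e' | e' <;> rw [e, e']
      · rw [e] at h3
        rw [e'] at h3'
        tauto
      · rfl
      · rw [e] at h3
        rw [e'] at h3'
        have := Link.neg_one_ne_one
        tauto
    rw [hs] at hq
    rw [hs, hq] at hc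
    have key2 : ∀ (s s' : ZMod 4) (ε : ℤˣ), startOf s' (-ε) = startOf s ε + 2 →
      s' = s + turn ε ∨ s' = s + turn (-ε) := by decide
    have key3 : ∀ (s s' : ZMod 4) (ε : ℤˣ), startOf s' (-ε) = startOf s ε + 2 →
      cornerOffset (startOf s ε) - cornerOffset (startOf s ε + 2) + dir s' = dir s := by decide
    have hg : L'.cell + dir L'.side = L.cell + dir L.side := by
      rw [hc, add_assoc, key3 _ _ _ hq]
    rw [hg] at h2'
    tauto

theorem arc_subset_face {o : ℂ} {d : ℤ × ℤ} (hd : (d.1 + d.2) % 2 = 0) (s : ZMod 4) :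
    arc o d s ⊆ face o d := fun _ h => Or.inl ⟨hd, h.1.le⟩

/-- Points on the same circle have the same parameters. Different circles meet only in joints; as
the final joint of each link is excluded, both parameters are `0` and the links have a common start.
-/
theorem IsBoundaryLink.eq_of_point_eq {P : Finset (ℤ × ℤ)} (hP : Sub P) {o : ℂ} {L L' : Link}
    (h : IsBoundaryLink P L) (h' : IsBoundaryLink P L') {s s' : ℝ} (hs : s ∈ Set.Ico 0 (Real.pi / 2))
    (hs' : s' ∈ Set.Ico 0 (Real.pi / 2)) (he : L.point o s = L'.point o s') : L = L' ∧ s = s' := by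
  have hq : ∀ q : ZMod 4, (q = 0 ∧ qcos q = 1 ∧ qsin q = 0) ∨ (q = 1 ∧ qcos q = 0 ∧ qsin q = 1) ∨
    (q = 2 ∧ qcos q = -1 ∧ qsin q = 0) ∨ (q = 3 ∧ qcos q = 0 ∧ qsin q = -1) := by decide
  have c1 : 0 < Real.cos s := Real.cos_pos_of_mem_Ioo ⟨by linarith [hs.1, Real.pi_pos], hs.2⟩
  have c2 : 0 < Real.cos s' := Real.cos_pos_of_mem_Ioo ⟨by linarith [hs'.1, Real.pi_pos], hs'.2⟩
  have c3 : 0 ≤ Real.sin s :=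
    Real.sin_nonneg_of_nonneg_of_le_pi hs.1 (by linarith [hs.2, Real.pi_pos])
  have c4 : 0 ≤ Real.sin s' :=
    Real.sin_nonneg_of_nonneg_of_le_pi hs'.1 (by linarith [hs'.2, Real.pi_pos])
  have hu := congrArg (cu o) he
  have hv := congrArg (cv o) he
  have hu' : cu o (L.point o s) = _ := cu_linkPoint _ _ _ _ _
  have hv' : cv o (L.point o s) = _ := cv_linkPoint _ _ _ _ _
  have hu2 : cu o (L'.point o s') = _ := cu_linkPoint _ _ _ _ _
  have hv2 : cv o (L'.point o s') = _ := cv_linkPoint _ _ _ _ _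
  rw [cast_val_zmod, cu_pt] at hu' hu2
  rw [cast_val_zmod, cv_pt] at hv' hv2
  by_cases hc : L.cell = L'.cell
  · have hsg : L.sgn = L'.sgn := by
      have e1 := h.2.2
      have e2 := h'.2.2
      rw [hc] at e1
      rcases Int.units_eq_one_or L.sgn with e | e <;> rcases Int.units_eq_one_or L'.sgn with e' | e'
      · rw [e, e']
      · exact (Link.neg_one_ne_one (e'.symm.trans (e2.2 (e1.1 e)))).elim
      · exact (Link.neg_one_ne_one (e.symm.trans (e1.2 (e2.1 e')))).elim
      · rw [e, e']
    rw [hu', hu2, hc, hsg, add_right_inj] at hu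
    rw [hv', hv2, hc, hsg, add_right_inj] at hv
    have key : startOf L.side L'.sgn = startOf L'.side L'.sgn ∧ Real.cos s = Real.cos s' := by
      generalize startOf L.side L'.sgn = q at *
      generalize startOf L'.side L'.sgn = q' at *
      rcases Int.units_eq_one_or L'.sgn with e | e <;> rw [e] at hu hv <;>
      rcases hq q with ⟨rfl, h2, h3⟩ | ⟨rfl, h2, h3⟩ | ⟨rfl, h2, h3⟩ | ⟨rfl, h2, h3⟩ <;>
      rcases hq q' with ⟨rfl, h4, h5⟩ | ⟨rfl, h4, h5⟩ | ⟨rfl, h4, h5⟩ | ⟨rfl, h4, h5⟩ <;>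
      simp only [h2, h3, h4, h5] at hu hv <;> push_cast at hu hv <;>
      first
        | exact ⟨rfl, by linarith⟩
        | (exfalso; linarith)
    refine ⟨Link.ext hc ?_ hsg, ?_⟩
    · have := congrArg (fun q => sideOf q L'.sgn) key.1
      simpa only [sideOf_startOf] using this
    · exact Real.injOn_cos ⟨hs.1, by linarith [hs.2, Real.pi_pos]⟩
        ⟨hs'.1, by linarith [hs'.2, Real.pi_pos]⟩ key.2
  · have hmem : ∀ (L : Link) (t : ℝ), t ∈ Set.Ico 0 (Real.pi / 2) → IsBoundaryLink P L →
        L.point o t ∈ face o L.cell := by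
      intro L t ht hL
      refine arc_subset_face hL.1 L.side ?_
      rw [← Link.image_point]
      exact Set.mem_image_of_mem _ ⟨ht.1, ht.2.le⟩
    have hzero : ∀ (q : ZMod 4) (ε : ℤˣ) (t : ℝ), t ∈ Set.Ico 0 (Real.pi / 2) →
        (qcos q * Real.cos t - qsin q * (((ε : ℤ) : ℝ) * Real.sin t)) *
        (qsin q * Real.cos t + qcos q * (((ε : ℤ) : ℝ) * Real.sin t)) = 0 → t = 0 := by
      intro q ε t ht h0
      have d1 : 0 < Real.cos t := Real.cos_pos_of_mem_Ioo ⟨by linarith [ht.1, Real.pi_pos], ht.2⟩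
      rcases ht.1.eq_or_lt with ht0 | ht0
      · exact ht0.symm
      · have d2 : 0 < Real.sin t := Real.sin_pos_of_pos_of_lt_pi ht0 (by linarith [ht.2, Real.pi_pos])
        have d3 := mul_pos d1 d2
        exfalso
        rcases Int.units_eq_one_or ε with rfl | rfl <;>
        rcases hq q with ⟨rfl, h2, h3⟩ | ⟨rfl, h2, h3⟩ | ⟨rfl, h2, h3⟩ | ⟨rfl, h2, h3⟩ <;>
        simp only [h2, h3] at h0 <;> push_cast at h0 <;> linarith
    have f1 := hmem L s hs h
    have f2 := hmem L' s' hs' h'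
    obtain ⟨⟨g1, -⟩, -⟩ := exists_gap_of_mem_face h.1 h'.1 hc f1 (he ▸ f2)
    obtain ⟨⟨g2, -⟩, -⟩ := exists_gap_of_mem_face h'.1 h.1 (Ne.symm hc) f2 (he ▸ f1)
    rw [hu', hv', add_sub_cancel_left, add_sub_cancel_left] at g1
    rw [hu2, hv2, add_sub_cancel_left, add_sub_cancel_left] at g2
    have z1 := hzero _ _ _ hs g1
    have z2 := hzero _ _ _ hs' g2
    rw [z1, z2, Link.point_zero_eq_iff] at he
    exact (hc (congrArg Link.cell (IsBoundaryLink.eq_of_start_eq hP h h' he))).elim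

/-- The parametrisation is the loop of `exists_loop_of_polyomino`, placed in the plane. -/
theorem isTangleOfLength_curve (o : ℂ) {Q : Finset (ℤ × ℤ)} (hQ : IsHoleFreePolyomino Q)
    (hS : Sub Q) : IsTangleOfLength (perimeter Q) (curve o Q) := by
  obtain ⟨L, hstep, hL, hinj, hsurj⟩ := exists_loop_of_polyomino hQ hS
  refine ⟨by have := four_le_perimeter (isHoleFree_nonempty hQ); omega, fun k => pt o (L k).cell,
    fun k => ((startOf (L k).side (L k).sgn).val : ℤ), fun k => (L k).sgn,
    fun k => ((Link.step_iff o _ _).1 (hstep k)).1, fun k => ((Link.step_iff o _ _).1 (hstep k)).2,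
    fun k k' s hs s' hs' he => ?_, ?_⟩
  · obtain ⟨h1, h2⟩ := IsBoundaryLink.eq_of_point_eq hS (hL k) (hL k') hs hs' he
    exact ⟨hinj h1, h2⟩
  · have h : ∀ k, linkPoint (pt o (L k).cell) ((startOf (L k).side (L k).sgn).val : ℤ) (L k).sgn ''
        Set.Icc 0 (Real.pi / 2) = arc o (L k).cell (L k).side := fun k => Link.image_point o (L k)
    simp only [h]
    ext z
    rw [Set.mem_iUnion]
    constructor
    · rintro ⟨d, s, hd, hds, hz⟩
      obtain ⟨k, rfl, rfl⟩ := hsurj d s hd hds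
      exact ⟨k, hz⟩
    · rintro ⟨k, hz⟩
      exact ⟨_, _, (hL k).1, (hL k).2.1, hz⟩

theorem curve_shift (o : ℂ) (v : ℤ × ℤ) (hv : (v.1 + v.2) % 2 = 0) (Q : Finset (ℤ × ℤ)) :
    curve o (shift v Q) = curve (pt o v) Q := by
  have harc : ∀ d s, arc o (d + v) s = arc (pt o v) d s := by
    intro d s
    simp only [arc, cu_pt_right, cv_pt_right, cellU_add, cellV_add, Int.cast_add, sub_sub,
      add_comm (cellU v : ℝ), add_comm (cellV v : ℝ)]
  ext z
  constructor
  · rintro ⟨d, s, hd, hQ, hz⟩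
    refine ⟨d - v, s, ?_, ?_, ?_⟩
    · rw [Prod.fst_sub, Prod.snd_sub]; omega
    · rw [mem_shift, mem_shift, add_sub_right_comm] at hQ
      exact hQ
    · rw [← harc, sub_add_cancel]; exact hz
  · rintro ⟨d, s, hd, hQ, hz⟩
    refine ⟨d + v, s, ?_, ?_, ?_⟩
    · rw [Prod.fst_add, Prod.snd_add]; omega
    · rw [mem_shift, mem_shift, add_right_comm, add_sub_cancel_right, add_sub_cancel_right]
      exact hQ
    · rw [harc]; exact hz

theorem pt_zero (o : ℂ) : pt o 0 = o := by
  simp [pt]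

/-- The midpoint of a quarter circle is at the same parameter for both orientations. It serves to
show that a simple curve does not use a side in both senses. -/
theorem Link.point_mid {o : ℂ} {L L' : Link} (hc : L.cell = L'.cell) (hs : L.side = L'.side) :
    L.point o (Real.pi / 4) = L'.point o (Real.pi / 4) := by
  have h : ∀ (s : ZMod 4) (ε : ℤˣ), qcos (startOf s ε) - qsin (startOf s ε) * ε = cellU (dir s) ∧
      qsin (startOf s ε) + qcos (startOf s ε) * ε = cellV (dir s) := by decide
  have key : ∀ L : Link,
      cu o (L.point o (Real.pi / 4)) = cellU L.cell + cellU (dir L.side) * (Real.sqrt 2 / 2) ∧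
      cv o (L.point o (Real.pi / 4)) = cellV L.cell + cellV (dir L.side) * (Real.sqrt 2 / 2) := by
    intro L
    have h1 := congrArg (fun z : ℤ => (z : ℝ)) (h L.side L.sgn).1
    have h2 := congrArg (fun z : ℤ => (z : ℝ)) (h L.side L.sgn).2
    push_cast at h1 h2
    rw [Link.point, cu_linkPoint, cv_linkPoint, cast_val_zmod, cu_pt, cv_pt, Real.cos_pi_div_four,
      Real.sin_pi_div_four, ← h1, ← h2]
    constructor <;> ring
  apply uv_ext (o := o)
  · rw [(key L).1, (key L').1, hc, hs]
  · rw [(key L).2, (key L').2, hc, hs]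

/-- The converse of `isTangleOfLength_curve`: a Tangle is read as a loop of links, and the discrete
Jordan curve theorem fills it. -/
theorem exists_curve_of_isTangleOfLength {n : ℕ} {Γ : Set ℂ} (h : IsTangleOfLength n Γ) :
    ∃ o Q, IsHoleFreePolyomino Q ∧ Sub Q ∧ perimeter Q = n ∧ Γ = curve o Q := by
  obtain ⟨hn, c, j, ε, hjoint, htan, hsimple, rfl⟩ := h
  have : NeZero n := ⟨hn.ne'⟩
  -- By smoothness each circle equals or kisses the previous one, so all centres lie in the packing
  -- through the first.
  have hD : ∀ k, ∃ D : ℤ × ℤ, c k = pt (c 0) D ∧ (D.1 + D.2) % 2 = 0 := by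
    refine forall_zmod_of_step ⟨0, (pt_zero _).symm, rfl⟩ ?_
    rintro k ⟨D, hD, hpar⟩
    have h1 := hjoint k
    have h2 := htan k
    rw [linkTangent_eq_tangent (d := D), linkTangent_eq_tangent (d := D),
      Link.tangent_eq_iff] at h2
    rw [hD, linkPoint_eq_point] at h1
    have fin : ∀ D' : ℤ × ℤ, Link.Step ⟨D, sideOf (j k) (ε k), ε k⟩
        ⟨D', sideOf (j (k + 1)) (ε (k + 1)), ε (k + 1)⟩ → c (k + 1) = pt (c 0) D' := by
      intro D' hstep
      have h3 := ((Link.step_iff (c 0) _ _).1 hstep).1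
      rw [h1, ← linkPoint_eq_point] at h3
      exact add_right_cancel h3
    rcases h2 with h2 | h2
    · exact ⟨D, fin D (Or.inl ⟨rfl, h2⟩), hpar⟩
    · exact ⟨_, fin _ (Or.inr ⟨rfl, h2⟩), parity_dir_dir _ _ _ hpar⟩
  choose D hD hpar using hD
  generalize c 0 = o at hD
  let L : ZMod n → Link := fun k => ⟨D k, sideOf (j k) (ε k), ε k⟩
  have hL : ∀ k, linkPoint (c k) (j k) (ε k) = (L k).point o := by
    intro k
    rw [hD, linkPoint_eq_point]
  have hstep : ∀ k, (L k).Step (L (k + 1)) := by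
    intro k
    refine (Link.step_iff o _ _).2 ⟨?_, ?_⟩
    · rw [← hL, ← hL]
      exact hjoint k
    · have := htan k
      rwa [linkTangent_eq_tangent (d := D k), linkTangent_eq_tangent (d := D (k + 1))] at this
  simp only [hL] at hsimple ⊢
  have hpi := Real.pi_pos
  have hstart : Function.Injective fun k => (L k).start := by
    intro k k' h
    exact (hsimple k k' 0 ⟨le_rfl, by linarith⟩ 0 ⟨le_rfl, by linarith⟩
      ((Link.point_zero_eq_iff o _ _).2 h)).1
  have hinj : ∀ k k', (L k).cell = (L k').cell → (L k).side = (L k').side → k = k' := by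
    intro k k' h1 h2
    exact (hsimple k k' (Real.pi / 4) ⟨by linarith, by linarith⟩ (Real.pi / 4)
      ⟨by linarith, by linarith⟩ (Link.point_mid h1 h2)).1
  obtain ⟨P, hP, hedge⟩ := exists_polyomino_of_loop hstep hpar hstart hinj
  have hper : perimeter P = n := by
    rw [perimeter_eq_card_of_sides (fun k => (L k).cell) (fun k => (L k).side) hpar hinj
      (fun k => (hedge _ _).1 ⟨k, Or.inl ⟨rfl, rfl⟩⟩)
      fun x t hx ht => (isEdge_iff hpar hx t).1 ((hedge x t).2 ht), ZMod.card]
  have hcurve : (⋃ k, (L k).point o '' Set.Icc 0 (Real.pi / 2)) = curve o P := by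
    simp only [Link.image_point]
    ext z
    rw [Set.mem_iUnion]
    constructor
    · rintro ⟨k, hz⟩
      exact ⟨_, _, hpar k, (hedge _ _).1 ⟨k, Or.inl ⟨rfl, rfl⟩⟩, hz⟩
    · rintro ⟨d, s, hd, hds, hz⟩
      obtain ⟨k, rfl, rfl⟩ := (isEdge_iff hpar hd s).1 ((hedge d s).2 hds)
      exact ⟨k, hz⟩
  rw [hcurve]
  rcases sub_or_sub_shift hstep hpar hstart hedge with hS | hS
  · exact ⟨o, P, hP, hS, hper, rfl⟩
  -- The origin moves against the shift, so the curve is unchanged.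
  · refine ⟨pt o (-1, -1), shift (1, 1) P, isHoleFree_shift hP _, hS, ?_, ?_⟩
    · rw [perimeter_shift, hper]
    · rw [curve_shift _ _ rfl, ← pt_add]
      exact congrArg (fun o => curve o P) (pt_zero o).symm


/-! ### The circles of a Tangle -/

/-- With `w = z - c` and `δ = d - c`, eliminating the conjugate of `w` from the two equations gives
`δ̄ w² - δ̄ δ w + δ = 0`, a nonzero polynomial equation. -/
theorem sphere_inter_sphere_finite {c d : ℂ} (h : c ≠ d) :
    (Metric.sphere c 1 ∩ Metric.sphere d 1).Finite := by
  let p : Polynomial ℂ := Polynomial.C (starRingEnd ℂ (d - c)) * Polynomial.X ^ 2 -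
    Polynomial.C ((starRingEnd ℂ (d - c)) * (d - c)) * Polynomial.X + Polynomial.C (d - c)
  have hp : p ≠ 0 := by
    intro h0
    have := congrArg (fun q => Polynomial.eval 0 q) h0
    simp only [p, Polynomial.eval_add, Polynomial.eval_sub, Polynomial.eval_mul, Polynomial.eval_C,
      Polynomial.eval_pow, Polynomial.eval_X, Polynomial.eval_zero] at this
    exact h (sub_eq_zero.1 (by simpa using this)).symm
  refine ((p.rootSet_finite ℂ).preimage (f := fun z => z - c)
    (sub_left_injective.injOn)).subset ?_
  rintro z ⟨h1, h2⟩
  rw [mem_sphere_iff_norm] at h1 h2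
  have e1 : (z - c) * starRingEnd ℂ (z - c) = 1 := by
    rw [Complex.mul_conj, Complex.normSq_eq_norm_sq, h1]; simp
  have e2 : (z - d) * starRingEnd ℂ (z - d) = 1 := by
    rw [Complex.mul_conj, Complex.normSq_eq_norm_sq, h2]; simp
  rw [Set.mem_preimage, Polynomial.mem_rootSet]
  refine ⟨hp, ?_⟩
  simp only [p, map_add, map_sub, map_mul, map_pow, Polynomial.aeval_X, Polynomial.aeval_C,
    Algebra.algebraMap_self, RingHom.id_apply]
  simp only [map_sub] at e1 e2
  linear_combination (z - d) * e1 - (z - c) * e2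

theorem arc_subset_sphere (o : ℂ) (d : ℤ × ℤ) (s : ZMod 4) : arc o d s ⊆ Metric.sphere (pt o d) 1 := by
  rintro z ⟨h, -⟩
  have h1 := dist_sq o z (pt o d)
  rw [cu_pt, cv_pt, h] at h1
  rw [Metric.mem_sphere]
  exact (pow_eq_one_iff_of_nonneg dist_nonneg two_ne_zero).1 h1

theorem arc_subset_curve {o : ℂ} {Q : Finset (ℤ × ℤ)} {d : ℤ × ℤ} {s : ZMod 4}
    (hd : (d.1 + d.2) % 2 = 0) (hQ : d ∈ Q ↔ d + dir s ∉ Q) : arc o d s ⊆ curve o Q :=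
  fun _ hz => ⟨d, s, hd, hQ, hz⟩

theorem curve_subset_biUnion (o : ℂ) (Q : Finset (ℤ × ℤ)) :
    curve o Q ⊆ ⋃ L ∈ {L | IsBoundaryLink Q L}, arc o L.cell L.side := by
  rintro z ⟨d, s, hd, hQ, hz⟩
  by_cases h : d ∈ Q
  · refine Set.mem_biUnion (x := (⟨d, s, 1⟩ : Link)) ⟨hd, hQ, ?_⟩ hz
    exact iff_of_true rfl h
  · refine Set.mem_biUnion (x := (⟨d, s, -1⟩ : Link)) ⟨hd, hQ, ?_⟩ hz
    exact iff_of_false Link.neg_one_ne_one h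

/-- A circle that has infinitely many points in common with the curve is the circle of a link. -/
theorem exists_arc_of_infinite {o c : ℂ} {Q : Finset (ℤ × ℤ)}
    (h : (Metric.sphere c 1 ∩ curve o Q).Infinite) :
    ∃ d s, c = pt o d ∧ (d.1 + d.2) % 2 = 0 ∧ (d ∈ Q ↔ d + dir s ∉ Q) := by
  by_contra! hcon
  refine h (((finite_isBoundaryLink Q).biUnion (t := fun L => Metric.sphere c 1 ∩
    arc o L.cell L.side) fun L hL => ?_).subset ?_)
  · refine (sphere_inter_sphere_finite (c := c) (d := pt o L.cell) fun hc => ?_).subset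
      (Set.inter_subset_inter_right _ (arc_subset_sphere o _ _))
    have := hcon L.cell L.side hc hL.1
    have := hL.2.1
    tauto
  · rintro z ⟨h1, h2⟩
    have h3 := curve_subset_biUnion o Q h2
    rw [Set.mem_iUnion₂] at h3 ⊢
    obtain ⟨L, hL, hz⟩ := h3
    exact ⟨L, hL, h1, hz⟩

/-- Having infinitely many points on the curve is what singles out the circles of links: other unit
circles meet each link in finitely many points. -/
theorem IsLinkCenter.infinite {Γ : Set ℂ} {c : ℂ} (h : IsLinkCenter Γ c) :
    (Metric.sphere c 1 ∩ Γ).Infinite := by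
  obtain ⟨j, hj⟩ := h
  have hpi := Real.pi_pos
  have hinj : Set.InjOn (linkPoint c j 1) (Set.Icc 0 (Real.pi / 2)) := by
    intro s hs t ht he
    have hu := congrArg (cu 0) he
    have hv := congrArg (cv 0) he
    rw [cu_linkPoint, cu_linkPoint] at hu
    rw [cv_linkPoint, cv_linkPoint] at hv
    have h1 : ∀ q, qcos q ^ 2 + qsin q ^ 2 = 1 := by decide
    have h2 : (qcos j : ℝ) ^ 2 + (qsin j : ℝ) ^ 2 = 1 := by exact_mod_cast h1 j
    refine Real.injOn_cos ⟨hs.1, by linarith [hs.2]⟩ ⟨ht.1, by linarith [ht.2]⟩ ?_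
    simp only [Units.val_one, Int.cast_one, one_mul] at hu hv
    linear_combination (qcos j : ℝ) * hu + (qsin j : ℝ) * hv - (Real.cos s - Real.cos t) * h2
  refine ((Set.Icc_infinite (by linarith : (0 : ℝ) < Real.pi / 2)).image hinj).mono ?_
  rintro _ ⟨s, hs, rfl⟩
  refine ⟨?_, hj s hs⟩
  rw [mem_sphere_iff_norm, linkPoint, add_sub_cancel_left, Complex.norm_exp_ofReal_mul_I]

theorem isLinkCenter_curve {o : ℂ} {Q : Finset (ℤ × ℤ)} {d : ℤ × ℤ} {s : ZMod 4}
    (hd : (d.1 + d.2) % 2 = 0) (hQ : d ∈ Q ↔ d + dir s ∉ Q) :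
    IsLinkCenter (curve o Q) (pt o d) := by
  refine ⟨(s.val : ℤ), fun t ht => ?_⟩
  refine arc_subset_curve hd hQ ?_
  have h := linkPoint_image o d (s.val : ℤ) 1
  rw [cast_val_zmod, sideOf, if_pos rfl] at h
  rw [← h]
  exact Set.mem_image_of_mem _ ht

/-! ### Recovering the packing and its colours from the curve -/

section Packing

variable {o : ℂ} {Q : Finset (ℤ × ℤ)}

theorem exists_black_center (hQ : IsHoleFreePolyomino Q) (hS : Sub Q) :
    ∃ d ∈ Q, IsBlack d ∧ IsLinkCenter (curve o Q) (pt o d) := by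
  obtain ⟨p, hp, hl⟩ := exists_last (isHoleFree_nonempty hQ)
  have hb := hS.isBlack_last hp hl
  refine ⟨p, hp, hb, isLinkCenter_curve (s := 3) (by have := hb.1; have := hb.2; omega) ?_⟩
  refine iff_of_true hp fun h => ?_
  have := hl _ h
  rw [dir_three] at this
  simp only [Prod.fst_add, Prod.snd_add] at this
  omega

theorem exists_of_isLinkCenter_inside (hQ : IsHoleFreePolyomino Q) (hS : Sub Q) {c : ℂ}
    (h : IsLinkCenter (curve o Q) c) (h' : c ∈ inside (curve o Q)) :
    ∃ d ∈ Q, IsBlack d ∧ c = pt o d := by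
  obtain ⟨d, s, rfl, hd, hs⟩ := exists_arc_of_infinite h.infinite
  rw [pt_mem_inside_iff hQ] at h'
  exact ⟨d, h', (hS.mem_iff_isBlack hd hs).1 h', rfl⟩

/-- The circles of links with centre inside are black discs of `Q`, and at least one exists. So the
packing built from any of them is the original one. -/
theorem packingCenters_curve (hQ : IsHoleFreePolyomino Q) (hS : Sub Q) :
    packingCenters (curve o Q) = pt o '' {x | (x.1 + x.2) % 2 = 0} := by
  ext z
  constructor
  · rintro ⟨c, h1, h2, a, b, hab, rfl⟩
    obtain ⟨d, hd, hb, rfl⟩ := exists_of_isLinkCenter_inside hQ hS h1 h2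
    refine ⟨d + (a, b), ?_, pt_add o d (a, b)⟩
    have := hb.1
    have := hb.2
    have := Int.even_iff.1 hab
    simp only [Set.mem_ofPred_eq, Prod.fst_add, Prod.snd_add]
    omega
  · rintro ⟨x, hx, rfl⟩
    obtain ⟨d, hd, hb, hl⟩ := exists_black_center (o := o) hQ hS
    refine ⟨_, hl, (pt_mem_inside_iff hQ d).2 hd, x.1 - d.1, x.2 - d.2, ?_, ?_⟩
    · have := hb.1
      have := hb.2
      rw [Set.mem_ofPred_eq] at hx
      rw [Int.even_iff]
      omega
    · have := pt_add o d (x.1 - d.1, x.2 - d.2)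
      rw [show d + (x.1 - d.1, x.2 - d.2) = x by ext <;> simp] at this
      exact this

theorem blackCenters_curve (hQ : IsHoleFreePolyomino Q) (hS : Sub Q) :
    blackCenters (curve o Q) = pt o '' {x | IsBlack x} := by
  ext z
  constructor
  · rintro ⟨c, h1, h2, a, b, ha, hb', rfl⟩
    obtain ⟨d, hd, hb, rfl⟩ := exists_of_isLinkCenter_inside hQ hS h1 h2
    refine ⟨d + (a, b), ?_, pt_add o d (a, b)⟩
    have := hb.1
    have := hb.2
    have := Int.even_iff.1 ha
    have := Int.even_iff.1 hb'
    simp only [Set.mem_ofPred_eq, IsBlack, Prod.fst_add, Prod.snd_add]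
    omega
  · rintro ⟨x, hx, rfl⟩
    obtain ⟨d, hd, hb, hl⟩ := exists_black_center (o := o) hQ hS
    have := hb.1
    have := hb.2
    rw [Set.mem_ofPred_eq] at hx
    have := hx.1
    have := hx.2
    refine ⟨_, hl, (pt_mem_inside_iff hQ d).2 hd, x.1 - d.1, x.2 - d.2, ?_, ?_, ?_⟩
    · rw [Int.even_iff]
      omega
    · rw [Int.even_iff]
      omega
    · have := pt_add o d (x.1 - d.1, x.2 - d.2)
      rw [show d + (x.1 - d.1, x.2 - d.2) = x by ext <;> simp] at this
      exact this

theorem mem_dualVertices_iff (hQ : IsHoleFreePolyomino Q) (hS : Sub Q) {z : ℂ} :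
    z ∈ dualVertices (curve o Q) ↔ ∃ x ∈ Q, IsBlack x ∧ z = pt o x := by
  rw [dualVertices, blackCenters_curve hQ hS]
  constructor
  · rintro ⟨⟨x, hx, rfl⟩, h⟩
    exact ⟨x, (pt_mem_inside_iff hQ x).1 h, hx, rfl⟩
  · rintro ⟨x, hx, hb, rfl⟩
    exact ⟨⟨x, hb, rfl⟩, (pt_mem_inside_iff hQ x).2 hx⟩

end Packing

/-! ### The edges of the dual graph -/

theorem exists_even_near (r : ℝ) : ∃ e : ℤ, e % 2 = 0 ∧ |r - e| ≤ 1 := by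
  refine ⟨2 * ⌊(r + 1) / 2⌋, by omega, ?_⟩
  have h1 := Int.floor_le ((r + 1) / 2)
  have h2 := Int.lt_floor_add_one ((r + 1) / 2)
  rw [abs_le]
  push_cast
  constructor <;> linarith

/-- If the segment between the centres of two black discs meets no other disc, then the discs are
separated by a single gap. -/
theorem exists_dir_of_segment {o : ℂ} {x y : ℤ × ℤ} (hx : IsBlack x) (hy : IsBlack y) (hne : x ≠ y)
    (h : ∀ d : ℤ × ℤ, (d.1 + d.2) % 2 = 0 → d ≠ x → d ≠ y →
      Disjoint (segment ℝ (pt o x) (pt o y)) (Metric.closedBall (pt o d) 1)) :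
    ∃ s, y = x + dir s + dir s := by
  have key : ∀ (t : ℝ) (u v : ℤ), 0 ≤ t → t ≤ 1 → u % 2 = 0 → v % 2 = 0 →
      (t * (cellU y - cellU x) - u) ^ 2 + (t * (cellV y - cellV x) - v) ^ 2 ≤ 1 →
      (u = 0 ∧ v = 0) ∨ (u = cellU y - cellU x ∧ v = cellV y - cellV x) := by
    intro t u v h0 h1 hu hv hle
    have p1 : cellU x % 2 = 0 := by simp only [cellU]; have := hx.1; have := hx.2; omega
    have p2 := cell_parity x
    obtain ⟨d, d1, d2⟩ := exists_cell (u := cellU x + u) (v := cellV x + v) (by omega)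
    by_contra! hcon
    have hdx : d ≠ x := fun e => by
      rw [e] at d1 d2
      exact hcon.1 (by omega) (by omega)
    have hdy : d ≠ y := fun e => by
      rw [e] at d1 d2
      exact hcon.2 (by omega) (by omega)
    have hpar : (d.1 + d.2) % 2 = 0 := by
      have : cellU d % 2 = 0 := by omega
      exact this
    refine Set.disjoint_left.1 (h d hpar hdx hdy)
      (?_ : AffineMap.lineMap (pt o x) (pt o y) t ∈ segment ℝ (pt o x) (pt o y)) ?_
    · rw [segment_eq_image_lineMap]
      exact Set.mem_image_of_mem _ ⟨h0, h1⟩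
    · have e := dist_sq o (AffineMap.lineMap (pt o x) (pt o y) t) (pt o d)
      rw [cu_lineMap, cv_lineMap, cu_pt, cv_pt, cu_pt, cv_pt, cu_pt, cv_pt, d1, d2] at e
      rw [Metric.mem_closedBall]
      push_cast at e
      refine (abs_le_one_iff_mul_self_le_one.2 ?_ : |_| ≤ (1 : ℝ)) |> le_trans (le_abs_self _)
      nlinarith
  -- On a longer segment, the parameter `2 / |ΔU|` gives a point at `U`-distance `2` from `x`. The
  -- disc centres on that line are `2` apart, so one is within distance `1`, and it belongs to
  -- neither end.
  have hU : ¬4 ≤ |cellU y - cellU x| := by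
    intro h4
    obtain ⟨e, he, hle⟩ := exists_even_near
      (2 / |((cellU y - cellU x : ℤ) : ℝ)| * (cellV y - cellV x))
    have h4' : (4 : ℝ) ≤ |((cellU y - cellU x : ℤ) : ℝ)| := by exact_mod_cast h4
    have hσ : ∃ σ : ℤ, (σ = 2 ∨ σ = -2) ∧
        2 / |((cellU y - cellU x : ℤ) : ℝ)| * (cellU y - cellU x) = σ := by
      rcases le_total 0 (cellU y - cellU x) with hs | hs
      · refine ⟨2, Or.inl rfl, ?_⟩
        rw [← Int.cast_abs, abs_of_nonneg hs] at h4' ⊢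
        rw [← Int.cast_sub, div_mul_cancel₀ _ (by linarith)]
        norm_num
      · refine ⟨-2, Or.inr rfl, ?_⟩
        rw [← Int.cast_abs, abs_of_nonpos hs] at h4' ⊢
        rw [← Int.cast_sub, Int.cast_neg, div_neg, neg_mul,
          div_mul_cancel₀ _ (by rw [Int.cast_neg] at h4'; linarith)]
        norm_num
    obtain ⟨σ, hσ, hσe⟩ := hσ
    have := key (2 / |((cellU y - cellU x : ℤ) : ℝ)|) σ e (by positivity)
      (by rw [div_le_one (by linarith)]; linarith) (by omega) he (by
        rw [hσe, sub_self]
        have := abs_le_one_iff_mul_self_le_one.1 hle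
        nlinarith)
    rcases this with ⟨h1, -⟩ | ⟨h1, -⟩
    · omega
    · rw [← h1] at h4
      rcases hσ with rfl | rfl <;> norm_num at h4
  have hV : ¬4 ≤ |cellV y - cellV x| := by
    intro h4
    obtain ⟨e, he, hle⟩ := exists_even_near
      (2 / |((cellV y - cellV x : ℤ) : ℝ)| * (cellU y - cellU x))
    have h4' : (4 : ℝ) ≤ |((cellV y - cellV x : ℤ) : ℝ)| := by exact_mod_cast h4
    have hσ : ∃ σ : ℤ, (σ = 2 ∨ σ = -2) ∧
        2 / |((cellV y - cellV x : ℤ) : ℝ)| * (cellV y - cellV x) = σ := by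
      rcases le_total 0 (cellV y - cellV x) with hs | hs
      · refine ⟨2, Or.inl rfl, ?_⟩
        rw [← Int.cast_abs, abs_of_nonneg hs] at h4' ⊢
        rw [← Int.cast_sub, div_mul_cancel₀ _ (by linarith)]
        norm_num
      · refine ⟨-2, Or.inr rfl, ?_⟩
        rw [← Int.cast_abs, abs_of_nonpos hs] at h4' ⊢
        rw [← Int.cast_sub, Int.cast_neg, div_neg, neg_mul,
          div_mul_cancel₀ _ (by rw [Int.cast_neg] at h4'; linarith)]
        norm_num
    obtain ⟨σ, hσ, hσe⟩ := hσ
    have := key (2 / |((cellV y - cellV x : ℤ) : ℝ)|) e σ (by positivity)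
      (by rw [div_le_one (by linarith)]; linarith) he (by omega) (by
        rw [hσe, sub_self]
        have := abs_le_one_iff_mul_self_le_one.1 hle
        nlinarith)
    rcases this with ⟨-, h1⟩ | ⟨-, h1⟩
    · omega
    · rw [← h1] at h4
      rcases hσ with rfl | rfl <;> norm_num at h4
  rw [not_le, abs_lt] at hU hV
  have b1 := hx.1
  have b2 := hx.2
  have b3 := hy.1
  have b4 := hy.2
  have hne' : ¬(x.1 = y.1 ∧ x.2 = y.2) := fun e => hne (Prod.ext e.1 e.2)
  simp only [cellU, cellV] at hU hV
  -- Grid coordinates of black cells differ by even numbers; as their sum and difference are below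
  -- `4`, one difference is `0` and the other is `2` or `-2`.
  have h5 : (y.1 = x.1 ∧ y.2 = x.2 + 2) ∨ (y.1 = x.1 - 2 ∧ y.2 = x.2) ∨
      (y.1 = x.1 ∧ y.2 = x.2 - 2) ∨ (y.1 = x.1 + 2 ∧ y.2 = x.2) := by omega
  rcases h5 with h5 | h5 | h5 | h5
  · exact ⟨0, by ext <;> simp only [dir_zero, Prod.fst_add, Prod.snd_add] <;> omega⟩
  · exact ⟨1, by ext <;> simp only [dir_one, Prod.fst_add, Prod.snd_add] <;> omega⟩
  · exact ⟨2, by ext <;> simp only [dir_two, Prod.fst_add, Prod.snd_add] <;> omega⟩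
  · exact ⟨3, by ext <;> simp only [dir_three, Prod.fst_add, Prod.snd_add] <;> omega⟩

section DualGraph

variable {o : ℂ} {Q : Finset (ℤ × ℤ)}

theorem adj_of_gap (hQ : IsHoleFreePolyomino Q) (hS : Sub Q) {x : ℤ × ℤ} {s : ZMod 4} (hx : IsBlack x)
    (hg : x + dir s ∈ Q) : (dualGraph (curve o Q)).Adj (pt o x) (pt o (x + dir s + dir s)) := by
  have hxQ := (hS x s).1 hx hg
  have hy : IsBlack (x + dir s + dir s) := by
    simp only [IsBlack, Prod.fst_add, Prod.snd_add] at hx ⊢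
    omega
  have hyQ : x + dir s + dir s ∈ Q := (hS _ (s + 2)).1 hy (by rwa [add_dir_add_dir_two])
  have hpar : (x.1 + x.2) % 2 = 0 := by have := hx.1; have := hx.2; omega
  have e1 := (dir_uv s).1
  refine ⟨fun e => ?_, (mem_dualVertices_iff hQ hS).2 ⟨x, hxQ, hx, rfl⟩,
    (mem_dualVertices_iff hQ hS).2 ⟨_, hyQ, hy, rfl⟩, ?_, ?_⟩
  · have := congrArg cellU (pt_injective o e)
    rw [cellU_add, cellU_add] at this
    omega
  · rw [segment_eq_image_lineMap, Set.disjoint_left]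
    rintro _ ⟨t, ⟨h0, h1⟩, rfl⟩ hz
    rcases le_total t (1 / 2) with ht | ht
    · refine Set.disjoint_left.1 (segment_disjoint_curve (o := o) (iff_of_true hxQ hg)) ?_ hz
      rw [segment_eq_image_lineMap]
      refine ⟨2 * t, ⟨by linarith, by linarith⟩, uv_ext (o := o) ?_ ?_⟩
      · simp only [cu_lineMap, cu_pt, cellU_add]; push_cast; ring
      · simp only [cv_lineMap, cv_pt, cellV_add]; push_cast; ring
    · refine Set.disjoint_left.1 (segment_disjoint_curve (o := o) (iff_of_true hg hyQ)) ?_ hz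
      rw [segment_eq_image_lineMap]
      refine ⟨2 * t - 1, ⟨by linarith, by linarith⟩, uv_ext (o := o) ?_ ?_⟩
      · simp only [cu_lineMap, cu_pt, cellU_add]; push_cast; ring
      · simp only [cv_lineMap, cv_pt, cellV_add]; push_cast; ring
  · intro c hc hcx hcy
    rw [packingCenters_curve hQ hS] at hc
    obtain ⟨d, hd, rfl⟩ := hc
    rw [segment_eq_image_lineMap, Set.disjoint_left]
    rintro _ ⟨t, ⟨h0, h1⟩, rfl⟩ hz
    rw [Metric.mem_closedBall] at hz
    have h2 := dist_sq o (AffineMap.lineMap (pt o x) (pt o (x + dir s + dir s)) t) (pt o d)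
    rw [cu_pt, cv_pt] at h2
    have h3 : dist (AffineMap.lineMap (pt o x) (pt o (x + dir s + dir s)) t) (pt o d) ^ 2 ≤ 1 :=
      pow_le_one₀ dist_nonneg hz
    rw [h2] at h3
    rcases eq_of_mem_ray (t := 2 * t) hpar hd (by linarith) (by linarith)
      (by rw [cu_lineMap, cu_pt, cu_pt, cellU_add, cellU_add]; push_cast; ring)
      (by rw [cv_lineMap, cv_pt, cv_pt, cellV_add, cellV_add]; push_cast; ring) h3 with h4 | h4
    · exact hcx (by rw [h4])
    · exact hcy (by rw [h4])

theorem exists_gap_of_adj (hQ : IsHoleFreePolyomino Q) (hS : Sub Q) {z w : ℂ}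
    (h : (dualGraph (curve o Q)).Adj z w) :
    ∃ x s, IsBlack x ∧ x + dir s ∈ Q ∧ z = pt o x ∧ w = pt o (x + dir s + dir s) := by
  obtain ⟨hne, hz, hw, hseg, hball⟩ := h
  obtain ⟨x, hxQ, hx, rfl⟩ := (mem_dualVertices_iff hQ hS).1 hz
  obtain ⟨y, hyQ, hy, rfl⟩ := (mem_dualVertices_iff hQ hS).1 hw
  obtain ⟨s, rfl⟩ := exists_dir_of_segment (o := o) hx hy (fun e => hne (by rw [e]))
    fun d hd h1 h2 => hball _ (by rw [packingCenters_curve hQ hS]; exact ⟨d, hd, rfl⟩)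
      (fun e => h1 (pt_injective o e)) fun e => h2 (pt_injective o e)
  refine ⟨x, s, hx, ?_, rfl, rfl⟩
  by_contra hg
  have hs2 := sqrt_two_sq
  have hs0 := sqrt_two_pos
  have hs1 : Real.sqrt 2 ≤ 4 := by nlinarith
  -- The segment has length `2 √2`, so `√2 / 4` is the parameter at which it leaves the disc `x`. If
  -- the gap were outside `Q`, this point would lie on a link.
  refine Set.disjoint_left.1 hseg (?_ : AffineMap.lineMap (pt o x) (pt o (x + dir s + dir s))
    (Real.sqrt 2 / 4) ∈ segment ℝ (pt o x) (pt o (x + dir s + dir s))) ⟨x, s, ?_, iff_of_true hxQ hg, ?_⟩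
  · rw [segment_eq_image_lineMap]
    exact Set.mem_image_of_mem _ ⟨by positivity, by linarith⟩
  · have := hx.1; have := hx.2; omega
  · obtain ⟨e1, e2⟩ := dir_uv s
    simp only [arc, Set.mem_ofPred_eq, cu_lineMap, cv_lineMap, cu_pt, cv_pt, cellU_add, cellV_add]
    push_cast
    have hU : ((cellU (dir s) : ℤ) : ℝ) ^ 2 = 1 := by rcases e1 with e | e <;> rw [e] <;> norm_num
    have hV : ((cellV (dir s) : ℤ) : ℝ) ^ 2 = 1 := by rcases e2 with e | e <;> rw [e] <;> norm_num
    refine ⟨?_, ?_, ?_⟩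
    · linear_combination (Real.sqrt 2 ^ 2 / 4) * hU + (Real.sqrt 2 ^ 2 / 4) * hV + (1 / 2) * hs2
    · refine (by positivity : 0 ≤ Real.sqrt 2 / 2).trans_eq ?_
      linear_combination (-Real.sqrt 2 / 2) * hU
    · refine (by positivity : 0 ≤ Real.sqrt 2 / 2).trans_eq ?_
      linear_combination (-Real.sqrt 2 / 2) * hV

/-- A direction in which the gap `g` has a black neighbour. -/
def blackDir (g : ℤ × ℤ) : ZMod 4 := if g.1 % 2 = 1 then 3 else 0

theorem isBlack_blackDir {g : ℤ × ℤ} (hg : IsGap g) : IsBlack (g + dir (blackDir g)) := by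
  rw [IsGap] at hg
  rw [blackDir]
  split_ifs with h
  · simp only [IsBlack, dir_three, Prod.fst_add, Prod.snd_add]; omega
  · simp only [IsBlack, dir_zero, Prod.fst_add, Prod.snd_add]; omega

theorem blackDir_eq {x : ℤ × ℤ} (hx : IsBlack x) (s : ZMod 4) :
    blackDir (x + dir s) = s ∨ blackDir (x + dir s) = s + 2 := by
  have h1 := hx.1
  rw [blackDir]
  revert s
  refine forall_side.2 ⟨?_, ?_, ?_, ?_⟩
  · exact Or.inl (if_neg (by simp only [dir_zero, Prod.fst_add]; omega))
  · exact Or.inr (if_pos (by simp only [dir_one, Prod.fst_add]; omega))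
  · exact Or.inr (if_neg (by simp only [dir_two, Prod.fst_add]; omega))
  · exact Or.inl (if_pos (by simp only [dir_three, Prod.fst_add]; omega))

/-- An edge passes through exactly one gap, which must be in `Q`; conversely a gap in `Q` has its
two black neighbours in `Q`, by `Sub`. -/
theorem edgeSet_dualGraph (hQ : IsHoleFreePolyomino Q) (hS : Sub Q) :
    (dualGraph (curve o Q)).edgeSet =
      (fun g => s(pt o (g + dir (blackDir g)), pt o (g + dir (blackDir g + 2)))) ''
        (Q.filter IsGap : Finset (ℤ × ℤ)) := by
  ext e
  induction e using Sym2.ind with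
  | _ z w =>
  rw [SimpleGraph.mem_edgeSet]
  constructor
  · intro h
    obtain ⟨x, s, hx, hg, rfl, rfl⟩ := exists_gap_of_adj hQ hS h
    refine ⟨x + dir s, ?_, ?_⟩
    · have := parity_dir x s (by have := hx.1; have := hx.2; omega)
      simpa [IsGap] using ⟨hg, this⟩
    · rcases blackDir_eq hx s with h | h
      · simp only [h, add_dir_add_dir_two]
        exact Sym2.eq_swap
      · simp only [h, add_dir_add_dir_two, side_four]
  · rintro ⟨g, hg, he⟩
    rw [Finset.mem_coe, Finset.mem_filter] at hg
    have hb := isBlack_blackDir hg.2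
    have h := adj_of_gap (o := o) (s := blackDir g + 2) hQ hS hb
      (by rw [add_dir_add_dir_two]; exact hg.1)
    rw [add_dir_add_dir_two] at h
    rw [← SimpleGraph.mem_edgeSet] at h ⊢
    rwa [← he]

/-- Edges correspond to gaps bijectively, a gap being the midpoint of its edge, and `Sub.card_eq`
expresses the area by the number of gaps. -/
theorem size_curve (hQ : IsHoleFreePolyomino Q) (hS : Sub Q) :
    Q.card = 2 * size (curve o Q) + 1 := by
  rw [(hS.card_eq hQ).1, size, edgeSet_dualGraph hQ hS, Set.ncard_image_of_injective,
    Set.ncard_coe_finset]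
  intro g g' h
  have hsum : ∀ g : ℤ × ℤ, (g + dir (blackDir g)) + (g + dir (blackDir g + 2)) = g + g := by
    intro g
    rw [add_add_add_comm, ← add_assoc, add_assoc (g + g), ← add_assoc, add_dir_add_dir_two]
  have h2 : g + g = g' + g' := by
    rw [← hsum g, ← hsum g']
    rcases Sym2.eq_iff.1 h with ⟨h1, h2⟩ | ⟨h1, h2⟩
    · rw [pt_injective o h1, pt_injective o h2]
    · rw [pt_injective o h1, pt_injective o h2, add_comm]
  have e1 := congrArg Prod.fst h2
  have e2 := congrArg Prod.snd h2
  simp only [Prod.fst_add, Prod.snd_add] at e1 e2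
  ext <;> omega

end DualGraph


/-! ### Tangles and subcomplexes up to translations -/

theorem linkPoint_add (c b : ℂ) (j : ℤ) (ε : ℤˣ) (s : ℝ) :
    linkPoint (c + b) j ε s = linkPoint c j ε s + b := by
  rw [linkPoint, linkPoint, add_right_comm]

theorem image_add_curve (o b : ℂ) (Q : Finset (ℤ × ℤ)) :
    (fun z => z + b) '' curve o Q = curve (o + b) Q := by
  have hu : ∀ z, cu (o + b) (z + b) = cu o z := fun z => by simp only [cu, add_sub_add_right_eq_sub]
  have hv : ∀ z, cv (o + b) (z + b) = cv o z := fun z => by simp only [cv, add_sub_add_right_eq_sub]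
  ext z
  rw [Set.mem_image]
  constructor
  · rintro ⟨w, ⟨d, s, hd, hs, hz⟩, rfl⟩
    refine ⟨d, s, hd, hs, ?_⟩
    simp only [arc, Set.mem_ofPred_eq, hu, hv]
    exact hz
  · rintro ⟨d, s, hd, hs, hz⟩
    refine ⟨z - b, ⟨d, s, hd, hs, ?_⟩, sub_add_cancel z b⟩
    simp only [arc, Set.mem_ofPred_eq] at hz ⊢
    rw [← hu, ← hv, sub_add_cancel]
    exact hz

/-- A common black link centre ties the two packings together by a translation of cells; then the
faces inside are the same. -/
theorem exists_shift_of_curve_eq {o o' : ℂ} {Q Q' : Finset (ℤ × ℤ)} (hQ : IsHoleFreePolyomino Q)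
    (hS : Sub Q) (hQ' : IsHoleFreePolyomino Q') (hS' : Sub Q') (h : curve o Q = curve o' Q') :
    ∃ v, Q' = shift v Q := by
  obtain ⟨d, hd, hb, hl⟩ := exists_black_center (o := o) hQ hS
  have hin := (pt_mem_inside_iff (o := o) hQ d).2 hd
  rw [h] at hl hin
  obtain ⟨d', hd', hb', he⟩ := exists_of_isLinkCenter_inside hQ' hS' hl hin
  have ho : o = pt o' (d' - d) := by
    rw [sub_eq_add_neg, pt_add, ← he, ← pt_add, add_neg_cancel, pt_zero]
  refine ⟨d' - d, ?_⟩
  rw [ho, ← curve_shift _ _ (by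
    have := hb.1; have := hb.2; have := hb'.1; have := hb'.2
    simp only [Prod.fst_sub, Prod.snd_sub]; omega)] at h
  ext x
  rw [← pt_mem_inside_iff (o := o') hQ' x, ← pt_mem_inside_iff (o := o') (isHoleFree_shift hQ _) x, h]

/-- The last cell of a subcomplex is black before and after the shift. -/
theorem Sub.isBlack_of_shift {Q : Finset (ℤ × ℤ)} (hne : Q.Nonempty) (hS : Sub Q) {v : ℤ × ℤ}
    (hS' : Sub (shift v Q)) : IsBlack v := by
  obtain ⟨p, hp, hl⟩ := exists_last hne
  have h1 := hS.isBlack_last hp hl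
  have h2 := hS'.isBlack_last (p := p + v) (mem_shift.2 (by simpa using hp)) fun x hx => by
    have := hl _ (mem_shift.1 hx)
    simp only [Prod.fst_add, Prod.snd_add, Prod.fst_sub, Prod.snd_sub] at this ⊢
    omega
  simp only [IsBlack, Prod.fst_add, Prod.snd_add] at h1 h2 ⊢
  omega

theorem fixedSetoid_curve_iff {o o' : ℂ} {Q Q' : Finset (ℤ × ℤ)} (hQ : IsHoleFreePolyomino Q)
    (hS : Sub Q) (hQ' : IsHoleFreePolyomino Q') (hS' : Sub Q') :
    fixedSetoid (curve o Q) (curve o' Q') ↔ polyominoSetoid Q Q' := by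
  constructor
  · rintro ⟨b, hb⟩
    rw [image_add_curve] at hb
    exact exists_shift_of_curve_eq hQ hS hQ' hS' hb.symm
  · rintro ⟨v, hv⟩
    change Q' = shift v Q at hv
    subst hv
    have := hS.isBlack_of_shift (isHoleFree_nonempty hQ) hS'
    refine ⟨pt o' v - o, ?_⟩
    rw [image_add_curve, add_sub_cancel, curve_shift _ _ (by
      rw [IsBlack] at this; omega)]

/-! ### Counting Tangles by words -/

/-- Continuity of the tangent determines all directions from the first one and the orientations;
continuity of the curve then determines the centres up to a common translation. -/
theorem fixedSetoid_of_word {n : ℕ} [NeZero n] {c c' : ZMod n → ℂ} {j j' : ZMod n → ℤ}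
    {ε : ZMod n → ℤˣ}
    (h1 : ∀ k, linkPoint (c k) (j k) (ε k) (Real.pi / 2)
      = linkPoint (c (k + 1)) (j (k + 1)) (ε (k + 1)) 0)
    (h2 : ∀ k, linkTangent (j k) (ε k) (Real.pi / 2) = linkTangent (j (k + 1)) (ε (k + 1)) 0)
    (h1' : ∀ k, linkPoint (c' k) (j' k) (ε k) (Real.pi / 2)
      = linkPoint (c' (k + 1)) (j' (k + 1)) (ε (k + 1)) 0)
    (h2' : ∀ k, linkTangent (j' k) (ε k) (Real.pi / 2) = linkTangent (j' (k + 1)) (ε (k + 1)) 0)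
    (h0 : (j 0 : ZMod 4) = j' 0) :
    fixedSetoid (⋃ k, linkPoint (c k) (j k) (ε k) '' Set.Icc 0 (Real.pi / 2))
      (⋃ k, linkPoint (c' k) (j' k) (ε k) '' Set.Icc 0 (Real.pi / 2)) := by
  have hj : ∀ k, (j k : ZMod 4) = j' k := by
    refine forall_zmod_of_step h0 fun k hk => ?_
    have e1 := h2 k
    have e2 := h2' k
    rw [linkTangent_eq_tangent (d := 0), linkTangent_eq_tangent (d := 0), Link.tangent_eq_iff] at e1 e2
    simp only [hk] at e1 e2
    have key : ∀ u : ℤˣ, u ≠ -u := by decide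
    have hs : sideOf (j (k + 1)) (ε (k + 1)) = sideOf (j' (k + 1)) (ε (k + 1)) := by
      rcases e1 with e1 | e1 <;> rcases e2 with e2 | e2
      · rw [e1.1, e2.1]
      · exact (key _ (e1.2.symm.trans e2.2)).elim
      · exact (key _ (e2.2.symm.trans e1.2)).elim
      · rw [e1.1, e2.1]
    rw [← startOf_sideOf (j (k + 1)) (ε (k + 1)), hs, startOf_sideOf]
  have hp : ∀ k, linkPoint (c k) (j k) (ε k) = linkPoint (c k) (j' k) (ε k) :=
    fun k => linkPoint_congr (hj k) _
  simp only [hp] at h1 ⊢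
  have hc : ∀ k, c' k = c k + (c' 0 - c 0) := by
    refine forall_zmod_of_step (by ring) fun k hk => ?_
    have e1 := h1 k
    have e2 := h1' k
    rw [hk, linkPoint_add, e1, ← linkPoint_add] at e2
    exact (add_right_cancel e2).symm
  refine ⟨c' 0 - c 0, ?_⟩
  rw [Set.image_iUnion]
  refine Set.iUnion_congr fun k => ?_
  rw [Set.image_image]
  refine Set.image_congr fun s _ => ?_
  rw [hc k, linkPoint_add]

theorem ncard_classes_length_le (n : ℕ) :
    (classes fixedSetoid {Γ | IsTangleOfLength n Γ}).ncard ≤ 4 * 2 ^ n ∧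
      (classes fixedSetoid {Γ | IsTangleOfLength n Γ}).Finite := by
  -- No Tangle has length `0`; the case is separate because `ZMod 0` is infinite.
  rcases Nat.eq_zero_or_pos n with rfl | hn
  · have : {Γ | IsTangleOfLength 0 Γ} = ∅ := Set.eq_empty_of_forall_notMem fun Γ h => lt_irrefl 0 h.1
    simp [classes, this]
  have : NeZero n := ⟨hn.ne'⟩
  have hB : (Set.univ : Set (ZMod 4 × (ZMod n → ℤˣ))).Finite := Set.finite_univ
  have hcard : (Set.univ : Set (ZMod 4 × (ZMod n → ℤˣ))).ncard = 4 * 2 ^ n := by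
    rw [Set.ncard_univ, Nat.card_eq_fintype_card, Fintype.card_prod, Fintype.card_fun, ZMod.card,
      ZMod.card, Fintype.card_units_int]
  rw [← hcard]
  refine ncard_le_of_rel hB (fun a w => ∃ (c : ZMod n → ℂ) (j : ZMod n → ℤ) (ε : ZMod n → ℤˣ),
    (∀ k, linkPoint (c k) (j k) (ε k) (Real.pi / 2)
      = linkPoint (c (k + 1)) (j (k + 1)) (ε (k + 1)) 0) ∧
    (∀ k, linkTangent (j k) (ε k) (Real.pi / 2) = linkTangent (j (k + 1)) (ε (k + 1)) 0) ∧
    a = Quotient.mk _ (⋃ k, linkPoint (c k) (j k) (ε k) '' Set.Icc 0 (Real.pi / 2)) ∧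
    w = ((j 0 : ZMod 4), ε)) ?_ ?_
  · rintro _ ⟨Γ, ⟨-, c, j, ε, h1, h2, -, rfl⟩, rfl⟩
    exact ⟨_, Set.mem_univ _, c, j, ε, h1, h2, rfl, rfl⟩
  · rintro _ - _ - _ - ⟨c, j, ε, h1, h2, rfl, rfl⟩ ⟨c', j', ε', h1', h2', rfl, he⟩
    rw [Prod.mk.injEq] at he
    obtain ⟨h0, rfl⟩ := he
    exact Quotient.sound (fixedSetoid_of_word h1 h2 h1' h2' h0)

/-! ### Numbers of Tangles as numbers of subcomplexes -/

/-- The hole-free subcomplexes that correspond to Tangles of size `m`. -/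
def subsOfSize (m : ℕ) : Set (Finset (ℤ × ℤ)) :=
  {Q | (Sub Q ∧ IsHoleFreePolyomino Q) ∧ Q.card = 2 * m + 1}

/-- The hole-free subcomplexes that correspond to Tangles of class `c`. -/
def subsOfClass (c : ℕ) : Set (Finset (ℤ × ℤ)) :=
  {Q | (Sub Q ∧ IsHoleFreePolyomino Q) ∧ perimeter Q = 4 * c}

theorem classes_mono {α : Type*} {r : Setoid α} {S T : Set α} (h : S ⊆ T) :
    classes r S ⊆ classes r T := Set.image_mono h

theorem finite_classes_tanglesOfClass (c : ℕ) :
    (classes fixedSetoid {Γ | IsTangleOfLength (4 * c) Γ}).Finite :=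
  (ncard_classes_length_le _).2

theorem classCount_subsOfClass_le (c : ℕ) :
    classCount polyominoSetoid (subsOfClass c) ≤ tanglesOfClass fixedSetoid c ∧
      (classes polyominoSetoid (subsOfClass c)).Finite := by
  refine classCount_le_of_rel (finite_classes_tanglesOfClass c) (fun Q Γ => Γ = curve 0 Q) ?_ ?_
  · intro Q hQ
    exact ⟨_, by have := isTangleOfLength_curve 0 hQ.1.2 hQ.1.1; rwa [hQ.2] at this, rfl⟩
  · rintro Q hQ Q' hQ' _ - _ - rfl rfl h
    exact (fixedSetoid_curve_iff hQ.1.2 hQ.1.1 hQ'.1.2 hQ'.1.1).1 h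

theorem tanglesOfClass_eq (c : ℕ) :
    tanglesOfClass fixedSetoid c = classCount polyominoSetoid (subsOfClass c) := by
  refine le_antisymm ?_ (classCount_subsOfClass_le c).1
  refine (classCount_le_of_rel (classCount_subsOfClass_le c).2
    (fun Γ Q => ∃ o, Γ = curve o Q) ?_ ?_).1
  · intro Γ hΓ
    obtain ⟨o, Q, hQ, hS, hp, rfl⟩ := exists_curve_of_isTangleOfLength hΓ
    exact ⟨Q, ⟨⟨hS, hQ⟩, hp⟩, o, rfl⟩
  · rintro _ - _ - Q hQ Q' hQ' ⟨o, rfl⟩ ⟨o', rfl⟩ h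
    exact (fixedSetoid_curve_iff hQ.1.2 hQ.1.1 hQ'.1.2 hQ'.1.1).2 h

theorem tanglesOfClass_le (c : ℕ) : tanglesOfClass fixedSetoid c ≤ 4 * 2 ^ (4 * c) :=
  (ncard_classes_length_le _).1

/-- With `m` gaps and `w` white cells the perimeter is `4(m + 1 - 2w)`, so the class is at most `m +
1`. -/
theorem subsOfSize_subset (m : ℕ) : subsOfSize m ⊆ ⋃ c ∈ Finset.range (m + 2), subsOfClass c := by
  rintro Q ⟨hQ, hm⟩
  obtain ⟨h1, h2⟩ := hQ.1.card_eq hQ.2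
  rw [Set.mem_iUnion₂]
  exact ⟨m + 1 - 2 * (Q.filter IsWhite).card, by rw [Finset.mem_range]; omega, hQ, by omega⟩

theorem classes_biUnion {α ι : Type*} {r : Setoid α} (s : Finset ι) (S : ι → Set α) :
    classes r (⋃ i ∈ s, S i) = ⋃ i ∈ s, classes r (S i) := by
  simp only [classes, Set.image_iUnion]

theorem finite_classes_subsOfSize (m : ℕ) : (classes polyominoSetoid (subsOfSize m)).Finite := by
  refine Set.Finite.subset ?_ (classes_mono (subsOfSize_subset m))
  rw [classes_biUnion]
  exact (Finset.finite_toSet _).biUnion fun c _ => (classCount_subsOfClass_le c).2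

theorem tanglesOfSize_le_classCount (m : ℕ) :
    tanglesOfSize fixedSetoid m ≤ classCount polyominoSetoid (subsOfSize m) ∧
      (classes fixedSetoid {Γ | IsTangle Γ ∧ size Γ = m}).Finite := by
  refine classCount_le_of_rel (finite_classes_subsOfSize m) (fun Γ Q => ∃ o, Γ = curve o Q) ?_ ?_
  · rintro Γ ⟨⟨n, hΓ⟩, hm⟩
    obtain ⟨o, Q, hQ, hS, hp, rfl⟩ := exists_curve_of_isTangleOfLength hΓ
    exact ⟨Q, ⟨⟨hS, hQ⟩, by rw [← hm]; exact size_curve hQ hS⟩, o, rfl⟩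
  · rintro _ - _ - Q hQ Q' hQ' ⟨o, rfl⟩ ⟨o', rfl⟩ h
    exact (fixedSetoid_curve_iff hQ.1.2 hQ.1.1 hQ'.1.2 hQ'.1.1).2 h

theorem tanglesOfSize_eq (m : ℕ) :
    tanglesOfSize fixedSetoid m = classCount polyominoSetoid (subsOfSize m) := by
  refine le_antisymm (tanglesOfSize_le_classCount m).1 ?_
  refine (classCount_le_of_rel (tanglesOfSize_le_classCount m).2 (fun Q Γ => Γ = curve 0 Q) ?_ ?_).1
  · intro Q hQ
    refine ⟨_, ⟨⟨_, isTangleOfLength_curve 0 hQ.1.2 hQ.1.1⟩, ?_⟩, rfl⟩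
    have h1 := size_curve (o := 0) hQ.1.2 hQ.1.1
    have h2 := hQ.2
    omega
  · rintro Q hQ Q' hQ' _ - _ - rfl rfl h
    exact (fixedSetoid_curve_iff hQ.1.2 hQ.1.1 hQ'.1.2 hQ'.1.1).1 h

theorem tanglesOfSize_le_sum (m : ℕ) :
    tanglesOfSize fixedSetoid m ≤ ∑ c ∈ Finset.range (m + 2), tanglesOfClass fixedSetoid c := by
  simp only [tanglesOfSize_eq, tanglesOfClass_eq, classCount_eq]
  refine (Set.ncard_le_ncard (classes_mono (subsOfSize_subset m)) ?_).trans ?_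
  · rw [classes_biUnion]
    exact (Finset.finite_toSet _).biUnion fun c _ => (classCount_subsOfClass_le c).2
  · rw [classes_biUnion]
    exact Finset.set_ncard_biUnion_le _ _

/-! ### Comparison with polyominoes -/

/-- A translation between subcomplexes preserves black cells, so its vector can be halved. -/
theorem exists_shift_of_double {P P' Q Q' : Finset (ℤ × ℤ)} (hne : Q.Nonempty) (hS : Sub Q)
    (hS' : Sub Q') (h : ∀ x, x + x ∈ Q ↔ x ∈ P) (h' : ∀ x, x + x ∈ Q' ↔ x ∈ P')
    (hQ : polyominoSetoid Q Q') : polyominoSetoid P P' := by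
  obtain ⟨v, hv⟩ := hQ
  change Q' = shift v Q at hv
  subst hv
  obtain ⟨h1, h2⟩ := hS.isBlack_of_shift hne hS'
  have hvv : v = (v.1 / 2, v.2 / 2) + (v.1 / 2, v.2 / 2) := by
    ext <;> simp only [Prod.fst_add, Prod.snd_add] <;> omega
  refine ⟨(v.1 / 2, v.2 / 2), ?_⟩
  change P' = shift _ P
  ext x
  rw [mem_shift, ← h, ← h', mem_shift, hvv]
  refine iff_of_eq (congrArg (· ∈ Q) ?_)
  rw [← hvv]
  ext <;> simp only [Prod.fst_add, Prod.snd_add, Prod.fst_sub, Prod.snd_sub] <;> omega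

/-- A spanning tree on `m + 1` black cells has `m` gaps. The polyomino is recovered from the black
cells of the tree, so the choice of tree does not matter. -/
theorem polyominoesOfArea_le (m : ℕ) : polyominoesOfArea (m + 1) ≤ tanglesOfSize fixedSetoid m ∧
    (classes polyominoSetoid {P | IsHoleFreePolyomino P ∧ P.card = m + 1}).Finite := by
  rw [tanglesOfSize_eq]
  refine classCount_le_of_rel (finite_classes_subsOfSize m) (fun P Q => ∀ x, x + x ∈ Q ↔ x ∈ P) ?_ ?_
  · rintro P ⟨hP, hm⟩
    obtain ⟨h1, h2, -⟩ := (isHoleFree_iff P).1 hP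
    obtain ⟨Q, hS, hQ, hc, hx⟩ := exists_tree h1 h2
    exact ⟨Q, ⟨⟨hS, hQ⟩, by omega⟩, hx⟩
  · rintro P - P' - Q hQ Q' hQ' h h' hr
    exact exists_shift_of_double (isHoleFree_nonempty hQ.1.2) hQ.1.1 hQ'.1.1 h h' hr

/-- Doubling turns the perimeter `2(c + 1)` into `4(c + 1) - 4 = 4c`. -/
theorem polyominoesOfHalfPerimeter_le (c : ℕ) :
    polyominoesOfHalfPerimeter (c + 1) ≤ tanglesOfClass fixedSetoid c ∧
    (classes polyominoSetoid {P | IsHoleFreePolyomino P ∧ perimeter P = 2 * (c + 1)}).Finite := by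
  rw [tanglesOfClass_eq]
  refine classCount_le_of_rel (classCount_subsOfClass_le c).2 (fun P Q => ∀ x, x + x ∈ Q ↔ x ∈ P)
    ?_ ?_
  · rintro P ⟨hP, hm⟩
    have := perimeter_refinement hP
    exact ⟨refinement P, ⟨⟨sub_refinement P, isHoleFree_refinement hP⟩, by omega⟩,
      fun x => by
        have h := mem_refinement_black (P := P) (a := x.1) (b := x.2)
        rwa [two_mul, two_mul] at h⟩
  · rintro P - P' - Q hQ Q' hQ' h h' hr
    exact exists_shift_of_double (isHoleFree_nonempty hQ.1.2) hQ.1.1 hQ'.1.1 h h' hr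

/-- The colours are forgotten: a subcomplex is in particular a hole-free polyomino. -/
theorem tanglesOfSize_le (m : ℕ) : tanglesOfSize fixedSetoid m ≤ polyominoesOfArea (2 * m + 1) := by
  rw [tanglesOfSize_eq]
  exact Set.ncard_le_ncard (classes_mono fun Q hQ => ⟨hQ.1.2, hQ.2⟩) (polyominoesOfArea_le _).2

theorem tanglesOfClass_le_polyominoes (c : ℕ) :
    tanglesOfClass fixedSetoid c ≤ polyominoesOfHalfPerimeter (2 * c) := by
  rw [tanglesOfClass_eq]
  rcases c with _ | c
  · have : subsOfClass 0 = ∅ := Set.eq_empty_of_forall_notMem fun Q hQ => by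
      have h1 := four_le_perimeter (isHoleFree_nonempty hQ.1.2)
      have h2 := hQ.2
      omega
    simp [classCount, this]
  · refine Set.ncard_le_ncard (classes_mono fun Q hQ => ⟨hQ.1.2, by have := hQ.2; omega⟩)
      (polyominoesOfHalfPerimeter_le (2 * c + 1)).2

/-! ### Supermultiplicativity -/

theorem polyominoesOfArea_zero : polyominoesOfArea 0 = 0 := by
  have : {P | IsHoleFreePolyomino P ∧ P.card = 0} = ∅ :=
    Set.eq_empty_of_forall_notMem fun P hP =>
      (Finset.card_pos.2 (isHoleFree_nonempty hP.1)).ne' hP.2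
  rw [polyominoesOfArea, this]
  simp [classCount]

theorem polyominoesOfArea_mul_le (m n : ℕ) :
    polyominoesOfArea m * polyominoesOfArea n ≤ polyominoesOfArea (m + n) := by
  rcases m with _ | m
  · simp [polyominoesOfArea_zero]
  · refine classCount_area_mul_le _ _ ?_
    rw [add_right_comm]
    exact (polyominoesOfArea_le _).2

theorem polyominoesOfHalfPerimeter_mul_le (m n : ℕ) :
    polyominoesOfHalfPerimeter (m + 1) * polyominoesOfHalfPerimeter (n + 1) ≤
      polyominoesOfHalfPerimeter (m + n + 1) :=
  classCount_halfPerimeter_mul_le m n (polyominoesOfHalfPerimeter_le _).2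

theorem Extends.isHoleFree {P R : Finset (ℤ × ℤ)} (h : Extends P R) (hP : IsHoleFreePolyomino P) :
    IsHoleFreePolyomino R ∧ R.card = P.card + 1 ∧ perimeter R = perimeter P + 2 := by
  obtain ⟨p, hj, rfl⟩ := h
  refine ⟨hj.isHoleFree hP (isHoleFree_singleton _), ?_, ?_⟩
  · rw [hj.card_union, Finset.card_singleton]
  · have := hj.perimeter_union
    rw [perimeter_singleton] at this
    omega

/-- The areas combine as `(2m + 1) + (2n + 1) + 1 = 2(m + n + 1) + 1`, the last cell on the left
being the connecting gap. -/
theorem tanglesOfSize_mul_le (m n : ℕ) :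
    tanglesOfSize fixedSetoid m * tanglesOfSize fixedSetoid n ≤
      tanglesOfSize fixedSetoid (m + n + 1) := by
  simp only [tanglesOfSize_eq]
  refine classCount_sub_mul_le (finite_classes_subsOfSize _) (fun _ _ => ?_) (fun P hP => hP.1)
    (fun P hP => hP.1) ?_ (Or.inl fun P hP P' hP' => hP.2.trans hP'.2.symm)
  · refine (polyominoesOfArea_le (2 * m + 1)).2.subset (classes_mono ?_)
    rintro R ⟨P, hP, h⟩
    obtain ⟨h1, h2, -⟩ := h.isHoleFree hP.1.2
    have := hP.2
    exact ⟨h1, by omega⟩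
  · intro P hP Q hQ R hR hR' hc _
    have := hP.2
    have := hQ.2
    exact ⟨⟨hR, hR'⟩, by omega⟩

theorem tanglesOfClass_mul_le (m n : ℕ) :
    tanglesOfClass fixedSetoid m * tanglesOfClass fixedSetoid n ≤
      tanglesOfClass fixedSetoid (m + n) := by
  simp only [tanglesOfClass_eq]
  refine classCount_sub_mul_le (classCount_subsOfClass_le _).2 (fun _ _ => ?_) (fun P hP => hP.1)
    (fun P hP => hP.1) ?_ (Or.inr fun P hP P' hP' => hP.2.trans hP'.2.symm)
  · refine (polyominoesOfHalfPerimeter_le (2 * m)).2.subset (classes_mono ?_)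
    rintro R ⟨P, hP, h⟩
    obtain ⟨h1, -, h2⟩ := h.isHoleFree hP.1.2
    have := hP.2
    exact ⟨h1, by omega⟩
  · intro P hP Q hQ R hR hR' _ hp
    have := hP.2
    have := hQ.2
    exact ⟨⟨hR, hR'⟩, by omega⟩

theorem classCount_pos {α : Type*} {r : Setoid α} {S : Set α} (hfin : (classes r S).Finite)
    {x : α} (hx : x ∈ S) : 0 < classCount r S :=
  (Set.ncard_pos hfin).2 ⟨_, x, hx, rfl⟩

theorem polyominoesOfArea_one_pos : 0 < polyominoesOfArea 1 :=
  classCount_pos (polyominoesOfArea_le 0).2 (x := {0}) ⟨isHoleFree_singleton _, rfl⟩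

theorem polyominoesOfHalfPerimeter_two_pos : 0 < polyominoesOfHalfPerimeter 2 :=
  classCount_pos (polyominoesOfHalfPerimeter_le 1).2 (x := {0})
    ⟨isHoleFree_singleton _, perimeter_singleton _⟩

theorem tanglesOfSize_zero_pos : 0 < tanglesOfSize fixedSetoid 0 :=
  polyominoesOfArea_one_pos.trans_le (polyominoesOfArea_le 0).1

theorem tanglesOfClass_one_pos : 0 < tanglesOfClass fixedSetoid 1 :=
  polyominoesOfHalfPerimeter_two_pos.trans_le (polyominoesOfHalfPerimeter_le 1).1


/-! ### Rotations and reflections -/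

/-- The centres of the unit circles that have infinitely many points in common with `Γ`. -/
def circleCenters (Γ : Set ℂ) : Set ℂ := {c | (Metric.sphere c 1 ∩ Γ).Infinite}

/-- Two kissing circles contribute to `Γ`. -/
def HasKiss (Γ : Set ℂ) : Prop :=
  ∃ c ∈ circleCenters Γ, ∃ v : ℤ × ℤ, pt c v ∈ circleCenters Γ ∧ v.1 ^ 2 = 1 ∧ v.2 ^ 2 = 1

/-- The identity or complex conjugation. -/
noncomputable def conjIf (r : Bool) (z : ℂ) : ℂ := if r then starRingEnd ℂ z else z

theorem IsTangle.exists_curve {Γ : Set ℂ} (h : IsTangle Γ) :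
    ∃ o Q, IsHoleFreePolyomino Q ∧ Sub Q ∧ Γ = curve o Q := by
  obtain ⟨n, h⟩ := h
  obtain ⟨o, Q, h1, h2, -, h3⟩ := exists_curve_of_isTangleOfLength h
  exact ⟨o, Q, h1, h2, h3⟩

theorem IsTangle.exists_pt {Γ : Set ℂ} (h : IsTangle Γ) {c c' : ℂ} (hc : c ∈ circleCenters Γ)
    (hc' : c' ∈ circleCenters Γ) : ∃ v, c' = pt c v := by
  obtain ⟨o, Q, -, -, rfl⟩ := h.exists_curve
  obtain ⟨d, -, rfl, -⟩ := exists_arc_of_infinite hc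
  obtain ⟨d', -, rfl, -⟩ := exists_arc_of_infinite hc'
  exact ⟨d' - d, by rw [← pt_add, add_sub_cancel]⟩

/-- If the boundary never passes to a kissing circle, it runs around one black disc, which is then
cut off from everything else in `Q`. -/
theorem IsTangle.hasKiss_or {Γ : Set ℂ} (h : IsTangle Γ) : HasKiss Γ ∨ ∃ o, Γ = curve o {0} := by
  obtain ⟨o, Q, hQ, hS, rfl⟩ := h.exists_curve
  by_cases hk : HasKiss (curve o Q)
  · exact Or.inl hk
  right
  have hcenter : ∀ L, IsBoundaryLink Q L → pt o L.cell ∈ circleCenters (curve o Q) :=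
    fun L hL => (isLinkCenter_curve hL.1 hL.2.1).infinite
  have hstay : ∀ L, IsBoundaryLink Q L →
      IsBoundaryLink Q ⟨L.cell, L.side + turn L.sgn, L.sgn⟩ := by
    intro L hL
    have h1 := isBoundaryLink_advance hS hL
    rcases step_advance Q L with ⟨e1, e2, e3⟩ | ⟨e1, e2, e3⟩
    · rwa [show advance Q L.sgn L = ⟨L.cell, L.side + turn L.sgn, L.sgn⟩ from
        Link.ext e1 e2 e3] at h1
    · refine (hk ⟨_, hcenter L hL, dir L.side + dir (L.side + turn L.sgn), ?_, ?_⟩).elim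
      · rw [← pt_add, ← add_assoc, ← e1]
        exact hcenter _ h1
      · generalize L.side = s
        generalize L.sgn = ε
        revert s ε
        decide
  obtain ⟨p, hp, hl⟩ := exists_last (isHoleFree_nonempty hQ)
  have hb := hS.isBlack_last hp hl
  have h0 : IsBoundaryLink Q ⟨p, 3, 1⟩ := by
    refine ⟨by have := hb.1; have := hb.2; simp only; omega, iff_of_true hp fun h => ?_,
      iff_of_true rfl hp⟩
    have := hl _ h
    simp only [dir_three, Prod.fst_add, Prod.snd_add] at this
    omega
  have h1 : IsBoundaryLink Q ⟨p, 0, 1⟩ := by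
    have h := hstay _ h0
    rwa [show (3 : ZMod 4) + turn 1 = 0 by decide] at h
  have h2 : IsBoundaryLink Q ⟨p, 1, 1⟩ := hstay _ h1
  have h3 : IsBoundaryLink Q ⟨p, 2, 1⟩ := hstay _ h2
  have hout : ∀ s, p + dir s ∉ Q :=
    forall_side.2 ⟨h1.2.1.1 hp, h2.2.1.1 hp, h3.2.1.1 hp, h0.2.1.1 hp⟩
  obtain ⟨-, hconn, -⟩ := (isHoleFree_iff Q).1 hQ
  have hall : ∀ x, Conn (Q : Set (ℤ × ℤ)) p x → x = p := by
    intro x hx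
    induction hx with
    | refl => rfl
    | tail _ hbc ih =>
      obtain ⟨-, hc, s, rfl⟩ := hbc
      rw [ih] at hc
      exact (hout s hc).elim
  have hQp : Q = shift p {0} := by
    ext x
    rw [mem_shift, Finset.mem_singleton, sub_eq_zero]
    exact ⟨fun hx => hall x (hconn p hp x hx), fun h => h ▸ hp⟩
  exact ⟨pt o p, by rw [hQp, curve_shift _ _ h0.1]⟩

theorem image_mem_circleCenters {Γ : Set ℂ} {c b : ℂ} {u : Circle} {r : Bool}
    (h : c ∈ circleCenters Γ) : (u : ℂ) * conjIf r c + b ∈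
      circleCenters ((fun z => (u : ℂ) * conjIf r z + b) '' Γ) := by
  have hdist : ∀ z w : ℂ, ‖((u : ℂ) * conjIf r z + b) - ((u : ℂ) * conjIf r w + b)‖ = ‖z - w‖ := by
    intro z w
    rw [add_sub_add_right_eq_sub, ← mul_sub, norm_mul, Circle.norm_coe, one_mul]
    cases r
    · rfl
    · simp only [conjIf, if_true, ← map_sub]
      exact RCLike.norm_conj _
  have hinj : Function.Injective (fun z => (u : ℂ) * conjIf r z + b) := by
    intro z w hzw
    have := hdist z w
    simp only at hzw
    rw [hzw, sub_self, norm_zero] at this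
    exact sub_eq_zero.1 (norm_eq_zero.1 this.symm)
  refine (Set.Infinite.image hinj.injOn h).mono ?_
  rintro _ ⟨z, ⟨hz, hzΓ⟩, rfl⟩
  refine ⟨?_, z, hzΓ, rfl⟩
  rw [mem_sphere_iff_norm] at hz ⊢
  rw [hdist, hz]

theorem eq_one_or_neg_one_of_sq {a : ℤ} (h : a ^ 2 = 1) : a = 1 ∨ a = -1 := by
  simpa using h

theorem sq_eq_one_of_add {a b : ℤ} (h : a ^ 2 + b ^ 2 = 2) : a ^ 2 = 1 ∧ b ^ 2 = 1 := by
  have h1 : a ≤ 1 := by nlinarith [sq_nonneg b]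
  have h2 : -1 ≤ a := by nlinarith [sq_nonneg b]
  have h3 : b ≤ 1 := by nlinarith [sq_nonneg a]
  have h4 : -1 ≤ b := by nlinarith [sq_nonneg a]
  interval_cases a <;> interval_cases b <;> simp_all

/-- The image of a vector between kissing centres is a vector of the image's packing and keeps its
length, so it again is one of `√2 (±1 ± i)`. The rotation is the quotient of two such vectors. -/
theorem HasKiss.image {Γ : Set ℂ} {b : ℂ} {u : Circle} {r : Bool} (h : HasKiss Γ)
    (h' : IsTangle ((fun z => (u : ℂ) * conjIf r z + b) '' Γ)) :
    HasKiss ((fun z => (u : ℂ) * conjIf r z + b) '' Γ) ∧ ∃ k : Fin 4, (u : ℂ) = Complex.I ^ k.val := by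
  obtain ⟨c, hc, v, hv, hv1, hv2⟩ := h
  have e1 := image_mem_circleCenters (u := u) (r := r) (b := b) hc
  have e2 := image_mem_circleCenters (u := u) (r := r) (b := b) hv
  obtain ⟨w, hw⟩ := h'.exists_pt e1 e2
  obtain ⟨x, y, hx, hy, hxy⟩ : ∃ x y : ℤ, x ^ 2 = 1 ∧ y ^ 2 = 1 ∧ conjIf r (pt c v) =
      conjIf r c + (Real.sqrt 2 : ℂ) * ((x : ℂ) + (y : ℂ) * Complex.I) := by
    cases r
    · exact ⟨v.1, v.2, hv1, hv2, rfl⟩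
    · refine ⟨v.1, -v.2, hv1, by rwa [neg_sq], ?_⟩
      simp only [conjIf, if_true, pt, map_add, map_mul, Complex.conj_ofReal, Complex.conj_I,
        map_intCast]
      push_cast
      ring
  have h2 : (Real.sqrt 2 : ℂ) ≠ 0 := by exact_mod_cast sqrt_two_ne
  have huw : (u : ℂ) * ((x : ℂ) + (y : ℂ) * Complex.I) = (w.1 : ℂ) + (w.2 : ℂ) * Complex.I := by
    rw [hxy, pt] at hw
    refine mul_left_cancel₀ h2 ?_
    linear_combination hw
  have hnorm : ∀ a b : ℤ, Complex.normSq ((a : ℂ) + (b : ℂ) * Complex.I) = a ^ 2 + b ^ 2 := by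
    intro a b
    simp [Complex.normSq_apply]
    ring
  have hw2 : w.1 ^ 2 + w.2 ^ 2 = 2 := by
    have := congrArg Complex.normSq huw
    rw [Complex.normSq_mul, Circle.normSq_coe, one_mul, hnorm, hnorm] at this
    have h3 : x ^ 2 + y ^ 2 = w.1 ^ 2 + w.2 ^ 2 := by exact_mod_cast this
    omega
  obtain ⟨hw1, hw2⟩ := sq_eq_one_of_add hw2
  refine ⟨⟨_, e1, w, hw ▸ e2, hw1, hw2⟩, ?_⟩
  -- Division by `x + y i` is multiplication by its conjugate over its squared modulus `2`.
  have hu : (u : ℂ) = ((w.1 : ℂ) + (w.2 : ℂ) * Complex.I) * ((x : ℂ) - (y : ℂ) * Complex.I) / 2 := by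
    have e : ((x : ℂ) + (y : ℂ) * Complex.I) * ((x : ℂ) - (y : ℂ) * Complex.I) = 2 := by
      have hx' : (x : ℂ) ^ 2 = 1 := by exact_mod_cast hx
      have hy' : (y : ℂ) ^ 2 = 1 := by exact_mod_cast hy
      linear_combination hx' + hy' - (y : ℂ) ^ 2 * Complex.I_sq
    rw [← huw, mul_assoc, e, mul_div_cancel_right₀ _ two_ne_zero]
  have hfin : ∀ a b x y : ℤ, (a = 1 ∨ a = -1) → (b = 1 ∨ b = -1) → (x = 1 ∨ x = -1) →
      (y = 1 ∨ y = -1) → ∃ k : Fin 4, ((a : ℂ) + (b : ℂ) * Complex.I) *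
        ((x : ℂ) - (y : ℂ) * Complex.I) / 2 = Complex.I ^ k.val := by
    intro a b x y ha hb hx hy
    have h0 : a * x + b * y = 2 ∧ b * x - a * y = 0 ∨ a * x + b * y = 0 ∧ b * x - a * y = 2 ∨
        a * x + b * y = -2 ∧ b * x - a * y = 0 ∨ a * x + b * y = 0 ∧ b * x - a * y = -2 := by
      rcases ha with rfl | rfl <;> rcases hb with rfl | rfl <;> rcases hx with rfl | rfl <;>
        rcases hy with rfl | rfl <;> decide
    have h1 : ((a : ℂ) + (b : ℂ) * Complex.I) * ((x : ℂ) - (y : ℂ) * Complex.I) / 2 =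
        (((a * x + b * y : ℤ) : ℂ) + ((b * x - a * y : ℤ) : ℂ) * Complex.I) / 2 := by
      push_cast
      linear_combination (-(b : ℂ) * y / 2) * Complex.I_sq
    rw [h1]
    rcases h0 with h | h | h | h <;> rw [h.1, h.2]
    · exact ⟨0, by norm_num⟩
    · exact ⟨1, by norm_num⟩
    · exact ⟨2, by norm_num⟩
    · refine ⟨3, ?_⟩
      change _ = Complex.I ^ 3
      rw [Complex.I_pow_three]
      push_cast
      ring
  rw [hu]
  exact hfin _ _ _ _ (eq_one_or_neg_one_of_sq hw1) (eq_one_or_neg_one_of_sq hw2)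
    (eq_one_or_neg_one_of_sq hx) (eq_one_or_neg_one_of_sq hy)

theorem freeSetoid_iff {Γ Γ' : Set ℂ} : freeSetoid Γ Γ' ↔ ∃ (u : Circle) (b : ℂ) (r : Bool),
    Γ' = (fun z => (u : ℂ) * conjIf r z + b) '' Γ := by
  constructor
  · rintro ⟨u, b, h | h⟩
    · exact ⟨u, b, false, h⟩
    · exact ⟨u, b, true, h⟩
  · rintro ⟨u, b, r, h⟩
    cases r
    · exact ⟨u, b, Or.inl h⟩
    · exact ⟨u, b, Or.inr h⟩

theorem hasKiss_of_free {Γ Γ' : Set ℂ} (h' : IsTangle Γ') (hk : HasKiss Γ)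
    (h : freeSetoid Γ Γ') : HasKiss Γ' ∧ ∃ (k : Fin 4) (r : Bool) (b : ℂ),
      Γ' = (fun z => Complex.I ^ k.val * conjIf r z + b) '' Γ := by
  obtain ⟨u, b, r, rfl⟩ := freeSetoid_iff.1 h
  obtain ⟨h1, k, hu⟩ := hk.image h'
  exact ⟨h1, k, r, b, by rw [hu]⟩

/-- A free class splits into at most eight fixed classes. -/
theorem classCount_fixed_le_free {S : Set (Set ℂ)} (hS : ∀ Γ ∈ S, IsTangle Γ)
    (hfin : (classes freeSetoid S).Finite) :
    classCount fixedSetoid S ≤ 8 * classCount freeSetoid S := by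
  have hrep : ∀ q ∈ classes freeSetoid S, ∃ Γ ∈ S, Quotient.mk freeSetoid Γ = q := fun q hq => hq
  choose! rep hrepS hrep using hrep
  have hB : (classes freeSetoid S ×ˢ (Set.univ : Set (Fin 4 × Bool))).Finite :=
    hfin.prod Set.finite_univ
  have hcard : (classes freeSetoid S ×ˢ (Set.univ : Set (Fin 4 × Bool))).ncard =
      8 * classCount freeSetoid S := by
    rw [Set.ncard_prod, Set.ncard_univ, Nat.card_eq_fintype_card, mul_comm]
    rfl
  rw [← hcard]
  refine (ncard_le_of_rel hB (fun a x => ∃ Γ ∈ S, Quotient.mk fixedSetoid Γ = a ∧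
    Quotient.mk freeSetoid Γ = x.1 ∧ (HasKiss Γ → HasKiss (rep x.1) ∧
      ∃ b, Γ = (fun z => Complex.I ^ x.2.1.val * conjIf x.2.2 z + b) '' rep x.1)) ?_ ?_).1
  · rintro _ ⟨Γ, hΓ, rfl⟩
    have hq : Quotient.mk freeSetoid Γ ∈ classes freeSetoid S := ⟨Γ, hΓ, rfl⟩
    have he : freeSetoid (rep (Quotient.mk freeSetoid Γ)) Γ := Quotient.exact (hrep _ hq)
    by_cases hk : HasKiss Γ
    · obtain ⟨h1, -⟩ := hasKiss_of_free (hS _ (hrepS _ hq)) hk (freeSetoid.symm he)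
      obtain ⟨-, k, r, b, h2⟩ := hasKiss_of_free (hS _ hΓ) h1 he
      exact ⟨(_, (k, r)), ⟨hq, Set.mem_univ _⟩, Γ, hΓ, rfl, rfl, fun _ => ⟨h1, b, h2⟩⟩
    · exact ⟨(_, (0, false)), ⟨hq, Set.mem_univ _⟩, Γ, hΓ, rfl, rfl, fun h => (hk h).elim⟩
  -- The label of a class with a kiss records one of four rotations, composed or not with a
  -- reflection, that takes the chosen representative to it up to translation. Tangles without a
  -- kiss are single circles and need no label.
  · rintro _ - _ - ⟨q, k, r⟩ - ⟨Γ, hΓ, rfl, h1, h2⟩ ⟨Γ', hΓ', rfl, h1', h2'⟩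
    have he : freeSetoid Γ Γ' := Quotient.exact (h1.trans h1'.symm)
    refine Quotient.sound ?_
    change fixedSetoid Γ Γ'
    by_cases hk : HasKiss Γ
    · obtain ⟨hk', -⟩ := hasKiss_of_free (hS _ hΓ') hk he
      obtain ⟨-, b, hb⟩ := h2 hk
      obtain ⟨-, b', hb'⟩ := h2' hk'
      refine ⟨b' - b, ?_⟩
      rw [hb, hb', Set.image_image]
      refine Set.image_congr fun z _ => ?_
      ring
    · have hk' : ¬HasKiss Γ' := fun h =>
        hk (hasKiss_of_free (hS _ hΓ) h (freeSetoid.symm he)).1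
      obtain ⟨o, ho⟩ := (hS _ hΓ).hasKiss_or.resolve_left hk
      obtain ⟨o', ho'⟩ := (hS _ hΓ').hasKiss_or.resolve_left hk'
      refine ⟨o' - o, ?_⟩
      rw [ho, ho', image_add_curve, add_sub_cancel]

theorem classCount_free_le_oneSided {S : Set (Set ℂ)} (hfin : (classes oneSidedSetoid S).Finite) :
    classCount freeSetoid S ≤ classCount oneSidedSetoid S ∧ (classes freeSetoid S).Finite := by
  refine classCount_le_of_rel hfin (fun x y => x = y) (fun x hx => ⟨x, hx, rfl⟩) ?_
  rintro x - x' - _ - _ - rfl rfl ⟨u, b, h⟩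
  exact ⟨u, b, Or.inl h⟩

theorem classCount_oneSided_le_fixed {S : Set (Set ℂ)} (hfin : (classes fixedSetoid S).Finite) :
    classCount oneSidedSetoid S ≤ classCount fixedSetoid S ∧ (classes oneSidedSetoid S).Finite := by
  refine classCount_le_of_rel hfin (fun x y => x = y) (fun x hx => ⟨x, hx, rfl⟩) ?_
  rintro x - x' - _ - _ - rfl rfl ⟨b, h⟩
  exact ⟨1, b, by simpa using h⟩

/-- The three ways of counting Tangles differ by a factor of at most eight. -/
theorem classCount_compare {S : Set (Set ℂ)} (hS : ∀ Γ ∈ S, IsTangle Γ)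
    (hfin : (classes fixedSetoid S).Finite) :
    classCount fixedSetoid S ≤ 8 * classCount freeSetoid S ∧
      classCount freeSetoid S ≤ classCount oneSidedSetoid S ∧
      classCount oneSidedSetoid S ≤ classCount fixedSetoid S := by
  obtain ⟨h1, h2⟩ := classCount_oneSided_le_fixed hfin
  obtain ⟨h3, h4⟩ := classCount_free_le_oneSided h2
  exact ⟨classCount_fixed_le_free hS h4, h3, h1⟩

theorem tanglesOfSize_compare (m : ℕ) :
    tanglesOfSize fixedSetoid m ≤ 8 * tanglesOfSize freeSetoid m ∧
      tanglesOfSize freeSetoid m ≤ tanglesOfSize oneSidedSetoid m ∧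
      tanglesOfSize oneSidedSetoid m ≤ tanglesOfSize fixedSetoid m :=
  classCount_compare (fun _ h => h.1) (tanglesOfSize_le_classCount m).2

theorem tanglesOfClass_compare (c : ℕ) :
    tanglesOfClass fixedSetoid c ≤ 8 * tanglesOfClass freeSetoid c ∧
      tanglesOfClass freeSetoid c ≤ tanglesOfClass oneSidedSetoid c ∧
      tanglesOfClass oneSidedSetoid c ≤ tanglesOfClass fixedSetoid c :=
  classCount_compare (fun _ h => ⟨_, h⟩) (finite_classes_tanglesOfClass c)


/-! ### Growth constants -/

open Filter Topology

theorem pos_of_supermultiplicative {b : ℕ → ℕ} (h1 : 0 < b 1)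
    (hmul : ∀ m n, 0 < m → 0 < n → b m * b n ≤ b (m + n)) {n : ℕ} (hn : 0 < n) : 0 < b n := by
  induction n, hn using Nat.le_induction with
  | base => exact h1
  | succ n hn ih => exact (Nat.mul_pos ih h1).trans_le (hmul n 1 hn one_pos)

/-- Fekete's lemma for supermultiplicative sequences. -/
theorem exists_tendsto_log_div {b : ℕ → ℕ} (h1 : 0 < b 1)
    (hmul : ∀ m n, 0 < m → 0 < n → b m * b n ≤ b (m + n)) {K : ℕ}
    (hK : ∀ n, 0 < n → b n ≤ 2 ^ (K * n)) :
    ∃ l : ℝ, Tendsto (fun n : ℕ => Real.log (b n) / n) atTop (𝓝 l) := by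
  have hpos : ∀ n, 0 < n → (0 : ℝ) < b n := fun n hn =>
    Nat.cast_pos.2 (pos_of_supermultiplicative h1 hmul hn)
  -- Nothing is assumed about `b 0`; the value `0` keeps `u` subadditive there.
  let u : ℕ → ℝ := fun n => if n = 0 then 0 else -Real.log (b n)
  have hu : Subadditive u := by
    intro m n
    rcases Nat.eq_zero_or_pos m with rfl | hm
    · simp [u]
    rcases Nat.eq_zero_or_pos n with rfl | hn
    · simp [u]
    have h2 : Real.log (b m) + Real.log (b n) ≤ Real.log (b (m + n)) := by
      rw [← Real.log_mul (hpos m hm).ne' (hpos n hn).ne']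
      exact Real.log_le_log (mul_pos (hpos m hm) (hpos n hn)) (by exact_mod_cast hmul m n hm hn)
    simp only [u, hm.ne', hn.ne', (Nat.add_pos_left hm n).ne', if_false]
    linarith
  have hbdd : BddBelow (Set.range fun n : ℕ => u n / n) := by
    refine ⟨-(K * Real.log 2), ?_⟩
    rintro _ ⟨n, rfl⟩
    rcases Nat.eq_zero_or_pos n with rfl | hn
    · simp only [Nat.cast_zero, div_zero, Left.neg_nonpos_iff]
      have := Real.log_nonneg one_le_two
      positivity
    · have hn' : (0 : ℝ) < n := Nat.cast_pos.2 hn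
      have h2 : Real.log (b n) ≤ (K * n : ℕ) * Real.log 2 := by
        rw [← Real.log_pow]
        exact Real.log_le_log (hpos n hn) (by exact_mod_cast hK n hn)
      simp only [u, hn.ne', if_false]
      rw [le_div_iff₀ hn']
      push_cast at h2
      linarith
  refine ⟨-hu.lim, ((hu.tendsto_lim hbdd).neg).congr fun n => ?_⟩
  rcases Nat.eq_zero_or_pos n with rfl | hn
  · simp
  · simp only [u, hn.ne', if_false]
    rw [neg_div, neg_neg]

theorem isGrowthConstant_of_log {a : ℕ → ℕ} {l : ℝ} (hpos : ∀ᶠ n in atTop, 0 < a n)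
    (h : Tendsto (fun n : ℕ => Real.log (a n) / n) atTop (𝓝 l)) :
    IsGrowthConstant a (Real.exp l) := by
  refine ((Real.continuous_exp.tendsto l).comp h).congr' ?_
  filter_upwards [hpos] with n hn
  rw [Real.rpow_def_of_pos (Nat.cast_pos.2 hn), mul_one_div]
  rfl

theorem tendsto_div_of_tendsto_succ {f : ℕ → ℝ} {l : ℝ}
    (h : Tendsto (fun n : ℕ => f (n + 1) / n) atTop (𝓝 l)) :
    Tendsto (fun n : ℕ => f n / n) atTop (𝓝 l) := by
  rw [← tendsto_add_atTop_iff_nat 1]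
  have h2 := h.mul (tendsto_natCast_div_add_atTop (1 : ℝ))
  rw [mul_one] at h2
  refine h2.congr' ?_
  filter_upwards [eventually_gt_atTop 0] with n hn
  have : (n : ℝ) ≠ 0 := Nat.cast_ne_zero.2 hn.ne'
  push_cast
  field_simp

theorem tendsto_succ_div_of_tendsto {f : ℕ → ℝ} {l : ℝ}
    (h : Tendsto (fun n : ℕ => f n / n) atTop (𝓝 l)) :
    Tendsto (fun n : ℕ => f (n + 1) / n) atTop (𝓝 l) := by
  have h2 := ((tendsto_add_atTop_iff_nat 1).2 h).div (tendsto_natCast_div_add_atTop (1 : ℝ))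
    one_ne_zero
  rw [div_one] at h2
  refine h2.congr' ?_
  filter_upwards [eventually_gt_atTop 0] with n hn
  have : (n : ℝ) ≠ 0 := Nat.cast_ne_zero.2 hn.ne'
  simp only [Pi.div_apply]
  push_cast
  field_simp

theorem tendsto_two_mul_div {f : ℕ → ℝ} {l : ℝ} (h : Tendsto (fun n : ℕ => f n / n) atTop (𝓝 l)) :
    Tendsto (fun n : ℕ => f (2 * n) / n) atTop (𝓝 (2 * l)) := by
  have h2 := (h.comp (tendsto_id.const_mul_atTop' (two_pos : 0 < 2))).const_mul 2
  refine h2.congr fun n => ?_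
  simp only [Function.comp_apply, id]
  push_cast
  rw [← mul_div_assoc, mul_div_mul_left _ _ (two_ne_zero' ℝ)]

theorem le_of_tendsto_log {f g : ℕ → ℕ} {l l' : ℝ}
    (hf : Tendsto (fun n : ℕ => Real.log (f n) / n) atTop (𝓝 l))
    (hg : Tendsto (fun n : ℕ => Real.log (g n) / n) atTop (𝓝 l'))
    (hpos : ∀ᶠ n in atTop, 0 < f n) (h : ∀ᶠ n in atTop, f n ≤ g n) : l ≤ l' := by
  refine le_of_tendsto_of_tendsto hf hg ?_
  filter_upwards [hpos, h] with n h1 h2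
  exact div_le_div_of_nonneg_right
    (Real.log_le_log (Nat.cast_pos.2 h1) (Nat.cast_le.2 h2)) (Nat.cast_nonneg n)

/-- Sequences that differ by a bounded factor grow alike. -/
theorem tendsto_log_of_compare {f g : ℕ → ℕ} {l : ℝ}
    (hf : Tendsto (fun n : ℕ => Real.log (f n) / n) atTop (𝓝 l))
    (hpos : ∀ᶠ n in atTop, 0 < f n) (h : ∀ n, f n ≤ 8 * g n) (h' : ∀ n, g n ≤ f n) :
    Tendsto (fun n : ℕ => Real.log (g n) / n) atTop (𝓝 l) := by
  have h8 : Tendsto (fun n : ℕ => Real.log (f n) / n - Real.log 8 / n) atTop (𝓝 l) := by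
    simpa using hf.sub (tendsto_const_div_atTop_nhds_zero_nat (Real.log 8))
  refine tendsto_of_tendsto_of_tendsto_of_le_of_le' h8 hf ?_ ?_
  · filter_upwards [hpos] with n hn
    have hg : 0 < g n := by have := h n; omega
    rw [← sub_div]
    refine div_le_div_of_nonneg_right ?_ (Nat.cast_nonneg n)
    rw [sub_le_iff_le_add', ← Real.log_mul (by norm_num) (Nat.cast_pos.2 hg).ne']
    exact Real.log_le_log (Nat.cast_pos.2 hn) (by exact_mod_cast h n)
  · filter_upwards [hpos] with n hn
    have hg : 0 < g n := by have := h n; omega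
    exact div_le_div_of_nonneg_right
      (Real.log_le_log (Nat.cast_pos.2 hg) (Nat.cast_le.2 (h' n))) (Nat.cast_nonneg n)

theorem isGrowthConstant_of_compare {f g : ℕ → ℕ} {l : ℝ}
    (hf : Tendsto (fun n : ℕ => Real.log (f n) / n) atTop (𝓝 l))
    (hpos : ∀ᶠ n in atTop, 0 < f n) (h : ∀ n, f n ≤ 8 * g n) (h' : ∀ n, g n ≤ f n) :
    IsGrowthConstant g (Real.exp l) := by
  refine isGrowthConstant_of_log ?_ (tendsto_log_of_compare hf hpos h h')
  filter_upwards [hpos] with n hn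
  have := h n
  omega

/-! ### Exponential upper bounds -/

theorem tanglesOfClass_le_two_pow {c : ℕ} (hc : 0 < c) : tanglesOfClass fixedSetoid c ≤ 2 ^ (6 * c) := by
  refine (tanglesOfClass_le c).trans ?_
  rw [show 4 = 2 ^ 2 from rfl, ← pow_add]
  exact Nat.pow_le_pow_right two_pos (by omega)

/-- A Tangle of size `m` has class at most `m + 1`, so the bounds for these `m + 2` classes are
added up. The constant `7` is merely convenient. -/
theorem tanglesOfSize_le_two_pow (m : ℕ) : tanglesOfSize fixedSetoid m ≤ 2 ^ (7 * (m + 1)) := by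
  have h1 : ∀ c ∈ Finset.range (m + 2), tanglesOfClass fixedSetoid c ≤ 4 * 2 ^ (4 * (m + 1)) := by
    intro c hc
    rw [Finset.mem_range] at hc
    exact (tanglesOfClass_le c).trans
      (Nat.mul_le_mul_left _ (Nat.pow_le_pow_right two_pos (by omega)))
  have h2 := (tanglesOfSize_le_sum m).trans (Finset.sum_le_card_nsmul _ _ _ h1)
  rw [Finset.card_range, smul_eq_mul] at h2
  have h3 : m + 2 ≤ 2 ^ (m + 1) := Nat.lt_two_pow_self
  calc tanglesOfSize fixedSetoid m ≤ (m + 2) * (4 * 2 ^ (4 * (m + 1))) := h2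
    _ ≤ 2 ^ (m + 1) * (2 ^ 2 * 2 ^ (4 * (m + 1))) := Nat.mul_le_mul_right _ h3
    _ = 2 ^ (m + 1 + (2 + 4 * (m + 1))) := by rw [← pow_add, ← pow_add]
    _ ≤ 2 ^ (7 * (m + 1)) := Nat.pow_le_pow_right two_pos (by omega)

/-! ### Limits -/

theorem exists_limit_polyominoesOfArea :
    ∃ l, Tendsto (fun n : ℕ => Real.log (polyominoesOfArea n) / n) atTop (𝓝 l) := by
  refine exists_tendsto_log_div polyominoesOfArea_one_pos
    (fun m n _ _ => polyominoesOfArea_mul_le m n) (K := 7) fun n hn => ?_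
  obtain ⟨m, rfl⟩ := Nat.exists_eq_succ_of_ne_zero hn.ne'
  exact (polyominoesOfArea_le m).1.trans (tanglesOfSize_le_two_pow m)

/-- Supermultiplicativity holds for the sequence shifted by one, as gluing loses one unit of
half-perimeter. The shift does not affect the limit. -/
theorem exists_limit_polyominoesOfHalfPerimeter :
    ∃ l, Tendsto (fun n : ℕ => Real.log (polyominoesOfHalfPerimeter n) / n) atTop (𝓝 l) := by
  obtain ⟨l, hl⟩ := exists_tendsto_log_div (b := fun n => polyominoesOfHalfPerimeter (n + 1))
    polyominoesOfHalfPerimeter_two_pos (fun m n _ _ => polyominoesOfHalfPerimeter_mul_le m n) (K := 6)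
    fun n hn => (polyominoesOfHalfPerimeter_le n).1.trans (tanglesOfClass_le_two_pow hn)
  exact ⟨l, tendsto_div_of_tendsto_succ (f := fun n => Real.log (polyominoesOfHalfPerimeter n)) hl⟩

theorem tanglesOfSize_pred_mul_le (m n : ℕ) (hm : 0 < m) (hn : 0 < n) :
    tanglesOfSize fixedSetoid (m - 1) * tanglesOfSize fixedSetoid (n - 1) ≤
      tanglesOfSize fixedSetoid (m + n - 1) := by
  have := tanglesOfSize_mul_le (m - 1) (n - 1)
  rwa [show m - 1 + (n - 1) + 1 = m + n - 1 by omega] at this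

theorem tanglesOfSize_pos (m : ℕ) : 0 < tanglesOfSize fixedSetoid m :=
  pos_of_supermultiplicative (b := fun n => tanglesOfSize fixedSetoid (n - 1)) tanglesOfSize_zero_pos
    tanglesOfSize_pred_mul_le (Nat.succ_pos m)

theorem tanglesOfClass_pos {c : ℕ} (hc : 0 < c) : 0 < tanglesOfClass fixedSetoid c :=
  pos_of_supermultiplicative tanglesOfClass_one_pos (fun m n _ _ => tanglesOfClass_mul_le m n) hc

theorem polyominoesOfArea_pos {m : ℕ} (hm : 0 < m) : 0 < polyominoesOfArea m :=
  pos_of_supermultiplicative polyominoesOfArea_one_pos (fun m n _ _ => polyominoesOfArea_mul_le m n) hm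

theorem polyominoesOfHalfPerimeter_pos {c : ℕ} (hc : 0 < c) :
    0 < polyominoesOfHalfPerimeter (c + 1) :=
  pos_of_supermultiplicative (b := fun n => polyominoesOfHalfPerimeter (n + 1))
    polyominoesOfHalfPerimeter_two_pos (fun m n _ _ => polyominoesOfHalfPerimeter_mul_le m n) hc

theorem exists_limit_tanglesOfSize :
    ∃ l, Tendsto (fun n : ℕ => Real.log (tanglesOfSize fixedSetoid n) / n) atTop (𝓝 l) := by
  obtain ⟨l, hl⟩ := exists_tendsto_log_div (b := fun n => tanglesOfSize fixedSetoid (n - 1))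
    tanglesOfSize_zero_pos tanglesOfSize_pred_mul_le (K := 7) fun n hn => by
      obtain ⟨m, rfl⟩ := Nat.exists_eq_succ_of_ne_zero hn.ne'
      exact tanglesOfSize_le_two_pow m
  exact ⟨l, tendsto_succ_div_of_tendsto (f := fun n => Real.log (tanglesOfSize fixedSetoid (n - 1))) hl⟩

theorem exists_limit_tanglesOfClass :
    ∃ l, Tendsto (fun n : ℕ => Real.log (tanglesOfClass fixedSetoid n) / n) atTop (𝓝 l) :=
  exists_tendsto_log_div tanglesOfClass_one_pos (fun m n _ _ => tanglesOfClass_mul_le m n) (K := 6)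
    fun _ hn => tanglesOfClass_le_two_pow hn

end TangleGrowth

/-! ### Comparison of the growth constants -/

open TangleGrowth

theorem mainTheorem3 :
    ∃ κp μp κ μ : ℝ,
      TangleGrowth.IsGrowthConstant TangleGrowth.polyominoesOfArea κp ∧
      TangleGrowth.IsGrowthConstant TangleGrowth.polyominoesOfHalfPerimeter μp ∧
      TangleGrowth.IsGrowthConstant (TangleGrowth.tanglesOfSize TangleGrowth.fixedSetoid) κ ∧
      TangleGrowth.IsGrowthConstant (TangleGrowth.tanglesOfSize TangleGrowth.oneSidedSetoid) κ ∧
      TangleGrowth.IsGrowthConstant (TangleGrowth.tanglesOfSize TangleGrowth.freeSetoid) κ ∧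
      TangleGrowth.IsGrowthConstant (TangleGrowth.tanglesOfClass TangleGrowth.fixedSetoid) μ ∧
      TangleGrowth.IsGrowthConstant (TangleGrowth.tanglesOfClass TangleGrowth.oneSidedSetoid) μ ∧
      TangleGrowth.IsGrowthConstant (TangleGrowth.tanglesOfClass TangleGrowth.freeSetoid) μ ∧
      κp ≤ κ ∧ κ ≤ κp ^ 2 ∧ μp ≤ μ ∧ μ ≤ μp ^ 2 := by
  obtain ⟨αp, hαp⟩ := exists_limit_polyominoesOfArea
  obtain ⟨βp, hβp⟩ := exists_limit_polyominoesOfHalfPerimeter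
  obtain ⟨α, hα⟩ := exists_limit_tanglesOfSize
  obtain ⟨β, hβ⟩ := exists_limit_tanglesOfClass
  have pαp : ∀ᶠ n in Filter.atTop, 0 < polyominoesOfArea n := by
    filter_upwards [Filter.eventually_gt_atTop 0] with n hn
    exact polyominoesOfArea_pos hn
  have pβp : ∀ᶠ n in Filter.atTop, 0 < polyominoesOfHalfPerimeter n := by
    filter_upwards [Filter.eventually_gt_atTop 1] with n hn
    obtain ⟨m, rfl⟩ := Nat.exists_eq_succ_of_ne_zero (by omega : n ≠ 0)
    exact polyominoesOfHalfPerimeter_pos (by omega)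
  have pα : ∀ᶠ n in Filter.atTop, 0 < tanglesOfSize fixedSetoid n :=
    Filter.Eventually.of_forall tanglesOfSize_pos
  have pβ : ∀ᶠ n in Filter.atTop, 0 < tanglesOfClass fixedSetoid n := by
    filter_upwards [Filter.eventually_gt_atTop 0] with n hn
    exact tanglesOfClass_pos hn
  -- All four inequalities are compared on the logarithmic scale, where shifting the index changes
  -- nothing and doubling it doubles the limit.
  have i1 : αp ≤ α :=
    le_of_tendsto_log
      (tendsto_succ_div_of_tendsto (f := fun n => Real.log (polyominoesOfArea n)) hαp) hα
      (Filter.Eventually.of_forall fun n => polyominoesOfArea_pos n.succ_pos)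
      (Filter.Eventually.of_forall fun n => (polyominoesOfArea_le n).1)
  have i2 : α ≤ 2 * αp :=
    le_of_tendsto_log hα
      (tendsto_two_mul_div (f := fun n => Real.log (polyominoesOfArea (n + 1)))
        (tendsto_succ_div_of_tendsto (f := fun n => Real.log (polyominoesOfArea n)) hαp)) pα
      (Filter.Eventually.of_forall tanglesOfSize_le)
  have i3 : βp ≤ β :=
    le_of_tendsto_log
      (tendsto_succ_div_of_tendsto (f := fun n => Real.log (polyominoesOfHalfPerimeter n)) hβp) hβ
      ((Filter.eventually_gt_atTop 0).mono fun n hn => polyominoesOfHalfPerimeter_pos hn)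
      (Filter.Eventually.of_forall fun n => (polyominoesOfHalfPerimeter_le n).1)
  have i4 : β ≤ 2 * βp :=
    le_of_tendsto_log hβ
      (tendsto_two_mul_div (f := fun n => Real.log (polyominoesOfHalfPerimeter n)) hβp) pβ
      (Filter.Eventually.of_forall tanglesOfClass_le_polyominoes)
  have hexp : ∀ x y : ℝ, x ≤ 2 * y → Real.exp x ≤ Real.exp y ^ 2 := fun x y h => by
    rw [← Real.exp_nat_mul]
    exact Real.exp_le_exp.2 (by exact_mod_cast h)
  refine ⟨Real.exp αp, Real.exp βp, Real.exp α, Real.exp β, isGrowthConstant_of_log pαp hαp,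
    isGrowthConstant_of_log pβp hβp, isGrowthConstant_of_log pα hα, ?_, ?_,
    isGrowthConstant_of_log pβ hβ, ?_, ?_, Real.exp_le_exp.2 i1, hexp _ _ i2,
    Real.exp_le_exp.2 i3, hexp _ _ i4⟩
  · exact isGrowthConstant_of_compare hα pα
      (fun n => (tanglesOfSize_compare n).1.trans
        (Nat.mul_le_mul_left _ (tanglesOfSize_compare n).2.1)) fun n => (tanglesOfSize_compare n).2.2
  · exact isGrowthConstant_of_compare hα pα (fun n => (tanglesOfSize_compare n).1)
      fun n => (tanglesOfSize_compare n).2.1.trans (tanglesOfSize_compare n).2.2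
  · exact isGrowthConstant_of_compare hβ pβ
      (fun n => (tanglesOfClass_compare n).1.trans
        (Nat.mul_le_mul_left _ (tanglesOfClass_compare n).2.1))
      fun n => (tanglesOfClass_compare n).2.2
  · exact isGrowthConstant_of_compare hβ pβ (fun n => (tanglesOfClass_compare n).1)
      fun n => (tanglesOfClass_compare n).2.1.trans (tanglesOfClass_compare n).2.2
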